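/- Let $q\ge 4$ be an even integer, $q=2p$, let $\lambda=2\cos\frac{\pi}{q}$ and $\frac12\le\alpha\le\frac1\lambda$. On $X_\alpha=[\lambda(\alpha-1),\lambda\alpha]$ let $T_\alpha(0)=0$ and, for $x\ne0$, $$T_\alpha(x)=\left|\tfrac1x\right|-\lambda d(x),\qquad d(x)=\left\lfloor\left|\tfrac{1}{x\lambda}\right|+1-\alpha\right\rfloor .$$ For $n\ge1$ put $\varepsilon_n=\operatorname{sgn}(T_\alpha^{n-1}(x))$ and $d_n=d(T_\alpha^{n-1}(x))$; let $R_{-1}=1$, $R_0=0$, $S_{-1}=0$, $S_0=1$, $R_n=d_n\lambda R_{n-1}+\varepsilon_nR_{n-2}$, $S_n=d_n\lambda S_{n-1}+\varepsilon_nS_{n-2}$, so that $R_n/S_n$ are the $\alpha$-Rosen convergents of $x$, and let $$\Theta_n(x)=S_n^2\left|x-\frac{R_n}{S_n}\right| .$$ (All of this is meaningful for every $n$ except for the countably many $x$ with a finite expansion.) Let $B_n=\sin\frac{n\pi}{q}/\sin\frac{\pi}{q}$ $(n\in\mathbb Z)$, $\ell_n=T_\alpha^n(\lambda(\alpha-1))$,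 $r_n=T_\alpha^n(\lambda\alpha)$, $H_{2n}=\frac{B_n}{B_{n+1}}$ and $H_{2n-1}=\frac{B_{p-n}-B_{p+1-n}}{B_{p-1-n}-B_{p-n}}$. The domain of the planar natural extension of $T_\alpha$ is, for $\alpha<1/\lambda$, $$\Omega_\alpha=\bigcup_{n=1}^{p-1}\Big([\ell_{n-1},r_n)\times[0,H_{2n-1}]\;\cup\;[r_n,\ell_n)\times[0,H_{2n}]\Big)\;\cup\;[\ell_{p-1},r_0)\times[0,H_{2p-1}],$$ and, for $\alpha=1/\lambda$, $$\Omega_{1/\lambda}=\bigcup_{n=1}^{p-1}\left[\frac{B_n-B_{n+1}}{B_n-B_{n-1}},\frac{B_{n+1}-B_{n+2}}{B_{n+1}-B_n}\right)\times\left[0,\frac{B_n}{B_{n+1}}\right].$$ Let $C_{q,\alpha}$ be the normalizing constant for which $\frac{C_{q,\alpha}}{(1+xy)^2}$ is a probability density on $\Omega_\alpha$, that is, $C_{q,\alpha}^{-1}=\iint_{\Omega_\alpha}\frac{dx\,dy}{(1+xy)^2}$, and let $$\mathcal L_\alpha=\min\left\{\frac{\lambda}{\lambda+2},\frac{\lambda(2-\alpha\lambda^2)}{4-\lambda^2}\right\}.$$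 Then for Lebesgue-almost every $x\in X_\alpha$ and all real $c\ge 1/\mathcal L_\alpha$, $$\lim_{N\to\infty}\frac1N\,\#\left\{n:\ 1\le n\le N,\ \Theta_n(x)<\frac1c\right\}=\frac{\lambda\,C_{q,\alpha}}{c}.$$ -/

import Mathlib

open Filter Topology MeasureTheory

noncomputable section

namespace AlphaRosen

/-- `λ = λ_q = 2 cos (π / q)`. -/
def lam (q : ℕ) : ℝ := 2 * Real.cos (Real.pi / q)

/-- The interval `X_α = [λ(α - 1), λα]` on which the continued fraction map acts. -/
def X (q : ℕ) (α : ℝ) : Set ℝ := Set.Icc (lam q * (α - 1)) (lam q * α)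

/-- The digit `d(x) = ⌊|1/(xλ)| + 1 - α⌋` for `x ≠ 0`. (By convention `d(0) = ∞`; the value of
this function at `0` matters only for those countably many `x` whose expansion is finite.) -/
def digit (q : ℕ) (α x : ℝ) : ℤ := ⌊|1 / (x * lam q)| + 1 - α⌋

/-- The α-Rosen map: `T_α(x) = |1/x| - λ d(x)` for `x ≠ 0`, and `T_α(0) = 0`. -/
def T (q : ℕ) (α x : ℝ) : ℝ :=
  if x = 0 then 0 else |1 / x| - lam q * (digit q α x : ℝ)

/-- The sign digits `ε_n(x) = sgn (T_α^{n-1} x)`, for `n ≥ 1`. -/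
def eps (q : ℕ) (α x : ℝ) (n : ℕ) : ℝ := Real.sign ((T q α)^[n - 1] x)

/-- The digits `d_n(x) = d (T_α^{n-1} x)`, for `n ≥ 1`. -/
def dig (q : ℕ) (α x : ℝ) (n : ℕ) : ℝ := (digit q α ((T q α)^[n - 1] x) : ℝ)

/-- Numerators of the α-Rosen convergents: `R_{-1} = 1`, `R_0 = 0`,
`R_n = d_n λ R_{n-1} + ε_n R_{n-2}`. -/
def R (q : ℕ) (α x : ℝ) : ℕ → ℝ
  | 0 => 0
  | 1 => dig q α x 1 * lam q * 0 + eps q α x 1 * 1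
  | n + 2 => dig q α x (n + 2) * lam q * R q α x (n + 1) + eps q α x (n + 2) * R q α x n

/-- Denominators of the α-Rosen convergents: `S_{-1} = 0`, `S_0 = 1`,
`S_n = d_n λ S_{n-1} + ε_n S_{n-2}`. -/
def S (q : ℕ) (α x : ℝ) : ℕ → ℝ
  | 0 => 1
  | 1 => dig q α x 1 * lam q * 1 + eps q α x 1 * 0
  | n + 2 => dig q α x (n + 2) * lam q * S q α x (n + 1) + eps q α x (n + 2) * S q α x n

/-- The approximation coefficients `Θ_n(x) = S_n² |x - R_n / S_n|`. -/
def Theta (q : ℕ) (α x : ℝ) (n : ℕ) : ℝ :=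
  S q α x n ^ 2 * |x - R q α x n / S q α x n|

/-- The orbit `ℓ_n = T_α^n (ℓ_0)` of the left endpoint `ℓ_0 = (α - 1) λ`. -/
def ell (q : ℕ) (α : ℝ) (n : ℕ) : ℝ := (T q α)^[n] ((α - 1) * lam q)

/-- The orbit `r_n = T_α^n (r_0)` of the right endpoint `r_0 = α λ`. -/
def r (q : ℕ) (α : ℝ) (n : ℕ) : ℝ := (T q α)^[n] (α * lam q)

/-- `B_n = sin (nπ/q) / sin (π/q)` for `n ∈ ℤ`, the solution of
`B_0 = 0`, `B_1 = 1`, `B_n = λ B_{n-1} - B_{n-2}` (see the three lemmas below). -/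
def B (q : ℕ) (n : ℤ) : ℝ := Real.sin (n * Real.pi / q) / Real.sin (Real.pi / q)

theorem B_zero (q : ℕ) : B q 0 = 0 := by simp [B]

theorem B_one {q : ℕ} (hq : 2 ≤ q) : B q 1 = 1 := by
  have hq' : (2 : ℝ) ≤ q := by exact_mod_cast hq
  have h : 0 < Real.sin (Real.pi / q) := by
    apply Real.sin_pos_of_pos_of_lt_pi
    · have := Real.pi_pos
      positivity
    · exact div_lt_self Real.pi_pos (by linarith)
  simp [B, h.ne']

theorem B_rec (q : ℕ) (n : ℤ) : B q n = lam q * B q (n - 1) - B q (n - 2) := by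
  have h0 : (n : ℝ) * Real.pi / q = (n - 1) * Real.pi / q + Real.pi / q := by ring
  have h2 : ((n : ℝ) - 2) * Real.pi / q = (n - 1) * Real.pi / q - Real.pi / q := by ring
  simp only [B, lam]
  push_cast
  rw [h0, h2, Real.sin_add, Real.sin_sub]
  ring

/-- The heights with even index (`q = 2p`): `H_{2n} = B_n / B_{n+1}`, `1 ≤ n ≤ p - 1`. -/
def Heven (q : ℕ) (n : ℤ) : ℝ := B q n / B q (n + 1)

/-- The heights with odd index (`q = 2p`):
`H_{2n-1} = (B_{p-n} - B_{p+1-n}) / (B_{p-1-n} - B_{p-n})`, `1 ≤ n ≤ p`. -/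
def Hodd (q : ℕ) (n : ℤ) : ℝ :=
  (B q ((q / 2 : ℕ) - n) - B q ((q / 2 : ℕ) + 1 - n)) /
    (B q ((q / 2 : ℕ) - 1 - n) - B q ((q / 2 : ℕ) - n))

/-- The domain of the planar natural extension for `q = 2p` and `1/2 ≤ α < 1/λ`: the union of
`[ℓ_{n-1}, r_n) × [0, H_{2n-1}]` and `[r_n, ℓ_n) × [0, H_{2n}]` for `1 ≤ n ≤ p - 1`, and of
`[ℓ_{p-1}, r_0) × [0, H_{2p-1}]`. (For `α = 1/2` the intervals `[r_n, ℓ_n)` are empty.) -/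
def OmegaGeneric (q : ℕ) (α : ℝ) : Set (ℝ × ℝ) :=
  (⋃ n ∈ Finset.Icc 1 (q / 2 - 1),
      Set.Ico (ell q α (n - 1)) (r q α n) ×ˢ Set.Icc 0 (Hodd q n) ∪
        Set.Ico (r q α n) (ell q α n) ×ˢ Set.Icc 0 (Heven q n)) ∪
    Set.Ico (ell q α (q / 2 - 1)) (r q α 0) ×ˢ Set.Icc 0 (Hodd q (q / 2 : ℕ))

/-- The domain of the planar natural extension for `q = 2p` and `α = 1/λ`. -/
def OmegaLast (q : ℕ) : Set (ℝ × ℝ) :=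
  ⋃ n ∈ Finset.Icc (1 : ℤ) ((q / 2 : ℕ) - 1),
    Set.Ico ((B q n - B q (n + 1)) / (B q n - B q (n - 1)))
        ((B q (n + 1) - B q (n + 2)) / (B q (n + 1) - B q n)) ×ˢ
      Set.Icc 0 (B q n / B q (n + 1))

open Classical in
/-- The domain `Ω_α` of the planar natural extension of `T_α`, for even `q ≥ 4`
and `1/2 ≤ α ≤ 1/λ`. -/
def Omega (q : ℕ) (α : ℝ) : Set (ℝ × ℝ) :=
  if α = 1 / lam q then OmegaLast q else OmegaGeneric q α

/-- The normalizing constant `C_{q,α}`, which makes `C_{q,α} / (1 + xy)²` a probability density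
on `Ω_α`. -/
def C (q : ℕ) (α : ℝ) : ℝ := (∫ z in Omega q α, 1 / (1 + z.1 * z.2) ^ 2)⁻¹

/-- The Lenstra-type constant `L_α = min {λ/(λ+2), λ(2 - αλ²)/(4 - λ²)}`. -/
def L (q : ℕ) (α : ℝ) : ℝ :=
  min (lam q / (lam q + 2)) (lam q * (2 - α * lam q ^ 2) / (4 - lam q ^ 2))

end AlphaRosen

end

/-! The natural extension F(t, v) = (T t, 1/(dλ + sgn(t) v)) acts on a staircase domain Ω and
preserves dt dv/(1 + tv)². Along the orbit of (x, 0) the second coordinate is S_{n-1}/S_n, and Θ_n =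
|t|/(1 + tv) at the n-th point (`Params.Theta_eq`). The limiting frequency of Θ_n < z should
therefore be the normalized mass of {|t|/(1 + tv) < z} in Ω.

The mass. At a fixed level v the substitution y = t/(1 + tv) turns the density into Lebesgue
measure, so a section of Ω contributes the length of its image inside (-z, z). The bound z ≤ L keeps
the right end of every image beyond z and the left end below -z, except for the two innermost steps
of the staircase. Those two deviate from 2z by opposite amounts, exchanged by the reflection v ↦ λ -
v, and the total is exactly λz (`Params.stairMeasure_smallCoeff_of_le`).

Invariance. F maps Ω into itself (`Params.natExt_mem`), is injective off a null set
(`Params.injOn_natExt`), and its Jacobian matches the density. The geometry rests on closed forms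
for thresholds and heights in terms of B_n: both are orbits of z ↦ 1/(λ - z), and B_{p+1} = B_{p-1}
makes them close up.

Ergodicity of T. The λ-periodic extension D of an invariant set is unchanged, on transcendental
points, by x ↦ -x and x ↦ 1/x (`TailInvariant.neg_iff`, `TailInvariant.inv_iff`), hence by the
Möbius maps of the convergents. These have unit determinant and bounded distortion, so if the
complement of D has positive measure it has density bounded below at all small scales S_n⁻² around
almost every point. Lebesgue's density theorem then makes D null (`Params.volume_inter_eq_zero`).

Frequencies. F contracts vertical lines, so Θ_n is determined up to a small error by the last 2k
digits, that is, by a function of one point of the T-orbit. One-sided ergodic bounds for T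
(`ae_card_visits_le`) thus suffice, and neither ergodicity of F nor genericity of the null line v =
0 is needed. -/

open Filter Topology MeasureTheory

/-! ### One-sided pointwise ergodic bounds. -/

namespace AlphaRosen

/-- Running maxima of the Birkhoff sums of `f`: `birkhoffMax T f n` is the maximum of the sums of
length `1, …, n + 1`. -/
noncomputable def birkhoffMax {Ω : Type*} (T : Ω → Ω) (f : Ω → ℝ) : ℕ → Ω → ℝ
  | 0 => f
  | n + 1 => fun x => f x + max 0 (birkhoffMax T f n (T x))

section Birkhoff

variable {Ω : Type*} {T : Ω → Ω} {f : Ω → ℝ}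

theorem birkhoffMax_le_succ (n : ℕ) (x : Ω) :
    birkhoffMax T f n x ≤ birkhoffMax T f (n + 1) x := by
  induction n generalizing x with
  | zero => simp [birkhoffMax]
  | succ n ih =>
    have := ih (T x)
    simp only [birkhoffMax] at this ⊢
    gcongr

theorem birkhoffMax_mono (x : Ω) : Monotone fun n => birkhoffMax T f n x :=
  monotone_nat_of_le_succ fun n => birkhoffMax_le_succ n x

theorem birkhoffSum_le_birkhoffMax (n : ℕ) (x : Ω) :
    birkhoffSum T f (n + 1) x ≤ birkhoffMax T f n x := by
  induction n generalizing x with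
  | zero => simp [birkhoffMax]
  | succ n ih =>
    rw [birkhoffSum_succ']
    simp only [birkhoffMax]
    have := (ih (T x)).trans (le_max_right 0 _)
    linarith

theorem measurable_birkhoffMax [MeasurableSpace Ω] (hT : Measurable T) (hf : Measurable f) (n : ℕ) :
    Measurable (birkhoffMax T f n) := by
  induction n with
  | zero => exact hf
  | succ n ih => exact hf.add (measurable_const.max (ih.comp hT))

theorem abs_birkhoffMax_le {M : ℝ} (hf : ∀ x, |f x| ≤ M) (n : ℕ) (x : Ω) :
    |birkhoffMax T f n x| ≤ (n + 1) * M := by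
  have hM : 0 ≤ M := (abs_nonneg _).trans (hf x)
  induction n generalizing x with
  | zero => simpa [birkhoffMax] using hf x
  | succ n ih =>
    simp only [birkhoffMax]
    have h1 := abs_le.1 (hf x)
    have h2 := abs_le.1 (ih (T x))
    have h3 : max 0 (birkhoffMax T f n (T x)) ≤ (n + 1) * M := max_le (by positivity) h2.2
    have h4 : 0 ≤ max 0 (birkhoffMax T f n (T x)) := le_max_left _ _
    push_cast
    rw [abs_le]
    constructor <;> nlinarith

/-- If a bounded function has negative integral, its Birkhoff sums along an ergodic map are
almost surely bounded above. -/
theorem ae_bddAbove_birkhoffSum [MeasurableSpace Ω] {μ : Measure Ω} [IsProbabilityMeasure μ]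
    (hT : Ergodic T μ) (hf : Measurable f) {M : ℝ} (hM : ∀ x, |f x| ≤ M) (hint : ∫ x, f x ∂μ < 0) :
    ∀ᵐ x ∂μ, ∃ b : ℝ, ∀ n, birkhoffSum T f n x ≤ b := by
  set E : Set Ω := {x | Tendsto (fun n => birkhoffMax T f n x) atTop atTop} with hE
  have hmeas : ∀ n, Measurable (birkhoffMax T f n) := measurable_birkhoffMax hT.measurable hf
  have hEm : MeasurableSet E := by
    have : E = ⋂ k : ℕ, ⋃ n : ℕ, {x | (k : ℝ) ≤ birkhoffMax T f n x} := by
      ext x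
      simp only [hE, Set.mem_ofPred_eq, Set.mem_iInter, Set.mem_iUnion]
      constructor
      · intro h k
        exact (h.eventually_ge_atTop (k : ℝ)).exists
      · intro h
        refine tendsto_atTop_atTop_of_monotone (birkhoffMax_mono x) fun b => ?_
        obtain ⟨k, hk⟩ := exists_nat_ge b
        obtain ⟨n, hn⟩ := h k
        exact ⟨n, hk.trans hn⟩
    rw [this]
    exact MeasurableSet.iInter fun k => MeasurableSet.iUnion fun n =>
      measurableSet_le measurable_const (hmeas n)
  -- Once the maximum at `T x` is positive, the recursion changes it only by the constant `f x`, so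
  -- divergence at `x` and at `T x` are equivalent.
  have hEinv : T ⁻¹' E = E := by
    ext x
    simp only [hE, Set.mem_preimage, Set.mem_ofPred_eq]
    rw [← tendsto_add_atTop_iff_nat (f := fun n => birkhoffMax T f n x) 1]
    simp only [birkhoffMax]
    constructor
    · intro h
      exact tendsto_atTop_add_const_left _ _
        (tendsto_atTop_mono (fun n => le_max_right _ _) h)
    · intro h
      have h' : Tendsto (fun n => max 0 (birkhoffMax T f n (T x))) atTop atTop := by
        simpa using tendsto_atTop_add_const_left _ (-f x) h
      refine h'.congr' ?_
      filter_upwards [h'.eventually_gt_atTop 0] with n hn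
      rcases lt_max_iff.1 hn with h | h
      · exact absurd h (lt_irrefl _)
      · exact max_eq_right h.le
  rcases hT.toPreErgodic.ae_mem_or_ae_notMem hEm hEinv with h | h
  · exfalso
    -- The integrand is f - min(0, M_n ∘ T). It is bounded by 2M because M_n ≥ f, and on `E` it
    -- eventually equals f.
    have hlim : Tendsto (fun n => ∫ x, (birkhoffMax T f (n + 1) x - birkhoffMax T f n (T x)) ∂μ)
        atTop (𝓝 (∫ x, f x ∂μ)) := by
      refine tendsto_integral_of_dominated_convergence (fun _ => 2 * M)
        (fun n => ((hmeas _).sub ((hmeas n).comp hT.measurable)).aestronglyMeasurable)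
        (integrable_const _) (fun n => Eventually.of_forall fun x => ?_) ?_
      · simp only [birkhoffMax, Real.norm_eq_abs]
        have h1 := abs_le.1 (hM x)
        have h2 := abs_le.1 (hM (T x))
        have h3 : f (T x) ≤ birkhoffMax T f n (T x) := birkhoffMax_mono (T := T) (f := f) (T x) (Nat.zero_le n)
        rw [abs_le]
        rcases max_cases 0 (birkhoffMax T f n (T x)) with ⟨h4, h5⟩ | ⟨h4, h5⟩ <;> rw [h4] <;>
          constructor <;> linarith
      · filter_upwards [h] with x hx
        have hx' : T x ∈ E := by rw [← hEinv] at hx; exact hx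
        refine tendsto_const_nhds.congr' ?_
        filter_upwards [Tendsto.eventually_ge_atTop hx' 0] with n hn
        simp [birkhoffMax, max_eq_right hn]
    have hI : ∀ n, Integrable (birkhoffMax T f n) μ := fun n =>
      Integrable.of_bound (hmeas n).aestronglyMeasurable ((n + 1) * M)
        (Eventually.of_forall fun x => abs_birkhoffMax_le hM n x)
    -- Invariance of μ turns the integral into that of M_{n+1} - M_n ≥ 0; in the limit ∫ f ≥ 0,
    -- contrary to assumption.
    have hpos : ∀ n, 0 ≤ ∫ x, (birkhoffMax T f (n + 1) x - birkhoffMax T f n (T x)) ∂μ := by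
      intro n
      have hc : Integrable (fun x => birkhoffMax T f n (T x)) μ :=
        hT.toMeasurePreserving.integrable_comp_of_integrable (hI n)
      rw [integral_sub (hI _) hc]
      have : ∫ x, birkhoffMax T f n (T x) ∂μ = ∫ x, birkhoffMax T f n x ∂μ := by
        rw [← hT.toMeasurePreserving.map_eq, integral_map hT.measurable.aemeasurable
          (hmeas n).aestronglyMeasurable, hT.toMeasurePreserving.map_eq]
      rw [this, sub_nonneg]
      exact integral_mono (hI n) (hI _) fun x => birkhoffMax_le_succ n x
    exact absurd (ge_of_tendsto' hlim hpos) (not_le.2 hint)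
  · filter_upwards [h] with x hx
    have hb : ¬ ∀ b, ∃ n, b ≤ birkhoffMax T f n x := fun hb =>
      hx (tendsto_atTop_atTop_of_monotone (birkhoffMax_mono x) hb)
    push Not at hb
    obtain ⟨b, hb⟩ := hb
    refine ⟨max 0 b, fun n => ?_⟩
    cases n with
    | zero => simp
    | succ n => exact ((birkhoffSum_le_birkhoffMax n x).trans (hb n).le).trans (le_max_right _ _)

open Classical in
/-- Upper half of the pointwise ergodic theorem for an indicator function. -/
theorem ae_card_visits_le [MeasurableSpace Ω] {μ : Measure Ω} [IsProbabilityMeasure μ]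
    (hT : Ergodic T μ) {A : Set Ω} (hA : MeasurableSet A) {s : ℝ} (hs : μ.real A < s) :
    ∀ᵐ x ∂μ, ∃ b : ℝ, ∀ n : ℕ,
      (((Finset.range n).filter fun k => T^[k] x ∈ A).card : ℝ) ≤ n * s + b := by
  have hf : Measurable fun x => A.indicator (fun _ => (1 : ℝ)) x - s :=
    (measurable_const.indicator hA).sub_const s
  have hM : ∀ x, |A.indicator (fun _ => (1 : ℝ)) x - s| ≤ 1 + |s| := by
    intro x
    refine (abs_sub _ _).trans (by gcongr; by_cases h : x ∈ A <;> simp [h])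
  have hint : ∫ x, (A.indicator (fun _ => (1 : ℝ)) x - s) ∂μ < 0 := by
    rw [integral_sub ((integrable_const _).indicator hA) (integrable_const _),
      integral_indicator_const _ hA]
    simpa using hs
  filter_upwards [ae_bddAbove_birkhoffSum hT hf hM hint] with x ⟨b, hb⟩
  refine ⟨b, fun n => ?_⟩
  have h := hb n
  simp only [birkhoffSum, Finset.sum_sub_distrib, Finset.sum_const, Finset.card_range,
    nsmul_eq_mul] at h
  have h2 : ∑ k ∈ Finset.range n, A.indicator (fun _ => (1 : ℝ)) (T^[k] x) =
      (((Finset.range n).filter fun k => T^[k] x ∈ A).card : ℝ) := by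
    rw [Finset.card_filter]
    push_cast
    refine Finset.sum_congr rfl fun k _ => ?_
    simp [Set.indicator_apply]
  linarith

end Birkhoff

end AlphaRosen

/-! ### The number λ and the sequence B_n. -/

namespace AlphaRosen

section Lam

variable {q : ℕ}

theorem two_le_lam_sq (hq : 4 ≤ q) : 2 ≤ lam q ^ 2 := by
  have hq' : (4 : ℝ) ≤ q := by exact_mod_cast hq
  have h : Real.cos (Real.pi / 4) ≤ Real.cos (Real.pi / q) := by
    apply Real.cos_le_cos_of_nonneg_of_le_pi
    · have := Real.pi_pos; positivity
    · linarith [Real.pi_pos]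
    · exact div_le_div_of_nonneg_left Real.pi_pos.le (by norm_num) hq'
  rw [Real.cos_pi_div_four] at h
  have h2 : (0 : ℝ) < √2 := by positivity
  have h3 : √2 ^ 2 = 2 := Real.sq_sqrt (by norm_num)
  have : √2 ≤ lam q := by unfold lam; linarith
  nlinarith

theorem lam_pos (hq : 4 ≤ q) : 0 < lam q := by
  have hq' : (4 : ℝ) ≤ q := by exact_mod_cast hq
  have : 0 < Real.cos (Real.pi / q) := by
    apply Real.cos_pos_of_mem_Ioo
    constructor
    · have := Real.pi_pos
      have : 0 < Real.pi / q := by positivity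
      linarith
    · exact div_lt_div_of_pos_left Real.pi_pos (by norm_num) (by linarith)
  unfold lam
  linarith

theorem one_lt_lam (hq : 4 ≤ q) : 1 < lam q := by
  nlinarith [lam_pos hq, two_le_lam_sq hq]

theorem lam_lt_two (hq : 4 ≤ q) : lam q < 2 := by
  have hq' : (4 : ℝ) ≤ q := by exact_mod_cast hq
  have : Real.cos (Real.pi / q) < Real.cos 0 := by
    apply Real.cos_lt_cos_of_nonneg_of_le_pi le_rfl
    · exact div_le_self Real.pi_pos.le (by linarith)
    · have := Real.pi_pos; positivity
  rw [Real.cos_zero] at this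
  unfold lam
  linarith

/-- Ensures that transcendental points stay transcendental under every branch, so that no orbit
considered later hits 0 or an endpoint. -/
theorem lam_isAlgebraic (q : ℕ) : IsAlgebraic ℚ (lam q) := by
  have h := (Real.isIntegral_two_mul_cos_rat_mul_pi (1 / q : ℚ)).isAlgebraic
  have h2 : lam q = 2 * Real.cos (((1 / q : ℚ) : ℝ) * Real.pi) := by
    unfold lam; push_cast; congr 2; ring
  rw [h2]
  exact h.extendScalars (Int.cast_injective)

theorem B_lt_B (hq : 4 ≤ q) (hqe : Even q) {a b : ℤ} (ha : -((q / 2 : ℕ) : ℤ) ≤ a) (hab : a < b)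
    (hb : b ≤ ((q / 2 : ℕ) : ℤ)) : B q a < B q b := by
  obtain ⟨p, rfl⟩ := hqe
  have hp : (p + p) / 2 = p := by omega
  rw [hp] at ha hb
  have hp0 : (0 : ℝ) < p := by exact_mod_cast (by omega : 0 < p)
  have hs : 0 < Real.sin (Real.pi / ((p + p : ℕ) : ℝ)) := by
    apply Real.sin_pos_of_pos_of_lt_pi
    · have := Real.pi_pos; positivity
    · apply div_lt_self Real.pi_pos
      exact_mod_cast (by omega : 1 < p + p)
  unfold B
  apply div_lt_div_of_pos_right _ hs
  have ha' : -(p : ℝ) ≤ a := by exact_mod_cast ha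
  have hb' : (b : ℝ) ≤ p := by exact_mod_cast hb
  have hab' : (a : ℝ) < b := by exact_mod_cast hab
  have hpi := Real.pi_pos
  apply Real.sin_lt_sin_of_lt_of_le_pi_div_two
  · rw [le_div_iff₀ (by positivity)]
    push_cast
    nlinarith
  · rw [div_le_iff₀ (by positivity)]
    push_cast
    nlinarith
  · gcongr

theorem B_pos (hq : 4 ≤ q) (hqe : Even q) {k : ℤ} (hk : 0 < k) (hk' : k ≤ ((q / 2 : ℕ) : ℤ)) :
    0 < B q k := by
  have := B_lt_B hq hqe (by omega) hk hk'
  rwa [B_zero] at this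

theorem B_nonneg (hq : 4 ≤ q) (hqe : Even q) {k : ℤ} (hk : 0 ≤ k) (hk' : k ≤ ((q / 2 : ℕ) : ℤ)) :
    0 ≤ B q k := by
  rcases hk.eq_or_lt with rfl | h
  · rw [B_zero]
  · exact (B_pos hq hqe h hk').le

theorem B_neg_one (hq : 4 ≤ q) : B q (-1) = -1 := by
  have := B_rec q 1
  rw [B_one (by omega)] at this
  norm_num [B_zero] at this
  linarith

theorem B_two (hq : 4 ≤ q) : B q 2 = lam q := by
  have := B_rec q 2
  norm_num [B_zero, B_one (by omega : 2 ≤ q)] at this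
  exact this

theorem lam_mul_B (q : ℕ) (n : ℤ) : lam q * B q n = B q (n + 1) + B q (n - 1) := by
  have := B_rec q (n + 1)
  rw [show n + 1 - 1 = n by ring, show n + 1 - 2 = n - 1 by ring] at this
  linarith

/-- For q = 2p the angle pπ/q is π/2, about which the sine is symmetric. This boundary condition
makes the threshold and height recursions end in closed form. -/
theorem B_half_succ (hq : 4 ≤ q) (hqe : Even q) :
    B q ((q / 2 : ℕ) + 1) = B q ((q / 2 : ℕ) - 1) := by
  obtain ⟨p, rfl⟩ := hqe
  have hp : (p + p) / 2 = p := by omega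
  have hp0 : (p : ℝ) ≠ 0 := by exact_mod_cast (by omega : p ≠ 0)
  rw [hp]
  unfold B
  congr 1
  rw [← Real.sin_pi_sub]
  congr 1
  push_cast
  field_simp
  ring

theorem B_half_pred (hq : 4 ≤ q) (hqe : Even q) :
    B q ((q / 2 : ℕ) - 1) = lam q / 2 * B q (q / 2 : ℕ) := by
  have := lam_mul_B q (q / 2 : ℕ)
  rw [B_half_succ hq hqe] at this
  linarith

end Lam

/-! ### Closed forms for the chain of thresholds and for the heights. -/

/-- The orbit of the two points `-a` and `a / (1 + l a)`, interlaced, under `z ↦ 1 / (l - z)`. -/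
noncomputable def chain (l a : ℝ) : ℕ → ℝ
  | 0 => -a
  | 1 => a / (1 + l * a)
  | n + 2 => 1 / (l - chain l a n)

/-- The heights of the planar domain, in increasing order. -/
noncomputable def height (l : ℝ) : ℕ → ℝ
  | 0 => 0
  | 1 => 1 / (l + 1)
  | n + 2 => 1 / (l - height l n)

section Chain

variable {q : ℕ} {a : ℝ}

theorem chain_even_den_pos (hq : 4 ≤ q) (hqe : Even q) (ha : 0 ≤ a) {k : ℕ} (hk : k + 1 ≤ q / 2) :
    0 < B q (k + 1) + a * B q k := by
  have h1 := B_pos hq hqe (k := (k : ℤ) + 1) (by omega) (by omega)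
  have h2 := B_nonneg hq hqe (k := (k : ℤ)) (by omega) (by omega)
  positivity

theorem chain_odd_den_pos (hq : 4 ≤ q) (hqe : Even q) (ha : 0 ≤ a) {k : ℕ} (hk : k + 2 ≤ q / 2) :
    0 < B q (k + 1) + a * B q (k + 2) := by
  have h1 := B_pos hq hqe (k := (k : ℤ) + 1) (by omega) (by omega)
  have h2 := B_nonneg hq hqe (k := (k : ℤ) + 2) (by omega) (by omega)
  positivity

/-- The map z ↦ 1/(λ - z) advances the ratio of consecutive terms of any solution of u_{n+1} = λu_n
- u_{n-1}; the solution B_n + aB_{n-1} starts from the ratio -a. -/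
theorem chain_even (hq : 4 ≤ q) (hqe : Even q) (ha : 0 ≤ a) {k : ℕ} (hk : k + 1 ≤ q / 2) :
    chain (lam q) a (2 * k) = (B q k + a * B q (k - 1)) / (B q (k + 1) + a * B q k) := by
  induction k with
  | zero => simp [chain, B_zero, B_one (by omega : 2 ≤ q), B_neg_one hq]
  | succ k ih =>
    have h1 := chain_even_den_pos hq hqe ha (by omega : k + 1 ≤ q / 2)
    have h2 := chain_even_den_pos hq hqe ha hk
    rw [show 2 * (k + 1) = 2 * k + 2 by ring, chain, ih (by omega)]
    have e1 := lam_mul_B q (k + 1)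
    have e2 := lam_mul_B q k
    push_cast at h2 ⊢
    rw [show (k : ℤ) + 1 - 1 = k by ring] at e1 ⊢
    have : lam q - (B q k + a * B q (k - 1)) / (B q (k + 1) + a * B q k) =
        (B q (k + 1 + 1) + a * B q (k + 1)) / (B q (k + 1) + a * B q k) := by
      rw [eq_div_iff h1.ne', sub_mul, div_mul_cancel₀ _ h1.ne']
      linear_combination e1 + a * e2
    rw [this, one_div_div]

theorem chain_odd (hq : 4 ≤ q) (hqe : Even q) (ha : 0 ≤ a) {k : ℕ} (hk : k + 2 ≤ q / 2) :
    chain (lam q) a (2 * k + 1) = (B q k + a * B q (k + 1)) / (B q (k + 1) + a * B q (k + 2)) := by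
  induction k with
  | zero => simp [chain, B_zero, B_one (by omega : 2 ≤ q), B_two hq, mul_comm]
  | succ k ih =>
    have h1 := chain_odd_den_pos hq hqe ha (by omega : k + 2 ≤ q / 2)
    have h2 := chain_odd_den_pos hq hqe ha hk
    rw [show 2 * (k + 1) + 1 = 2 * k + 1 + 2 by ring, chain, ih (by omega)]
    have e1 := lam_mul_B q (k + 1)
    have e2 := lam_mul_B q (k + 2)
    push_cast at h2 ⊢
    rw [show (k : ℤ) + 1 - 1 = k by ring] at e1
    rw [show (k : ℤ) + 2 - 1 = k + 1 by ring] at e2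
    rw [show (k : ℤ) + 1 + 1 = k + 2 by ring] at *
    rw [show (k : ℤ) + 1 + 2 = k + 2 + 1 by ring] at *
    have : lam q - (B q k + a * B q (k + 1)) / (B q (k + 1) + a * B q (k + 2)) =
        (B q (k + 2) + a * B q (k + 2 + 1)) / (B q (k + 1) + a * B q (k + 2)) := by
      rw [eq_div_iff h1.ne', sub_mul, div_mul_cancel₀ _ h1.ne']
      linear_combination e1 + a * e2
    rw [this, one_div_div]

theorem chain_succ_nonneg (hq : 4 ≤ q) (hqe : Even q) (ha : 0 ≤ a) {j : ℕ} (hj : j + 3 ≤ q) :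
    0 ≤ chain (lam q) a (j + 1) := by
  obtain ⟨p, hp⟩ := hqe
  have hqe : Even q := ⟨p, hp⟩
  obtain ⟨k, hk | hk⟩ := Nat.even_or_odd' j
  · subst hk
    rw [chain_odd hq hqe ha (by omega)]
    refine div_nonneg ?_ (chain_odd_den_pos hq hqe ha (by omega)).le
    have h1 := B_nonneg hq hqe (k := (k : ℤ)) (by omega) (by omega)
    have h2 := B_nonneg hq hqe (k := (k : ℤ) + 1) (by omega) (by omega)
    positivity
  · rw [show j + 1 = 2 * (k + 1) by omega, chain_even hq hqe ha (by omega)]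
    refine div_nonneg ?_ (chain_even_den_pos hq hqe ha (by omega)).le
    have h1 := B_nonneg hq hqe (k := ((k + 1 : ℕ) : ℤ)) (by omega) (by omega)
    have h2 := B_nonneg hq hqe (k := ((k + 1 : ℕ) : ℤ) - 1) (by omega) (by omega)
    positivity

theorem chain_lt_lam (hq : 4 ≤ q) (hqe : Even q) (ha : 0 ≤ a) {j : ℕ} (hj : j + 4 ≤ q) :
    chain (lam q) a j < lam q := by
  obtain ⟨p, hp⟩ := hqe
  have hqe : Even q := ⟨p, hp⟩
  obtain ⟨k, hk | hk⟩ := Nat.even_or_odd' j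
  · subst hk
    rw [chain_even hq hqe ha (by omega), div_lt_iff₀ (chain_even_den_pos hq hqe ha (by omega))]
    have h2 := chain_even_den_pos hq hqe ha (by omega : (k + 1) + 1 ≤ q / 2)
    have e1 := lam_mul_B q (k + 1)
    have e2 := lam_mul_B q k
    push_cast at h2
    rw [show (k : ℤ) + 1 - 1 = k by ring] at e1
    nlinarith
  · subst hk
    rw [chain_odd hq hqe ha (by omega), div_lt_iff₀ (chain_odd_den_pos hq hqe ha (by omega))]
    have h2 := chain_odd_den_pos hq hqe ha (by omega : (k + 1) + 2 ≤ q / 2)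
    have e1 := lam_mul_B q (k + 1)
    have e2 := lam_mul_B q (k + 2)
    push_cast at h2
    rw [show (k : ℤ) + 1 - 1 = k by ring] at e1
    rw [show (k : ℤ) + 2 - 1 = k + 1 by ring] at e2
    rw [show (k : ℤ) + 1 + 1 = k + 2 by ring] at *
    rw [show (k : ℤ) + 1 + 2 = k + 2 + 1 by ring] at *
    nlinarith

theorem chain_pos (hq : 4 ≤ q) (hqe : Even q) (ha : 0 ≤ a) {j : ℕ} (hj : j + 4 ≤ q) :
    0 < chain (lam q) a (j + 2) := by
  rw [chain]
  exact one_div_pos.2 (sub_pos.2 (chain_lt_lam hq hqe ha hj))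

theorem chain_le_succ_succ (hq : 4 ≤ q) (hqe : Even q) (ha : 0 ≤ a) {j : ℕ} (hj : j + 4 ≤ q) :
    chain (lam q) a j ≤ chain (lam q) a (j + 2) := by
  have hl := one_lt_lam hq
  induction j using Nat.twoStepInduction with
  | zero =>
    have := chain_pos hq hqe ha hj
    simp only [chain] at this ⊢
    linarith
  | one =>
    have := chain_lt_lam hq hqe ha hj
    simp only [chain] at this ⊢
    have h1 : 0 < 1 + lam q * a := by positivity
    rw [div_le_div_iff₀ h1 (by linarith), mul_sub, mul_div_assoc']
    rw [sub_le_iff_le_add, ← sub_le_iff_le_add', le_div_iff₀ h1]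
    nlinarith [mul_nonneg ha ha, mul_nonneg ha (by linarith : 0 ≤ lam q)]
  | more j ih _ =>
    have h1 := chain_lt_lam hq hqe ha hj
    have h2 := ih (by omega)
    simp only [chain] at *
    exact one_div_le_one_div_of_le (by linarith) (by linarith)

/-- Monotonicity of z ↦ 1/(λ - z) propagates the two initial comparisons. The second, a/(1 + λa) ≤
1/(λ + a), amounts to a² ≤ 1. -/
theorem chain_le_succ (hq : 4 ≤ q) (hqe : Even q) (ha : 0 ≤ a) (ha1 : a ≤ 1) {j : ℕ}
    (hj : j + 3 ≤ q) : chain (lam q) a j ≤ chain (lam q) a (j + 1) := by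
  have hl := one_lt_lam hq
  induction j using Nat.twoStepInduction with
  | zero =>
    have := chain_succ_nonneg hq hqe ha hj
    simp only [chain] at this ⊢
    linarith
  | one =>
    simp only [chain]
    have h1 : 0 < 1 + lam q * a := by positivity
    rw [div_le_div_iff₀ h1 (by linarith)]
    nlinarith
  | more j ih _ =>
    have h1 := chain_lt_lam hq hqe ha (by omega : (j + 1) + 4 ≤ q)
    have h2 := ih (by omega)
    simp only [chain] at *
    exact one_div_le_one_div_of_le (by linarith) (by linarith)

/-- The parameter of the chain that ends in `l - x`. -/
noncomputable def chainParam (l x : ℝ) : ℝ := (2 * x - l) / (2 - l * x)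

theorem chainParam_nonneg {l x : ℝ} (hx : l / 2 ≤ x) (hx' : l * x < 2) : 0 ≤ chainParam l x :=
  div_nonneg (by linarith) (by linarith)

theorem chainParam_le_self {l x : ℝ} (hl : 0 < l) (hx0 : 0 ≤ x) (hx : x ≤ 1) (hx' : l * x < 2) :
    chainParam l x ≤ x := by
  rw [chainParam, div_le_iff₀ (by linarith)]
  nlinarith [mul_nonneg hl.le (by nlinarith : 0 ≤ 1 - x ^ 2)]

/-- Since B_{p-1} = λB_p/2 and B_{p-2} = (λ²/2 - 1)B_p, the last element is an explicit Möbius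
function of the parameter, and `chainParam` is the solution for the value λ - x. -/
theorem chain_last (hq : 4 ≤ q) (hqe : Even q) {x : ℝ} (hx : lam q / 2 ≤ x) (hx' : lam q * x < 2) :
    chain (lam q) (chainParam (lam q) x) (q - 2) = lam q - x := by
  have ha := chainParam_nonneg hx hx'
  have hl := one_lt_lam hq
  have hl2 := lam_lt_two hq
  obtain ⟨p, hp⟩ := hqe
  have hqe : Even q := ⟨p, hp⟩
  have hp2 : q / 2 = p := by omega
  have hd := chain_even_den_pos hq hqe ha (by omega : (p - 1) + 1 ≤ q / 2)
  rw [show q - 2 = 2 * (p - 1) by omega, chain_even hq hqe ha (by omega), div_eq_iff hd.ne']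
  have e0 := B_half_pred hq hqe
  have e1 := lam_mul_B q ((q / 2 : ℕ) - 1)
  rw [hp2] at e0 e1
  rw [show ((p - 1 : ℕ) : ℤ) = (p : ℤ) - 1 by omega]
  rw [show (p : ℤ) - 1 + 1 = p by ring] at *
  have e2 : B q ((p : ℤ) - 1 - 1) = lam q * (lam q / 2 * B q p) - B q p := by
    rw [← e0]; linarith
  rw [e2, e0]
  have h2 : (2 - lam q * x) ≠ 0 := by linarith
  rw [chainParam]
  field_simp
  ring

/-- The same parameter serves the other orbit: the chain ends in λ - 1/x, λ - x, which for x = λα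
are -r_1 and -ℓ_0. -/
theorem chain_penultimate (hq : 4 ≤ q) (hqe : Even q) {x : ℝ} (hx : lam q / 2 ≤ x)
    (hx' : lam q * x < 2) :
    chain (lam q) (chainParam (lam q) x) (q - 3) = lam q - 1 / x := by
  have ha := chainParam_nonneg hx hx'
  have hl := one_lt_lam hq
  have hl2 := lam_lt_two hq
  obtain ⟨p, hp⟩ := hqe
  have hqe : Even q := ⟨p, hp⟩
  have hp2 : q / 2 = p := by omega
  have hd := chain_odd_den_pos hq hqe ha (by omega : (p - 2) + 2 ≤ q / 2)
  rw [show q - 3 = 2 * (p - 2) + 1 by omega, chain_odd hq hqe ha (by omega), div_eq_iff hd.ne']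
  have e0 := B_half_pred hq hqe
  have e1 := lam_mul_B q ((q / 2 : ℕ) - 1)
  rw [hp2] at e0 e1
  rw [show ((p - 2 : ℕ) : ℤ) = (p : ℤ) - 1 - 1 by omega]
  rw [show (p : ℤ) - 1 + 1 = p by ring] at *
  rw [show (p : ℤ) - 1 - 1 + 1 = p - 1 by ring, show (p : ℤ) - 1 - 1 + 2 = p by ring]
  have e2 : B q ((p : ℤ) - 1 - 1) = lam q * (lam q / 2 * B q p) - B q p := by
    rw [← e0]; linarith
  rw [e2, e0]
  have h2 : (2 - lam q * x) ≠ 0 := by linarith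
  have hx0 : x ≠ 0 := by linarith
  rw [chainParam]
  field_simp
  ring

end Chain

section Height

variable {q : ℕ}

theorem height_even (hq : 4 ≤ q) (hqe : Even q) {k : ℕ} (hk : k + 1 ≤ q / 2) :
    height (lam q) (2 * k) = Heven q k := by
  induction k with
  | zero => simp [height, Heven, B_zero]
  | succ k ih =>
    rw [show 2 * (k + 1) = 2 * k + 2 by ring, height, ih (by omega), Heven, Heven]
    have h1 := B_pos hq hqe (k := (k : ℤ) + 1) (by omega) (by omega)
    have e1 := lam_mul_B q (k + 1)
    push_cast
    rw [show (k : ℤ) + 1 - 1 = k by ring] at e1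
    have : lam q - B q k / B q (k + 1) = B q (k + 1 + 1) / B q (k + 1) := by
      field_simp
      linarith
    rw [this, one_div_div]

theorem Hodd_one (hq : 4 ≤ q) (hqe : Even q) : Hodd q 1 = 1 / (lam q + 1) := by
  have h1 := B_pos hq hqe (k := ((q / 2 : ℕ) : ℤ)) (by omega) (by omega)
  have e0 := B_half_pred hq hqe
  have e1 := lam_mul_B q ((q / 2 : ℕ) - 1)
  have hl := one_lt_lam hq
  have hl2 := lam_lt_two hq
  rw [Hodd]
  rw [show ((q / 2 : ℕ) : ℤ) - 1 + 1 = (q / 2 : ℕ) by ring] at e1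
  rw [show ((q / 2 : ℕ) : ℤ) + 1 - 1 = (q / 2 : ℕ) by ring]
  have e2 : B q (((q / 2 : ℕ) : ℤ) - 1 - 1) = lam q * (lam q / 2 * B q (q / 2 : ℕ)) - B q (q / 2 : ℕ) := by
    rw [← e0]; linarith
  rw [e2, e0]
  set b := B q (q / 2 : ℕ)
  have h3 : lam q * (lam q / 2 * b) - b - lam q / 2 * b = (lam q - 2) * (lam q + 1) * b / 2 := by ring
  have h4 : (lam q - 2) ≠ 0 := by linarith
  rw [h3]
  field_simp

theorem Hodd_succ (hq : 4 ≤ q) (hqe : Even q) {k : ℕ} (hk : k + 2 ≤ q / 2) :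
    Hodd q (k + 1 + 1) = 1 / (lam q - Hodd q (k + 1)) := by
  rw [Hodd, Hodd]
  set p := ((q / 2 : ℕ) : ℤ) with hp
  rw [show p - 1 - (k + 1 + 1) = p - k - 3 by ring, show p - (k + 1 + 1) = p - k - 2 by ring,
    show p - (k + 1) = p - k - 1 by ring, show p - 1 - (k + 1) = p - k - 2 by ring,
    show p + 1 - (k + 1 + 1) = p - k - 1 by ring, show p + 1 - (k + 1) = p - k by ring]
  have h1 := B_lt_B hq hqe (a := p - k - 2) (b := p - k - 1) (by omega) (by omega) (by omega)
  have h2 := B_lt_B hq hqe (a := p - k - 3) (b := p - k - 2) (by omega) (by omega) (by omega)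
  have e1 := B_rec q (p - k)
  have e2 := B_rec q (p - k - 1)
  rw [show p - k - 1 - 1 = p - k - 2 by ring, show p - k - 1 - 2 = p - k - 3 by ring] at e2
  have h3 : B q (p - k - 2) - B q (p - k - 1) ≠ 0 := by linarith
  have h4 : B q (p - k - 3) - B q (p - k - 2) ≠ 0 := by linarith
  have : lam q - (B q (p - k - 1) - B q (p - k)) / (B q (p - k - 2) - B q (p - k - 1)) =
      (B q (p - k - 3) - B q (p - k - 2)) / (B q (p - k - 2) - B q (p - k - 1)) := by
    field_simp
    linarith
  rw [this, one_div_div]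

theorem height_odd (hq : 4 ≤ q) (hqe : Even q) {k : ℕ} (hk : k + 1 ≤ q / 2) :
    height (lam q) (2 * k + 1) = Hodd q (k + 1) := by
  induction k with
  | zero => simpa [height] using (Hodd_one hq hqe).symm
  | succ k ih =>
    rw [show 2 * (k + 1) + 1 = 2 * k + 1 + 2 by ring, height, ih (by omega)]
    push_cast
    rw [Hodd_succ hq hqe hk]

theorem height_le_one (hq : 4 ≤ q) (hqe : Even q) {j : ℕ} (hj : j + 1 ≤ q) :
    height (lam q) j ≤ 1 := by
  obtain ⟨p, hp⟩ := hqe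
  have hqe : Even q := ⟨p, hp⟩
  obtain ⟨k, hk | hk⟩ := Nat.even_or_odd' j
  · subst hk
    have h1 := B_pos hq hqe (k := (k : ℤ) + 1) (by omega) (by omega)
    rw [height_even hq hqe (by omega), Heven, div_le_one h1]
    exact (B_lt_B hq hqe (by omega) (by omega) (by omega)).le
  · subst hk
    rw [height_odd hq hqe (by omega), Hodd]
    set p := ((q / 2 : ℕ) : ℤ) with hp
    rw [show p - (k + 1) = p - k - 1 by ring, show p - 1 - (k + 1) = p - k - 2 by ring,
      show p + 1 - (k + 1) = p - k by ring]
    have h1 := B_lt_B hq hqe (a := p - k - 2) (b := p - k - 1) (by omega) (by omega) (by omega)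
    have h2 := B_nonneg hq hqe (k := p - k - 1) (by omega) (by omega)
    have e1 := B_rec q (p - k)
    rw [div_le_one_of_neg (by linarith)]
    nlinarith [lam_lt_two hq]

theorem height_lt_lam (hq : 4 ≤ q) (hqe : Even q) {j : ℕ} (hj : j + 1 ≤ q) :
    height (lam q) j < lam q :=
  (height_le_one hq hqe hj).trans_lt (one_lt_lam hq)

theorem height_le_succ (hq : 4 ≤ q) (hqe : Even q) {j : ℕ} (hj : j + 2 ≤ q) :
    height (lam q) j ≤ height (lam q) (j + 1) := by
  have hl := one_lt_lam hq
  induction j using Nat.twoStepInduction with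
  | zero => simp only [height]; positivity
  | one =>
    simp only [height, sub_zero]
    exact one_div_le_one_div_of_le (by linarith) (by linarith)
  | more j ih _ =>
    have h1 := height_lt_lam hq hqe (by omega : (j + 1) + 1 ≤ q)
    have h2 := ih (by omega)
    simp only [height] at *
    exact one_div_le_one_div_of_le (by linarith) (by linarith)

theorem height_last (hq : 4 ≤ q) (hqe : Even q) : height (lam q) (q - 1) = 1 := by
  obtain ⟨p, hp⟩ := hqe
  have hqe : Even q := ⟨p, hp⟩
  rw [show q - 1 = 2 * (p - 1) + 1 by omega, height_odd hq hqe (by omega), Hodd]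
  rw [show ((p - 1 : ℕ) : ℤ) + 1 = ((q / 2 : ℕ) : ℤ) by omega]
  simp [B_zero, B_one (by omega : 2 ≤ q), B_neg_one hq]

theorem height_penultimate (hq : 4 ≤ q) (hqe : Even q) : height (lam q) (q - 2) = lam q / 2 := by
  obtain ⟨p, hp⟩ := hqe
  have hqe : Even q := ⟨p, hp⟩
  have h1 := B_pos hq hqe (k := ((q / 2 : ℕ) : ℤ)) (by omega) (by omega)
  rw [show q - 2 = 2 * (p - 1) by omega, height_even hq hqe (by omega), Heven]
  rw [show ((p - 1 : ℕ) : ℤ) = ((q / 2 : ℕ) : ℤ) - 1 by omega, B_half_pred hq hqe,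
    show ((q / 2 : ℕ) : ℤ) - 1 + 1 = ((q / 2 : ℕ) : ℤ) by ring]
  field_simp

/-- The recursion is solved backwards from the last height 1. -/
theorem height_antepenultimate (hq : 4 ≤ q) (hqe : Even q) :
    height (lam q) (q - 3) = lam q - 1 := by
  have h := height_last hq hqe
  obtain ⟨j, rfl⟩ : ∃ j, q = j + 4 := ⟨q - 4, by omega⟩
  rw [show j + 4 - 1 = (j + 1) + 2 by omega, height, show j + 4 - 3 = j + 1 by omega] at *
  have : lam (j + 4) - height (lam (j + 4)) (j + 1) ≠ 0 := by
    intro h0; rw [h0] at h; norm_num at h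
  rw [div_eq_iff this] at h
  linarith

theorem height_preantepenultimate (hq : 4 ≤ q) (hqe : Even q) :
    height (lam q) (q - 4) = lam q - 2 / lam q := by
  have h := height_penultimate hq hqe
  have hl := one_lt_lam hq
  obtain ⟨j, rfl⟩ : ∃ j, q = j + 4 := ⟨q - 4, by omega⟩
  rw [show j + 4 - 2 = j + 2 by omega, height, show j + 4 - 4 = j by omega] at *
  have : lam (j + 4) - height (lam (j + 4)) j ≠ 0 := by
    intro h0; rw [h0] at h; norm_num at h; linarith
  rw [div_eq_iff this] at h
  field_simp
  linarith

end Height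

end AlphaRosen

/-! ### The staircase domain and its invariance under the natural extension. -/

namespace AlphaRosen

/-- The standing assumptions on the parameters. -/
structure Params (q : ℕ) (α : ℝ) : Prop where
  four_le : 4 ≤ q
  even : Even q
  half_le : 1 / 2 ≤ α
  le_inv : α ≤ 1 / lam q

/-- The left endpoints of the steps of the planar domain, in increasing order. -/
noncomputable def thr (q : ℕ) (α : ℝ) (j : ℕ) : ℝ :=
  -chain (lam q) (chainParam (lam q) (lam q * α)) (q - 2 - j)

/-- The planar domain, described by its staircase. -/
def stair (q : ℕ) (α : ℝ) : Set (ℝ × ℝ) :=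
  {z | z.1 ∈ Set.Ico (lam q * (α - 1)) (lam q * α) ∧ 0 ≤ z.2 ∧ z.2 ≤ 1 ∧
    ∀ j, j + 2 ≤ q → z.1 < thr q α j → z.2 ≤ height (lam q) j}

/-- The planar natural extension map. -/
noncomputable def natExt (q : ℕ) (α : ℝ) (z : ℝ × ℝ) : ℝ × ℝ :=
  (T q α z.1, 1 / (digit q α z.1 * lam q + Real.sign z.1 * z.2))

section Map

variable {q : ℕ} {α : ℝ}

theorem digit_eq_of_add (hl : 0 < lam q) {t s : ℝ} {d : ℤ} (h : 1 / |t| = lam q * d + s)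
    (hs : s ∈ Set.Ico (lam q * (α - 1)) (lam q * α)) : digit q α t = d := by
  have e0 : |1 / (t * lam q)| = 1 / |t| / lam q := by
    rw [abs_div, abs_mul, abs_one, abs_of_pos hl, div_div]
  rw [digit, e0, h, Int.floor_eq_iff]
  have e : (lam q * d + s) / lam q = d + s / lam q := by field_simp
  have h1 : α - 1 ≤ s / lam q := by rw [le_div_iff₀ hl]; linarith [hs.1]
  have h2 : s / lam q < α := by rw [div_lt_iff₀ hl]; linarith [hs.2]
  rw [e]
  constructor <;> linarith

theorem one_div_abs_eq (t : ℝ) (ht : t ≠ 0) : 1 / |t| = lam q * digit q α t + T q α t := by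
  rw [T, if_neg ht, abs_div, abs_one]
  ring

theorem T_mem (hl : 0 < lam q) {t : ℝ} (ht : t ≠ 0) :
    T q α t ∈ Set.Ico (lam q * (α - 1)) (lam q * α) := by
  have e : |1 / (t * lam q)| = 1 / |t| / lam q := by
    rw [abs_div, abs_mul, abs_one, abs_of_pos hl, div_div]
  have h1 := Int.floor_le (|1 / (t * lam q)| + 1 - α)
  have h2 := Int.lt_floor_add_one (|1 / (t * lam q)| + 1 - α)
  have h3 := one_div_abs_eq (q := q) (α := α) t ht
  rw [← digit, e] at h1 h2
  have h4 : 1 / |t| = 1 / |t| / lam q * lam q := by field_simp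
  set w := 1 / |t| / lam q
  constructor <;> nlinarith

theorem T_eq_of_add (hl : 0 < lam q) {t s : ℝ} {d : ℤ} (ht : t ≠ 0) (h : 1 / |t| = lam q * d + s)
    (hs : s ∈ Set.Ico (lam q * (α - 1)) (lam q * α)) : T q α t = s := by
  have h1 := one_div_abs_eq (q := q) (α := α) t ht
  rw [digit_eq_of_add hl h hs] at h1
  linarith

end Map

namespace Params

variable {q : ℕ} {α : ℝ}

theorem lam_pos (h : Params q α) : 0 < lam q := AlphaRosen.lam_pos h.four_le

theorem one_lt_lam (h : Params q α) : 1 < lam q := AlphaRosen.one_lt_lam h.four_le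

theorem lam_lt_two (h : Params q α) : lam q < 2 := AlphaRosen.lam_lt_two h.four_le

theorem half_lam_le (h : Params q α) : lam q / 2 ≤ lam q * α := by
  nlinarith [h.lam_pos, h.half_le]

theorem le_one (h : Params q α) : lam q * α ≤ 1 := by
  have := h.le_inv
  rw [le_div_iff₀ h.lam_pos] at this
  linarith

theorem lam_mul_lt_two (h : Params q α) : lam q * (lam q * α) < 2 := by
  nlinarith [h.lam_pos, h.le_one, h.lam_lt_two]

theorem right_pos (h : Params q α) : 0 < lam q * α := by
  linarith [h.half_lam_le, h.lam_pos]

theorem chainParam_nonneg (h : Params q α) : 0 ≤ chainParam (lam q) (lam q * α) :=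
  AlphaRosen.chainParam_nonneg h.half_lam_le h.lam_mul_lt_two

theorem chainParam_le (h : Params q α) : chainParam (lam q) (lam q * α) ≤ lam q * α :=
  chainParam_le_self h.lam_pos h.right_pos.le h.le_one h.lam_mul_lt_two

theorem thr_zero (h : Params q α) : thr q α 0 = lam q * (α - 1) := by
  rw [thr, Nat.sub_zero, chain_last h.four_le h.even h.half_lam_le h.lam_mul_lt_two]
  ring

theorem thr_one (h : Params q α) : thr q α 1 = 1 / (lam q * α) - lam q := by
  rw [thr, show q - 2 - 1 = q - 3 by omega,
    chain_penultimate h.four_le h.even h.half_lam_le h.lam_mul_lt_two]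
  ring

theorem thr_neg (h : Params q α) {j : ℕ} (hj : j + 4 ≤ q) : thr q α j < 0 := by
  rw [thr, show q - 2 - j = (q - 4 - j) + 2 by omega, neg_lt_zero]
  exact chain_pos h.four_le h.even h.chainParam_nonneg (by omega)

/-- The right side is the branch of `T` with t < 0 and digit 1. The thresholds thus interlace the
orbits of the two endpoints: ℓ_0, r_1, ℓ_1, r_2, …. -/
theorem thr_add_two (_h : Params q α) {j : ℕ} (hj : j + 4 ≤ q) :
    thr q α (j + 2) = -1 / thr q α j - lam q := by
  rw [thr, thr, show q - 2 - j = (q - 4 - j) + 2 by omega, chain,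
    show q - 2 - (j + 2) = q - 4 - j by omega]
  rw [neg_div_neg_eq, one_div_one_div]
  ring

theorem thr_le_succ (h : Params q α) {j : ℕ} (hj : j + 3 ≤ q) :
    thr q α j ≤ thr q α (j + 1) := by
  rw [thr, thr, show q - 2 - j = (q - 3 - j) + 1 by omega,
    show q - 2 - (j + 1) = q - 3 - j by omega, neg_le_neg_iff]
  exact chain_le_succ h.four_le h.even h.chainParam_nonneg (h.chainParam_le.trans h.le_one)
    (by omega)

theorem thr_mono (h : Params q α) {i j : ℕ} (hij : i ≤ j) (hj : j + 2 ≤ q) :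
    thr q α i ≤ thr q α j := by
  induction j, hij using Nat.le_induction with
  | base => exact le_rfl
  | succ j _ ih => exact (ih (by omega)).trans (h.thr_le_succ (by omega))

theorem height_mono (h : Params q α) {i j : ℕ} (hij : i ≤ j) (hj : j + 1 ≤ q) :
    height (lam q) i ≤ height (lam q) j := by
  induction j, hij using Nat.le_induction with
  | base => exact le_rfl
  | succ j _ ih => exact (ih (by omega)).trans (height_le_succ h.four_le h.even (by omega))

theorem thr_last (_h : Params q α) : thr q α (q - 2) = chainParam (lam q) (lam q * α) := by
  simp [thr, chain]

theorem thr_last_nonneg (h : Params q α) : 0 ≤ thr q α (q - 2) := by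
  rw [h.thr_last]; exact h.chainParam_nonneg

theorem thr_last_le (h : Params q α) : thr q α (q - 2) ≤ lam q * α := by
  rw [h.thr_last]; exact h.chainParam_le

theorem thr_penultimate (h : Params q α) :
    thr q α (q - 3) = -(thr q α (q - 2) / (1 + lam q * thr q α (q - 2))) := by
  rw [h.thr_last, thr, show q - 2 - (q - 3) = 1 by have := h.four_le; omega, chain]

theorem thr_penultimate_nonpos (h : Params q α) : thr q α (q - 3) ≤ 0 := by
  rw [h.thr_penultimate, neg_nonpos]
  have := h.thr_last_nonneg
  have := h.lam_pos
  positivity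

theorem thr_last_pos_of_penultimate_neg (h : Params q α) (hn : thr q α (q - 3) < 0) :
    0 < thr q α (q - 2) := by
  refine lt_of_le_of_ne h.thr_last_nonneg fun h0 => ?_
  rw [h.thr_penultimate, ← h0] at hn
  simp at hn

/-- The two innermost thresholds are matched by the map. -/
theorem one_div_thr_penultimate (h : Params q α) (hn : thr q α (q - 3) < 0) :
    1 / -thr q α (q - 3) = lam q + 1 / thr q α (q - 2) := by
  have h1 := h.thr_last_pos_of_penultimate_neg hn
  rw [h.thr_penultimate, neg_neg, one_div_div]
  field_simp
  ring

theorem abs_le (h : Params q α) {t : ℝ} (ht : t ∈ Set.Icc (lam q * (α - 1)) (lam q * α)) :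
    |t| ≤ lam q * α := by
  rw [_root_.abs_le]
  have := h.half_lam_le
  constructor
  · linarith [ht.1]
  · exact ht.2

theorem one_le_digit (h : Params q α) {t : ℝ} (ht0 : t ≠ 0)
    (ht : t ∈ Set.Icc (lam q * (α - 1)) (lam q * α)) : 1 ≤ digit q α t := by
  have hl := h.lam_pos
  have h1 := one_div_abs_eq (q := q) (α := α) t ht0
  have h2 := (T_mem (α := α) hl ht0).2
  have h3 : 1 ≤ 1 / |t| := by
    rw [le_div_iff₀ (abs_pos.2 ht0)]
    linarith [h.abs_le ht, h.le_one]
  by_contra hd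
  have hd' : (digit q α t : ℝ) ≤ 0 := by exact_mod_cast (by omega : digit q α t ≤ 0)
  nlinarith [h.le_one]

/-- Everything depends on the denominator D = dλ + sgn(t)v. On negative points with digit 1, both
thresholds and heights advance by two indices, so the staircase reproduces itself. Every other
branch has either D ≥ λ + 1, landing below the first height, or D ≥ λ with image to the right of the
first interior threshold, where the second height is allowed. -/
theorem natExt_mem (h : Params q α) {z : ℝ × ℝ} (hz : z ∈ stair q α) (hz0 : z.1 ≠ 0) :
    natExt q α z ∈ stair q α := by
  obtain ⟨t, v⟩ := z
  obtain ⟨ht, hv0, hv1, hst⟩ := hz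
  simp only at ht hv0 hv1 hst hz0
  have hl := h.one_lt_lam
  have hl2 := h.lam_lt_two
  have hq := h.four_le
  have hd := h.one_le_digit hz0 ⟨ht.1, ht.2.le⟩
  have hT := T_mem (α := α) h.lam_pos hz0
  have heq := one_div_abs_eq (q := q) (α := α) t hz0
  have hd1 : (1 : ℝ) ≤ digit q α t := by exact_mod_cast hd
  have hH1 : height (lam q) 1 = 1 / (lam q + 1) := rfl
  have hH2 : height (lam q) 2 = 1 / lam q := by simp [height]
  -- enough: a lower bound on the denominator below each threshold
  suffices hmain : 1 ≤ digit q α t * lam q + Real.sign t * v ∧ ∀ j, j + 2 ≤ q →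
      T q α t < thr q α j → 1 / (digit q α t * lam q + Real.sign t * v) ≤ height (lam q) j by
    refine ⟨hT, ?_, ?_, hmain.2⟩
    · exact one_div_nonneg.2 (by linarith [hmain.1])
    · exact (div_le_one (by linarith [hmain.1])).2 hmain.1
  -- No image lies to the left of the threshold of index 0, so only indices j ≥ 1 constrain it.
  have key1 : lam q + 1 ≤ digit q α t * lam q + Real.sign t * v → 1 ≤ digit q α t * lam q + Real.sign t * v ∧
      ∀ j, j + 2 ≤ q → T q α t < thr q α j →
        1 / (digit q α t * lam q + Real.sign t * v) ≤ height (lam q) j := by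
    intro hle
    refine ⟨by linarith, fun j hj hlt => ?_⟩
    rcases Nat.eq_zero_or_pos j with rfl | hj0
    · rw [h.thr_zero] at hlt; exact absurd hlt (not_lt.2 hT.1)
    · refine le_trans ?_ (h.height_mono hj0 (by omega))
      rw [hH1]
      exact one_div_le_one_div_of_le (by linarith) hle
  have key2 : thr q α 1 ≤ T q α t → lam q ≤ digit q α t * lam q + Real.sign t * v →
      1 ≤ digit q α t * lam q + Real.sign t * v ∧
      ∀ j, j + 2 ≤ q → T q α t < thr q α j →
        1 / (digit q α t * lam q + Real.sign t * v) ≤ height (lam q) j := by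
    intro hT1 hle
    refine ⟨by linarith, fun j hj hlt => ?_⟩
    have hj2 : 2 ≤ j := by
      by_contra hj2
      exact absurd hlt (not_lt.2 ((h.thr_mono (by omega : j ≤ 1) (by omega)).trans hT1))
    refine le_trans ?_ (h.height_mono hj2 (by omega))
    rw [hH2]
    exact one_div_le_one_div_of_le (by linarith) hle
  rcases lt_or_gt_of_ne hz0 with hneg | hpos
  · rw [Real.sign_of_neg hneg, abs_of_neg hneg] at *
    have hvK : v ≤ lam q / 2 := by
      have := hst (q - 2) (by omega) (hneg.trans_le h.thr_last_nonneg)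
      rwa [height_penultimate hq h.even] at this
    have hvK1 : t < thr q α (q - 3) → v ≤ lam q - 1 := by
      intro hlt
      have := hst (q - 3) (by omega) hlt
      rwa [height_antepenultimate hq h.even] at this
    -- The matching of the two innermost thresholds, combined with the bound λα on the last one.
    have hge : thr q α (q - 3) ≤ t → lam q + 1 / (lam q * α) ≤ 1 / -t := by
      intro hle
      have hn := hle.trans_lt hneg
      have h1 := h.one_div_thr_penultimate hn
      have h2 := h.thr_last_pos_of_penultimate_neg hn
      have h3 := one_div_le_one_div_of_le h2 h.thr_last_le
      have h4 := one_div_le_one_div_of_le (by linarith : 0 < -t) (by linarith : -t ≤ -thr q α (q - 3))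
      linarith
    rcases eq_or_lt_of_le hd with hd2 | hd2
    · rw [← hd2] at heq ⊢
      push_cast at heq ⊢
      -- Digit 1 cannot occur further right: the image would be at least 1/(λα) ≥ λα.
      have hlt : t < thr q α (q - 3) := by
        by_contra hle
        have h1 := hge (not_lt.1 hle)
        have h2 : lam q * α ≤ 1 / (lam q * α) := by
          rw [le_div_iff₀ h.right_pos]
          nlinarith [h.le_one, h.right_pos]
        linarith [hT.2]
      have hv := hvK1 hlt
      refine ⟨by linarith, fun j hj hTj => ?_⟩
      have hTe : T q α t = 1 / -t - lam q := by linarith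
      have hmono : ∀ i, i + 4 ≤ q → (T q α t < thr q α (i + 2) → t < thr q α i) := by
        intro i hi hT2
        have h1 := h.thr_neg hi
        rw [h.thr_add_two hi, hTe] at hT2
        have h2 : 1 / -t < 1 / -thr q α i := by
          rw [neg_div, ← div_neg] at hT2; linarith
        have h3 := (one_div_lt_one_div (by linarith) (by linarith)).1 h2
        linarith
      have hge2 : thr q α 2 ≤ T q α t := by
        by_contra hlt2
        have := hmono 0 (by omega) (not_le.1 hlt2)
        rw [h.thr_zero] at this
        linarith [ht.1]
      obtain ⟨i, rfl⟩ : ∃ i, j = i + 2 := by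
        refine ⟨j - 2, ?_⟩
        by_contra hj2
        exact absurd hTj (not_lt.2 ((h.thr_mono (by omega : j ≤ 2) (by omega)).trans hge2))
      have h3 := hst i (by omega) (hmono i (by omega) hTj)
      have h4 := height_lt_lam hq h.even (by omega : i + 1 ≤ q)
      rw [height]
      exact one_div_le_one_div_of_le (by linarith) (by linarith)
    · have hd2' : (2 : ℝ) ≤ digit q α t := by exact_mod_cast hd2
      -- Left of this threshold v ≤ λ - 1, so D ≥ 2λ - (λ - 1) = λ + 1. Right of it only v ≤ λ/2 is
      -- known; for digit 2 the image is then at least 1/(λα) - λ, the threshold of index 1.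
      by_cases hlt : t < thr q α (q - 3)
      · apply key1
        have := hvK1 hlt
        nlinarith
      · rcases eq_or_lt_of_le (show (2 : ℤ) ≤ digit q α t by omega) with hd3 | hd3
        · apply key2
          · have := hge (not_lt.1 hlt)
            rw [← hd3] at heq
            push_cast at heq
            rw [h.thr_one]
            linarith
          · nlinarith
        · have hd3' : (3 : ℝ) ≤ digit q α t := by exact_mod_cast hd3
          apply key1
          nlinarith
  · rw [Real.sign_of_pos hpos, abs_of_pos hpos] at *
    rcases eq_or_lt_of_le hd with hd2 | hd2
    · apply key2
      · rw [← hd2] at heq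
        push_cast at heq
        have := one_div_le_one_div_of_le hpos ht.2.le
        rw [h.thr_one]
        linarith
      · nlinarith
    · have hd2' : (2 : ℝ) ≤ digit q α t := by exact_mod_cast hd2
      apply key1
      nlinarith

end Params

/-- The contraction rate of two steps of the natural extension in the vertical direction. -/
noncomputable def rate (q : ℕ) : ℝ := max (lam q / 2) (1 / lam q)

namespace Params

variable {q : ℕ} {α : ℝ}

theorem rate_lt_one (h : Params q α) : rate q < 1 := by
  have := h.one_lt_lam
  have := h.lam_lt_two
  refine max_lt (by linarith) ?_
  rw [div_lt_one (by linarith)]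
  linarith

theorem rate_pos (h : Params q α) : 0 < rate q :=
  lt_max_of_lt_left (half_pos h.lam_pos)

theorem natExt_den_ge_one (h : Params q α) {z : ℝ × ℝ} (hz : z ∈ stair q α) (hz0 : z.1 ≠ 0) :
    1 ≤ digit q α z.1 * lam q + Real.sign z.1 * z.2 := by
  have h1 := (h.natExt_mem hz hz0).2.2.1
  have h2 := (h.natExt_mem hz hz0).2.1
  have hd : (1 : ℝ) ≤ digit q α z.1 := by
    exact_mod_cast h.one_le_digit hz0 ⟨hz.1.1, hz.1.2.le⟩
  have hpos : 0 < digit q α z.1 * lam q + Real.sign z.1 * z.2 := by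
    have hl := h.one_lt_lam
    have : -1 ≤ Real.sign z.1 * z.2 := by
      rcases Real.sign_apply_eq z.1 with hs | hs | hs <;> rw [hs] <;> linarith [hz.2.1, hz.2.2.1]
    nlinarith
  simp only [natExt] at h1
  rwa [div_le_one hpos] at h1

/-- Two consecutive vertical coordinates have a product bounded away from one. -/
theorem mul_natExt_le (h : Params q α) {z : ℝ × ℝ} (hz : z ∈ stair q α) (hz0 : z.1 ≠ 0) :
    z.2 * (natExt q α z).2 ≤ rate q := by
  have h1 := h.natExt_mem hz hz0
  have hl := h.one_lt_lam
  rcases lt_or_gt_of_ne hz0 with hneg | hpos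
  · have h2 := hz.2.2.2 (q - 2) (by have := h.four_le; omega) (hneg.trans_le h.thr_last_nonneg)
    rw [height_penultimate h.four_le h.even] at h2
    refine le_trans ?_ (le_max_left _ _)
    nlinarith [h1.2.1, h1.2.2.1, hz.2.1]
  · refine le_trans ?_ (le_max_right _ _)
    have hd : (1 : ℝ) ≤ digit q α z.1 := by
      exact_mod_cast h.one_le_digit hz0 ⟨hz.1.1, hz.1.2.le⟩
    have h3 : (natExt q α z).2 ≤ 1 / lam q := by
      simp only [natExt]
      rw [Real.sign_of_pos hpos]
      refine one_div_le_one_div_of_le (by linarith) ?_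
      nlinarith [hz.2.1]
    nlinarith [hz.2.1, hz.2.2.1, h1.2.1]

end Params

end AlphaRosen

/-! ### The invariant density, null boundaries and injectivity. -/

namespace AlphaRosen

/-- The points at which the map is locally a Möbius transformation and that are not thresholds. -/
def regularPoints (q : ℕ) (α : ℝ) : Set ℝ :=
  {t | t ≠ 0 ∧ (∀ n : ℤ, |1 / (t * lam q)| + 1 - α ≠ n) ∧ ∀ j, t ≠ thr q α j}

/-- The planar domain without the graph of its upper boundary and without irregular fibres. -/
def openStair (q : ℕ) (α : ℝ) : Set (ℝ × ℝ) :=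
  {z | z.1 ∈ Set.Ico (lam q * (α - 1)) (lam q * α) ∧ z.1 ∈ regularPoints q α ∧ 0 < z.2 ∧ z.2 < 1 ∧
    ∀ j, j + 2 ≤ q → z.1 < thr q α j → z.2 < height (lam q) j}

/-- The density `1 / (1 + t v)²`. -/
noncomputable def invDensity (z : ℝ × ℝ) : ENNReal := ENNReal.ofReal (1 / (1 + z.1 * z.2) ^ 2)

/-- The invariant measure of the natural extension, not normalized. -/
noncomputable def stairMeasure (q : ℕ) (α : ℝ) : Measure (ℝ × ℝ) :=
  (volume.restrict (stair q α)).withDensity invDensity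

theorem sign_mul_abs' (r : ℝ) : Real.sign r * |r| = r := by
  rcases lt_trichotomy r 0 with h | rfl | h
  · rw [Real.sign_of_neg h, abs_of_neg h]; ring
  · simp
  · rw [Real.sign_of_pos h, abs_of_pos h, one_mul]

section Measurability

variable {q : ℕ} {α : ℝ}

theorem measurable_digit : Measurable (digit q α) := by
  unfold digit
  exact Int.measurable_floor.comp
    ((((measurable_id.mul_const _).const_div 1).abs.add_const 1).sub_const α)

theorem measurable_T : Measurable (T q α) := by
  unfold T
  refine Measurable.ite (measurableSet_singleton 0) measurable_const ?_
  exact (measurable_id.const_div 1).abs.sub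
    (measurable_const.mul (measurable_from_top.comp measurable_digit))

theorem measurable_sign : Measurable Real.sign :=
  Measurable.ite measurableSet_Iio measurable_const
    (Measurable.ite measurableSet_Ioi measurable_const measurable_const)

theorem measurable_natExt : Measurable (natExt q α) := by
  unfold natExt
  have h1 : Measurable fun z : ℝ × ℝ => (digit q α z.1 : ℝ) :=
    measurable_from_top.comp (measurable_digit.comp measurable_fst)
  exact (measurable_T.comp measurable_fst).prodMk
    (((h1.mul_const _).add ((measurable_sign.comp measurable_fst).mul measurable_snd)).const_div 1)

theorem measurable_invDensity : Measurable invDensity := by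
  unfold invDensity
  exact ((((measurable_fst.mul measurable_snd).const_add 1).pow_const 2).const_div 1).ennreal_ofReal

theorem measurableSet_stair : MeasurableSet (stair q α) := by
  have : stair q α = {z | z.1 ∈ Set.Ico (lam q * (α - 1)) (lam q * α)} ∩ {z | 0 ≤ z.2} ∩
      {z | z.2 ≤ 1} ∩ ⋂ j : ℕ, {z | j + 2 ≤ q → z.1 < thr q α j → z.2 ≤ height (lam q) j} := by
    ext z
    simp only [stair, Set.mem_ofPred_eq, Set.mem_inter_iff, Set.mem_iInter]
    tauto
  rw [this]
  refine (((measurable_fst measurableSet_Ico).inter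
    (measurableSet_le measurable_const measurable_snd)).inter
    (measurableSet_le measurable_snd measurable_const)).inter (MeasurableSet.iInter fun j => ?_)
  exact (MeasurableSet.const _).imp ((measurableSet_lt measurable_fst measurable_const).imp
    (measurableSet_le measurable_snd measurable_const))

theorem countable_compl_regularPoints (hl : 0 < lam q) : (regularPoints q α)ᶜ.Countable := by
  have hsub : (regularPoints q α)ᶜ ⊆ ({0} ∪ ⋃ n : ℤ, {1 / (lam q * (n - 1 + α)),
      1 / (lam q * -(n - 1 + α))}) ∪ Set.range (thr q α) := by
    intro t ht
    simp only [regularPoints, Set.mem_compl_iff, Set.mem_ofPred_eq, not_and_or, not_not,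
      not_forall] at ht
    rcases ht with ht | ⟨n, hn⟩ | ⟨j, hj⟩
    · exact Or.inl (Or.inl ht)
    · refine Or.inl (Or.inr (Set.mem_iUnion.2 ⟨n, ?_⟩))
      have h1 : |1 / (t * lam q)| = n - 1 + α := by linarith
      rcases abs_choice (1 / (t * lam q)) with h2 | h2
      · left
        rw [← h1, h2]
        by_cases ht0 : t = 0
        · simp [ht0]
        · field_simp
      · right
        rw [Set.mem_singleton_iff, ← h1, h2]
        by_cases ht0 : t = 0
        · simp [ht0]
        · field_simp
    · exact Or.inr ⟨j, hj.symm⟩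
  refine Set.Countable.mono hsub (((Set.countable_singleton _).union
    (Set.countable_iUnion fun n => ?_)).union (Set.countable_range _))
  exact (Set.toFinite _).countable

theorem measurableSet_openStair (hl : 0 < lam q) : MeasurableSet (openStair q α) := by
  have : openStair q α = {z | z.1 ∈ Set.Ico (lam q * (α - 1)) (lam q * α)} ∩
      {z | z.1 ∈ regularPoints q α} ∩ {z | 0 < z.2} ∩
      {z | z.2 < 1} ∩ ⋂ j : ℕ, {z | j + 2 ≤ q → z.1 < thr q α j → z.2 < height (lam q) j} := by
    ext z
    simp only [openStair, Set.mem_ofPred_eq, Set.mem_inter_iff, Set.mem_iInter]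
    tauto
  rw [this]
  have hreg : MeasurableSet (regularPoints q α) := by
    rw [← compl_compl (regularPoints q α)]
    exact (countable_compl_regularPoints hl).measurableSet.compl
  refine ((((measurable_fst measurableSet_Ico).inter (measurable_fst hreg)).inter
    (measurableSet_lt measurable_const measurable_snd)).inter
    (measurableSet_lt measurable_snd measurable_const)).inter (MeasurableSet.iInter fun j => ?_)
  exact (MeasurableSet.const _).imp ((measurableSet_lt measurable_fst measurable_const).imp
    (measurableSet_lt measurable_snd measurable_const))

theorem openStair_subset : openStair q α ⊆ stair q α := fun _ hz =>
  ⟨hz.1, hz.2.2.1.le, hz.2.2.2.1.le, fun j hj h => (hz.2.2.2.2 j hj h).le⟩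

theorem volume_stair_diff_openStair (hl : 0 < lam q) :
    volume (stair q α \ openStair q α) = 0 := by
  have hsub : stair q α \ openStair q α ⊆ ((regularPoints q α)ᶜ ×ˢ Set.univ) ∪
      (Set.univ ×ˢ ({0, 1} ∪ Set.range (height (lam q)))) := by
    rintro ⟨t, v⟩ ⟨⟨h1, h2, h3, h4⟩, hz⟩
    by_contra hcon
    simp only [Set.mem_union, Set.mem_prod, Set.mem_compl_iff, Set.mem_univ, and_true, true_and,
      Set.mem_insert_iff, Set.mem_singleton_iff, Set.mem_range, not_or, not_not, not_exists] at hcon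
    obtain ⟨hr, ⟨hv0, hv1⟩, hvj⟩ := hcon
    exact hz ⟨h1, hr, lt_of_le_of_ne h2 (Ne.symm hv0), lt_of_le_of_ne h3 hv1,
      fun j hj hlt => lt_of_le_of_ne (h4 j hj hlt) fun h => hvj j h.symm⟩
  refine measure_mono_null hsub (measure_union_null ?_ ?_)
  · rw [Measure.volume_eq_prod, Measure.prod_prod,
      (countable_compl_regularPoints hl).measure_zero, zero_mul]
  · rw [Measure.volume_eq_prod, Measure.prod_prod,
      ((Set.toFinite _).countable.union (Set.countable_range _)).measure_zero volume, mul_zero]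

theorem stairMeasure_apply {E : Set (ℝ × ℝ)} (hE : MeasurableSet E) :
    stairMeasure q α E = ∫⁻ z in E ∩ stair q α, invDensity z := by
  rw [stairMeasure, withDensity_apply _ hE, Measure.restrict_restrict hE]

theorem stairMeasure_absolutelyContinuous :
    stairMeasure q α ≪ volume.restrict (stair q α) :=
  withDensity_absolutelyContinuous _ _

theorem stairMeasure_compl_openStair (hl : 0 < lam q) :
    stairMeasure q α (openStair q α)ᶜ = 0 := by
  apply stairMeasure_absolutelyContinuous
  rw [Measure.restrict_apply (measurableSet_openStair hl).compl, Set.inter_comm, ← Set.sdiff_eq]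
  exact volume_stair_diff_openStair hl

end Measurability

namespace Params

variable {q : ℕ} {α : ℝ}

theorem one_add_mul_ge (h : Params q α) {z : ℝ × ℝ} (h1 : lam q * (α - 1) ≤ z.1) (h2 : 0 ≤ z.2)
    (h3 : z.2 ≤ 1) : 1 - lam q / 2 ≤ 1 + z.1 * z.2 := by
  have h4 := h.half_lam_le
  have h5 := h.lam_pos
  nlinarith

theorem one_add_mul_pos (h : Params q α) {z : ℝ × ℝ} (h1 : lam q * (α - 1) ≤ z.1) (h2 : 0 ≤ z.2)
    (h3 : z.2 ≤ 1) : 0 < 1 + z.1 * z.2 := by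
  linarith [h.one_add_mul_ge h1 h2 h3, h.lam_lt_two]

theorem volume_stair_lt_top (_h : Params q α) : volume (stair q α) < ⊤ := by
  refine lt_of_le_of_lt (measure_mono (t := Set.Icc (lam q * (α - 1)) (lam q * α) ×ˢ Set.Icc 0 1)
    fun z hz => ⟨⟨hz.1.1, hz.1.2.le⟩, hz.2.1, hz.2.2.1⟩) ?_
  rw [Measure.volume_eq_prod, Measure.prod_prod, Real.volume_Icc, Real.volume_Icc]
  exact ENNReal.mul_lt_top ENNReal.ofReal_lt_top ENNReal.ofReal_lt_top

theorem invDensity_le (h : Params q α) {z : ℝ × ℝ} (hz : z ∈ stair q α) :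
    invDensity z ≤ ENNReal.ofReal (1 / (1 - lam q / 2) ^ 2) := by
  apply ENNReal.ofReal_le_ofReal
  have h1 := h.one_add_mul_ge hz.1.1 hz.2.1 hz.2.2.1
  have h2 := h.lam_lt_two
  have h3 : 0 < 1 - lam q / 2 := by linarith
  gcongr

theorem stairMeasure_univ_lt_top (h : Params q α) : stairMeasure q α Set.univ < ⊤ := by
  rw [stairMeasure_apply MeasurableSet.univ, Set.univ_inter]
  refine lt_of_le_of_lt (setLIntegral_mono measurable_const fun z hz => h.invDensity_le hz) ?_
  rw [setLIntegral_const]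
  exact ENNReal.mul_lt_top ENNReal.ofReal_lt_top h.volume_stair_lt_top

theorem isFiniteMeasure_stairMeasure (h : Params q α) : IsFiniteMeasure (stairMeasure q α) :=
  ⟨h.stairMeasure_univ_lt_top⟩

theorem injOn_natExt (h : Params q α) : Set.InjOn (natExt q α) (openStair q α) := by
  -- a clash between a negative point and a positive point is excluded by the matching thresholds
  have clash : ∀ x ∈ openStair q α, ∀ y ∈ openStair q α, x.1 < 0 → 0 < y.1 →
      natExt q α x = natExt q α y → False := by
    rintro ⟨t, v⟩ hx ⟨s, w⟩ hy ht hs hxy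
    have hl := h.one_lt_lam
    have hl2 := h.lam_lt_two
    have hq := h.four_le
    have d1 := h.natExt_den_ge_one (openStair_subset hx) ht.ne
    have d2 := h.natExt_den_ge_one (openStair_subset hy) hs.ne'
    obtain ⟨-, htr, hv0, hv1, hv⟩ := hx
    obtain ⟨-, hsr, hw0, hw1, hw⟩ := hy
    simp only at *
    have e1 := one_div_abs_eq (q := q) (α := α) t ht.ne
    have e2 := one_div_abs_eq (q := q) (α := α) s hs.ne'
    simp only [natExt, Prod.mk.injEq] at hxy
    obtain ⟨hT, hD⟩ := hxy
    rw [one_div, one_div, inv_inj, Real.sign_of_neg ht, Real.sign_of_pos hs] at hD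
    rw [abs_of_neg ht] at e1
    rw [abs_of_pos hs] at e2
    -- The sum v + w lies in (0, 2) and λ > 1, so the digits differ by exactly 1 and v + w = λ.
    have hdiff : ((digit q α t - digit q α s : ℤ) : ℝ) * lam q = v + w := by
      push_cast; linarith
    have hd : digit q α t - digit q α s = 1 := by
      apply le_antisymm
      · by_contra hcon
        have : (2 : ℝ) ≤ ((digit q α t - digit q α s : ℤ) : ℝ) := by
          exact_mod_cast (by omega : (2 : ℤ) ≤ digit q α t - digit q α s)
        nlinarith
      · by_contra hcon
        have : ((digit q α t - digit q α s : ℤ) : ℝ) ≤ 0 := by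
          exact_mod_cast (by omega : digit q α t - digit q α s ≤ 0)
        nlinarith
    rw [hd] at hdiff
    have hd' : (digit q α t : ℝ) = digit q α s + 1 := by
      exact_mod_cast (by omega : digit q α t = digit q α s + 1)
    have hinv : 1 / -t = 1 / s + lam q := by rw [e1, e2, hT, hd']; ring
    have hv2 := hv (q - 2) (by omega) (ht.trans_le h.thr_last_nonneg)
    rw [height_penultimate hq h.even] at hv2
    -- Either v < λ - 1 while w < 1, or the matching forces s to the left of the last threshold and
    -- both heights are below λ/2. In both cases v + w < λ.
    rcases lt_or_ge t (thr q α (q - 3)) with hlt | hge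
    · have := hv (q - 3) (by omega) hlt
      rw [height_antepenultimate hq h.even] at this
      push_cast at hdiff
      linarith
    · have hn := hge.trans_lt ht
      have h1 := h.one_div_thr_penultimate hn
      have h2 := h.thr_last_pos_of_penultimate_neg hn
      have h4 := one_div_le_one_div_of_le (by linarith : 0 < -t)
        (by linarith : -t ≤ -thr q α (q - 3))
      have h5 : s ≤ thr q α (q - 2) := by
        rw [← one_div_le_one_div h2 hs]; linarith
      have h6 := hw (q - 2) (by omega) (lt_of_le_of_ne h5 (hsr.2.2 _))
      rw [height_penultimate hq h.even] at h6
      push_cast at hdiff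
      linarith
  have same : ∀ σ : ℝ, σ ≠ 0 → σ * σ = 1 → ∀ x ∈ openStair q α, ∀ y ∈ openStair q α,
      Real.sign x.1 = σ → Real.sign y.1 = σ → natExt q α x = natExt q α y → x = y := by
    rintro σ hσ hσ2 ⟨t, v⟩ hx ⟨s, w⟩ hy hts hss hxy
    have hl := h.one_lt_lam
    obtain ⟨-, htr, hv0, hv1, -⟩ := hx
    obtain ⟨-, hsr, hw0, hw1, -⟩ := hy
    simp only at *
    have e1 := one_div_abs_eq (q := q) (α := α) t htr.1
    have e2 := one_div_abs_eq (q := q) (α := α) s hsr.1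
    simp only [natExt, Prod.mk.injEq] at hxy
    obtain ⟨hT, hD⟩ := hxy
    rw [one_div, one_div, inv_inj, hts, hss] at hD
    have hdiff : ((digit q α t - digit q α s : ℤ) : ℝ) * lam q = σ * (w - v) := by
      push_cast; linarith
    -- With equal signs the difference of the heights is less than 1 < λ in absolute value, so the
    -- digits agree.
    have hb : |((digit q α t - digit q α s : ℤ) : ℝ) * lam q| < 1 := by
      rw [hdiff, abs_mul]
      have : |σ| = 1 := by
        have := abs_mul_abs_self σ
        rw [hσ2] at this
        nlinarith [abs_nonneg σ]
      rw [this, one_mul, abs_lt]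
      constructor <;> linarith
    have hd : digit q α t - digit q α s = 0 := by
      by_contra hcon
      have h1 : (1 : ℝ) ≤ |((digit q α t - digit q α s : ℤ) : ℝ)| := by
        exact_mod_cast Int.one_le_abs hcon
      rw [abs_mul, abs_of_pos h.lam_pos] at hb
      nlinarith
    have hd' : digit q α t = digit q α s := by omega
    rw [hd', hT, ← e2] at e1
    have habs : |t| = |s| := by
      rw [one_div, one_div, inv_inj] at e1; exact e1
    rw [hd] at hdiff
    have hvw : v = w := by
      have : w - v = σ * σ * (w - v) := by rw [hσ2, one_mul]
      rw [mul_assoc, ← hdiff] at this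
      push_cast at this
      linarith
    have hst : t = s := by
      rw [← sign_mul_abs' t, ← sign_mul_abs' s, hts, hss, habs]
    rw [hvw, hst]
  intro x hx y hy hxy
  rcases lt_or_gt_of_ne hx.2.1.1 with hx0 | hx0 <;> rcases lt_or_gt_of_ne hy.2.1.1 with hy0 | hy0
  · exact same (-1) (by norm_num) (by norm_num) x hx y hy (Real.sign_of_neg hx0)
      (Real.sign_of_neg hy0) hxy
  · exact (clash x hx y hy hx0 hy0 hxy).elim
  · exact (clash y hy x hx hy0 hx0 hxy.symm).elim
  · exact same 1 (by norm_num) (by norm_num) x hx y hy (Real.sign_of_pos hx0)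
      (Real.sign_of_pos hy0) hxy

end Params

end AlphaRosen

/-! ### The Jacobian and invariance of the planar measure. -/

namespace AlphaRosen

variable {q : ℕ} {α : ℝ}

theorem eventually_digit_eq {t : ℝ} (ht : t ∈ regularPoints q α) :
    ∀ᶠ s in 𝓝 t, digit q α s = digit q α t := by
  by_cases hl : lam q = 0
  · refine Eventually.of_forall fun s => ?_
    simp [digit, hl]
  have hc : ContinuousAt (fun s : ℝ => |1 / (s * lam q)| + 1 - α) t := by
    have : t * lam q ≠ 0 := mul_ne_zero ht.1 hl
    fun_prop (disch := assumption)
  have h1 : (⌊|1 / (t * lam q)| + 1 - α⌋ : ℝ) < |1 / (t * lam q)| + 1 - α :=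
    lt_of_le_of_ne (Int.floor_le _) (ht.2.1 _).symm
  filter_upwards [hc.eventually (Ioo_mem_nhds h1 (Int.lt_floor_add_one _))] with s hs
  exact Int.floor_eq_iff.2 ⟨hs.1.le, hs.2⟩

theorem eventually_sign_eq {t : ℝ} (ht : t ≠ 0) : ∀ᶠ s in 𝓝 t, Real.sign s = Real.sign t := by
  rcases lt_or_gt_of_ne ht with h | h
  · filter_upwards [Iio_mem_nhds h] with s hs
    rw [Real.sign_of_neg h, Real.sign_of_neg hs]
  · filter_upwards [Ioi_mem_nhds h] with s hs
    rw [Real.sign_of_pos h, Real.sign_of_pos hs]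

theorem T_eq_sign_div {t : ℝ} (ht : t ≠ 0) :
    T q α t = Real.sign t / t - lam q * digit q α t := by
  rw [T, if_neg ht, abs_div, abs_one]
  congr 1
  rcases lt_or_gt_of_ne ht with h | h
  · rw [Real.sign_of_neg h, abs_of_neg h, div_neg, neg_div]
  · rw [Real.sign_of_pos h, abs_of_pos h]

theorem sign_mul_self {t : ℝ} (ht : t ≠ 0) : Real.sign t * Real.sign t = 1 := by
  rcases Real.sign_apply_eq_of_ne_zero t ht with h | h <;> rw [h] <;> norm_num

/-- The derivative of the natural extension. -/
noncomputable def natExtDeriv (q : ℕ) (α : ℝ) (z : ℝ × ℝ) : ℝ × ℝ →L[ℝ] ℝ × ℝ :=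
  (ContinuousLinearMap.toSpanSingleton ℝ (-Real.sign z.1 / z.1 ^ 2)).prodMap
    (ContinuousLinearMap.toSpanSingleton ℝ
      (-Real.sign z.1 / (digit q α z.1 * lam q + Real.sign z.1 * z.2) ^ 2))

theorem det_natExtDeriv (z : ℝ × ℝ) : (natExtDeriv q α z).det =
    (-Real.sign z.1 / z.1 ^ 2) *
      (-Real.sign z.1 / (digit q α z.1 * lam q + Real.sign z.1 * z.2) ^ 2) := by
  rw [natExtDeriv, ContinuousLinearMap.det, ContinuousLinearMap.coe_prodMap, LinearMap.det_prodMap]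
  congr 1 <;> exact ContinuousLinearMap.det_toSpanSingleton _

theorem hasFDerivAt_natExt {z : ℝ × ℝ} (hz : z.1 ∈ regularPoints q α)
    (hd : digit q α z.1 * lam q + Real.sign z.1 * z.2 ≠ 0) :
    HasFDerivAt (natExt q α) (natExtDeriv q α z) z := by
  set σ := Real.sign z.1
  set d := digit q α z.1
  have h1 : HasDerivAt (fun t : ℝ => σ / t - lam q * d) (-σ / z.1 ^ 2) z.1 := by
    have := ((hasDerivAt_inv hz.1).const_mul σ).sub_const (lam q * d)
    rw [mul_neg, ← div_eq_mul_inv, ← neg_div] at this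
    simpa only [div_eq_mul_inv] using this
  have h2 : HasDerivAt (fun v : ℝ => 1 / (d * lam q + σ * v))
      (-σ / (d * lam q + σ * z.2) ^ 2) z.2 := by
    have h3 : HasDerivAt (fun v : ℝ => d * lam q + σ * v) σ z.2 := by
      simpa using ((hasDerivAt_id z.2).const_mul σ).const_add (d * lam q)
    simpa only [one_div] using h3.fun_inv hd
  refine (h1.hasFDerivAt.prodMap z h2.hasFDerivAt).congr_of_eventuallyEq ?_
  have e1 := (continuous_fst.tendsto z).eventually (eventually_digit_eq hz)
  have e2 := (continuous_fst.tendsto z).eventually (eventually_sign_eq hz.1)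
  have e3 := (continuous_fst.tendsto z).eventually (isOpen_ne.mem_nhds hz.1)
  filter_upwards [e1, e2, e3] with w hw1 hw2 hw3
  simp only [natExt, Prod.map]
  rw [T_eq_sign_div hw3, hw1, hw2]

namespace Params

/-- The natural extension preserves the density. -/
theorem det_mul_invDensity (h : Params q α) {z : ℝ × ℝ} (hz : z ∈ openStair q α) :
    ENNReal.ofReal |(natExtDeriv q α z).det| * invDensity (natExt q α z) = invDensity z := by
  have hz0 := hz.2.1.1
  have hd := h.natExt_den_ge_one (openStair_subset hz) hz0
  have hp := h.one_add_mul_pos hz.1.1 hz.2.2.1.le hz.2.2.2.1.le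
  rw [invDensity, ← ENNReal.ofReal_mul (abs_nonneg _), invDensity, det_natExtDeriv]
  congr 1
  simp only [natExt]
  rw [T_eq_sign_div hz0]
  have hs := sign_mul_self hz0
  set σ := Real.sign z.1
  set D := (digit q α z.1 : ℝ) * lam q + σ * z.2 with hD
  have e1 : -σ / z.1 ^ 2 * (-σ / D ^ 2) = 1 / (z.1 ^ 2 * D ^ 2) := by
    rw [div_mul_div_comm, neg_mul_neg, hs]
  -- The square of this identity cancels the Jacobian 1/(t²D²).
  have e2 : 1 + (σ / z.1 - lam q * digit q α z.1) * (1 / D) =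
      σ * (1 + z.1 * z.2) / (z.1 * D) := by
    field_simp
    rw [hD]
    ring
  have hσ2 : σ ^ 2 = 1 := by rw [sq, hs]
  rw [e1, e2, abs_of_nonneg (by positivity), div_pow, mul_pow, mul_pow, hσ2]
  field_simp

theorem stairMeasure_image (h : Params q α) {E : Set (ℝ × ℝ)} (hE : MeasurableSet E)
    (hsub : E ⊆ openStair q α) :
    stairMeasure q α (natExt q α '' E) = stairMeasure q α E := by
  have hder : ∀ z ∈ E, HasFDerivWithinAt (natExt q α) (natExtDeriv q α z) E z := fun z hz =>
    (hasFDerivAt_natExt (hsub hz).2.1 (by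
      linarith [h.natExt_den_ge_one (openStair_subset (hsub hz)) (hsub hz).2.1.1])).hasFDerivWithinAt
  have hinj := h.injOn_natExt.mono hsub
  have him : MeasurableSet (natExt q α '' E) :=
    measurable_image_of_fderivWithin hE hder hinj
  have hst : natExt q α '' E ⊆ stair q α := by
    rintro _ ⟨z, hz, rfl⟩
    exact h.natExt_mem (openStair_subset (hsub hz)) (hsub hz).2.1.1
  rw [stairMeasure_apply him, stairMeasure_apply hE, Set.inter_eq_left.2 hst,
    Set.inter_eq_left.2 (hsub.trans openStair_subset),
    lintegral_image_eq_lintegral_abs_det_fderiv_mul volume hE hder hinj]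
  exact setLIntegral_congr_fun hE fun z hz => h.det_mul_invDensity (hsub hz)

/-- The natural extension preserves its measure. -/
theorem measurePreserving_natExt (h : Params q α) :
    MeasurePreserving (natExt q α) (stairMeasure q α) (stairMeasure q α) := by
  have := h.isFiniteMeasure_stairMeasure
  refine ⟨measurable_natExt, Measure.ext fun E hE => ?_⟩
  have hO := measurableSet_openStair (q := q) (α := α) h.lam_pos
  have hO0 := stairMeasure_compl_openStair (q := q) (α := α) h.lam_pos
  have hIm : MeasurableSet (natExt q α '' openStair q α) :=
    measurable_image_of_fderivWithin hO (fun z hz => (hasFDerivAt_natExt hz.2.1 (by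
      linarith [h.natExt_den_ge_one (openStair_subset hz) hz.2.1.1])).hasFDerivWithinAt)
      h.injOn_natExt
  -- The image has the same finite mass as the whole domain, hence is conull; surjectivity need not
  -- be read off from the geometry.
  have hc : stairMeasure q α (natExt q α '' openStair q α)ᶜ = 0 := by
    rw [measure_compl hIm (measure_ne_top _ _), h.stairMeasure_image hO subset_rfl,
      ← measure_compl hO (measure_ne_top _ _), hO0]
  rw [Measure.map_apply measurable_natExt hE]
  calc stairMeasure q α (natExt q α ⁻¹' E)
      = stairMeasure q α (natExt q α ⁻¹' E ∩ openStair q α) :=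
        (measure_inter_conull hO0).symm
    _ = stairMeasure q α (natExt q α '' (natExt q α ⁻¹' E ∩ openStair q α)) :=
        (h.stairMeasure_image ((measurable_natExt hE).inter hO) Set.inter_subset_right).symm
    _ = stairMeasure q α (E ∩ natExt q α '' openStair q α) := by
        rw [Set.image_preimage_inter]
    _ = stairMeasure q α E := measure_inter_conull hc

end Params

end AlphaRosen

/-! ### Identification of the staircase with Ω_α. -/

namespace AlphaRosen

namespace Params

variable {q : ℕ} {α : ℝ}

theorem mem_stair_iff (h : Params q α) {z : ℝ × ℝ} : z ∈ stair q α ↔ 0 ≤ z.2 ∧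
    ((∃ j, j + 3 ≤ q ∧ z.1 ∈ Set.Ico (thr q α j) (thr q α (j + 1)) ∧ z.2 ≤ height (lam q) (j + 1)) ∨
      z.1 ∈ Set.Ico (thr q α (q - 2)) (lam q * α) ∧ z.2 ≤ 1) := by
  have hq := h.four_le
  constructor
  · rintro ⟨h1, h2, h3, h4⟩
    refine ⟨h2, ?_⟩
    set P : ℕ → Prop := fun j => thr q α j ≤ z.1
    classical
    have hP0 : P 0 := by simp only [P]; rw [h.thr_zero]; exact h1.1
    -- The strip containing the point starts at the last threshold not exceeding its first
    -- coordinate.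
    have hP := Nat.findGreatest_spec (P := P) (Nat.zero_le (q - 2)) hP0
    have hle := Nat.findGreatest_le (P := P) (q - 2)
    rcases hle.eq_or_lt with heq | hlt
    · right
      rw [heq] at hP
      exact ⟨⟨hP, h1.2⟩, h3⟩
    · left
      have hnot := Nat.findGreatest_is_greatest (P := P) (Nat.lt_succ_self _) hlt
      exact ⟨_, by omega, ⟨hP, not_le.1 hnot⟩, h4 _ (by omega) (not_le.1 hnot)⟩
  · rintro ⟨h2, ⟨j, hj, ht, hv⟩ | ⟨ht, hv⟩⟩
    · refine ⟨⟨?_, ?_⟩, h2, hv.trans (height_le_one hq h.even (by omega)), fun i hi hlt => ?_⟩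
      · rw [← h.thr_zero]
        exact (h.thr_mono (Nat.zero_le j) (by omega)).trans ht.1
      · exact ht.2.trans_le ((h.thr_mono (by omega : j + 1 ≤ q - 2) (by omega)).trans h.thr_last_le)
      · refine hv.trans (h.height_mono ?_ (by omega))
        by_contra hcon
        exact absurd hlt (not_lt.2 ((h.thr_mono (by omega : i ≤ j) (by omega)).trans ht.1))
    · refine ⟨⟨?_, ht.2⟩, h2, hv, fun i hi hlt => ?_⟩
      · rw [← h.thr_zero]
        exact (h.thr_mono (Nat.zero_le (q - 2)) (by omega)).trans ht.1
      · exact absurd hlt (not_lt.2 ((h.thr_mono (by omega : i ≤ q - 2) (by omega)).trans ht.1))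

/-- The strict bound on α makes the last threshold smaller than λα, so that the candidate image lies
in the half-open interval. For α = 1/λ the last threshold is the right endpoint itself. -/
theorem T_thr (h : Params q α) (hα : α < 1 / lam q) {j : ℕ} (hj : j + 4 ≤ q) :
    T q α (thr q α j) = thr q α (j + 2) := by
  have hneg := h.thr_neg hj
  refine T_eq_of_add (d := 1) h.lam_pos hneg.ne ?_ ⟨?_, ?_⟩
  · rw [h.thr_add_two hj, abs_of_neg hneg, div_neg, neg_div]
    push_cast
    ring
  · rw [← h.thr_zero]
    exact h.thr_mono (Nat.zero_le _) (by omega)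
  · refine (h.thr_mono (by omega : j + 2 ≤ q - 2) (by omega)).trans_lt ?_
    have h1 : lam q * α < 1 := by
      rw [lt_div_iff₀ h.lam_pos] at hα; linarith
    have h2 := h.lam_mul_lt_two
    have h3 := h.right_pos
    have h4 := h.lam_pos
    rw [h.thr_last, chainParam, div_lt_iff₀ (by linarith)]
    nlinarith [mul_pos h4 (by nlinarith : 0 < 1 - (lam q * α) ^ 2)]

theorem ell_eq (h : Params q α) (hα : α < 1 / lam q) {n : ℕ} (hn : 2 * n + 2 ≤ q) :
    ell q α n = thr q α (2 * n) := by
  induction n with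
  | zero => rw [ell, Function.iterate_zero, id, Nat.mul_zero, h.thr_zero]; ring
  | succ n ih =>
    rw [ell, Function.iterate_succ_apply', ← ell, ih (by omega), h.T_thr hα (by omega)]
    rfl

theorem r_succ_eq (h : Params q α) (hα : α < 1 / lam q) {n : ℕ} (hn : 2 * n + 3 ≤ q) :
    r q α (n + 1) = thr q α (2 * n + 1) := by
  have hq := h.four_le
  induction n with
  | zero =>
    rw [r, Function.iterate_one, mul_comm]
    refine T_eq_of_add (d := 1) h.lam_pos h.right_pos.ne' ?_ ⟨?_, ?_⟩
    · rw [h.thr_one, abs_of_pos h.right_pos]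
      push_cast
      ring
    · rw [← h.thr_zero]
      exact h.thr_mono (Nat.zero_le _) (by omega)
    · exact ((h.thr_mono (by omega : 1 ≤ q - 3) (by omega)).trans
        h.thr_penultimate_nonpos).trans_lt h.right_pos
  | succ n ih =>
    rw [r, Function.iterate_succ_apply', ← r, ih (by omega), h.T_thr hα (by omega)]
    rfl

theorem OmegaGeneric_eq (h : Params q α) (hα : α < 1 / lam q) :
    OmegaGeneric q α = stair q α := by
  have hq := h.four_le
  obtain ⟨p, hp⟩ := h.even
  have hp2 : q / 2 = p := by omega
  ext z
  rw [h.mem_stair_iff]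
  simp only [OmegaGeneric, Set.mem_union, Set.mem_iUnion, Set.mem_prod,
    Finset.mem_Icc, exists_prop, hp2]
  have hr0 : r q α 0 = lam q * α := by rw [r, Function.iterate_zero, id, mul_comm]
  have hl1 : ell q α (p - 1) = thr q α (q - 2) := by
    rw [h.ell_eq hα (by omega)]; congr 1; omega
  have hH1 : Hodd q (p : ℤ) = 1 := by
    rw [← height_last hq h.even, show q - 1 = 2 * (p - 1) + 1 by omega,
      height_odd hq h.even (by omega)]
    congr 1
    omega
  have hn : ∀ n, 1 ≤ n → n ≤ p - 1 → ell q α (n - 1) = thr q α (2 * n - 2) ∧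
      r q α n = thr q α (2 * n - 2 + 1) ∧ r q α n = thr q α (2 * n - 1) ∧
      ell q α n = thr q α (2 * n - 1 + 1) ∧ Hodd q n = height (lam q) (2 * n - 2 + 1) ∧
      Heven q n = height (lam q) (2 * n - 1 + 1) := by
    intro n hn1 hn2
    obtain ⟨k, rfl⟩ : ∃ k, n = k + 1 := ⟨n - 1, by omega⟩
    have e1 : 2 * (k + 1) - 2 = 2 * k := by omega
    have e2 : 2 * (k + 1) - 1 = 2 * k + 1 := by omega
    have e3 : k + 1 - 1 = k := rfl
    rw [e1, e2, e3, h.ell_eq hα (by omega), h.ell_eq hα (by omega), h.r_succ_eq hα (by omega),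
      height_odd hq h.even (by omega), show 2 * k + 1 + 1 = 2 * (k + 1) by ring,
      height_even hq h.even (by omega)]
    simp
  rw [hr0, hl1, hH1]
  constructor
  · rintro (⟨n, ⟨hn1, hn2⟩, ⟨ht, hv⟩ | ⟨ht, hv⟩⟩ | ⟨ht, hv⟩)
    · obtain ⟨a1, a2, a3, a4, a5, a6⟩ := hn n hn1 hn2
      rw [a1, a2] at ht
      rw [a5] at hv
      exact ⟨hv.1, Or.inl ⟨_, by omega, ht, hv.2⟩⟩
    · obtain ⟨a1, a2, a3, a4, a5, a6⟩ := hn n hn1 hn2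
      rw [a3, a4] at ht
      rw [a6] at hv
      exact ⟨hv.1, Or.inl ⟨_, by omega, ht, hv.2⟩⟩
    · exact ⟨hv.1, Or.inr ⟨ht, hv.2⟩⟩
  · rintro ⟨h0, ⟨j, hj, ht, hv⟩ | ⟨ht, hv⟩⟩
    · left
      obtain ⟨k, hk | hk⟩ := Nat.even_or_odd' j
      · obtain ⟨a1, a2, a3, a4, a5, a6⟩ := hn (k + 1) (by omega) (by omega)
        refine ⟨k + 1, ⟨by omega, by omega⟩, Or.inl ?_⟩
        rw [a1, a2, a5, show 2 * (k + 1) - 2 = j by omega]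
        exact ⟨ht, h0, hv⟩
      · obtain ⟨a1, a2, a3, a4, a5, a6⟩ := hn (k + 1) (by omega) (by omega)
        refine ⟨k + 1, ⟨by omega, by omega⟩, Or.inr ?_⟩
        rw [a3, a4, a6, show 2 * (k + 1) - 1 = j by omega]
        exact ⟨ht, h0, hv⟩
    · exact Or.inr ⟨ht, h0, hv⟩

theorem thr_odd_of_eq (h : Params q α) (hα : α = 1 / lam q) {n : ℕ} (hn : 2 * n + 3 ≤ q) :
    thr q α (2 * n + 1) = (B q (n + 1) - B q (n + 1 + 1)) / (B q (n + 1) - B q (n + 1 - 1)) := by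
  have hq := h.four_le
  have h1 : lam q * α = 1 := by rw [hα]; have := h.lam_pos; field_simp
  induction n with
  | zero =>
    rw [h.thr_one, h1]
    norm_num [B_zero, B_one (by omega : 2 ≤ q), B_two hq]
  | succ n ih =>
    rw [show 2 * (n + 1) + 1 = 2 * n + 1 + 2 by ring, h.thr_add_two (by omega), ih (by omega)]
    have b1 := B_lt_B hq h.even (a := n + 1) (b := n + 1 + 1) (by omega) (by omega) (by omega)
    have e1 := lam_mul_B q (n + 1)
    have e2 := lam_mul_B q (n + 1 + 1)
    push_cast
    rw [show (n : ℤ) + 1 + 1 - 1 = n + 1 by ring] at *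
    have b2 : B q (n + 1) - B q (n + 1 + 1) ≠ 0 := by linarith
    have b3 : B q (n + 1 + 1) - B q (n + 1) ≠ 0 := by linarith
    rw [div_div_eq_mul_div, eq_div_iff b3, sub_mul, div_mul_eq_mul_div,
      show -1 * (B q (n + 1) - B q (n + 1 - 1)) * (B q (n + 1 + 1) - B q (n + 1)) =
        (B q (n + 1) - B q (n + 1 - 1)) * (B q (n + 1) - B q (n + 1 + 1)) by ring,
      mul_div_cancel_right₀ _ b2]
    linarith

/-- At α = 1/λ both λ(α - 1) and 1/(λα) - λ equal 1 - λ, so the two orbits coincide and every second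
strip is empty. -/
theorem thr_even_eq_odd (h : Params q α) (hα : α = 1 / lam q) {n : ℕ} (hn : 2 * n + 3 ≤ q) :
    thr q α (2 * n) = thr q α (2 * n + 1) := by
  have h1 : lam q * α = 1 := by rw [hα]; have := h.lam_pos; field_simp
  obtain ⟨p, hp⟩ := h.even
  induction n with
  | zero =>
    rw [Nat.mul_zero, h.thr_zero, h.thr_one, mul_sub, h1]; ring
  | succ n ih =>
    rw [show 2 * (n + 1) + 1 = 2 * n + 1 + 2 by ring, show 2 * (n + 1) = 2 * n + 2 by ring,
      h.thr_add_two (by omega), h.thr_add_two (by omega), ih (by omega)]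

theorem OmegaLast_eq (h : Params q α) (hα : α = 1 / lam q) : OmegaLast q = stair q α := by
  have hq := h.four_le
  have h1 : lam q * α = 1 := by rw [hα]; have := h.lam_pos; field_simp
  have hlast : thr q α (q - 2) = 1 := by
    rw [h.thr_last, chainParam, h1]
    have := h.lam_lt_two
    rw [div_eq_one_iff_eq (by linarith)]
    ring
  obtain ⟨p, hp⟩ := h.even
  have hp2 : q / 2 = p := by omega
  have hright : ∀ k : ℕ, k + 2 ≤ p → (B q ((k : ℤ) + 1 + 1) - B q ((k : ℤ) + 1 + 2)) /
      (B q ((k : ℤ) + 1 + 1) - B q ((k : ℤ) + 1)) = thr q α (2 * k + 1 + 1) := by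
    intro k hk
    rcases hk.eq_or_lt with heq | hlt
    · have e := B_half_succ hq h.even
      rw [hp2, ← heq] at e
      push_cast at e
      rw [show (k : ℤ) + 2 - 1 = k + 1 by ring, show (k : ℤ) + 2 + 1 = k + 1 + 2 by ring] at e
      have b1 := B_lt_B hq h.even (a := k + 1) (b := k + 1 + 1) (by omega) (by omega) (by omega)
      rw [e, show 2 * k + 1 + 1 = q - 2 by omega, hlast, div_self (by linarith)]
    · rw [show 2 * k + 1 + 1 = 2 * (k + 1) by ring, h.thr_even_eq_odd hα (by omega),
        h.thr_odd_of_eq hα (by omega)]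
      push_cast
      rw [show (k : ℤ) + 1 + 1 + 1 = k + 1 + 2 by ring, show (k : ℤ) + 1 + 1 - 1 = k + 1 by ring]
  ext z
  rw [h.mem_stair_iff]
  simp only [OmegaLast, Set.mem_iUnion, Set.mem_prod,
    Finset.mem_Icc, exists_prop, hp2]
  have hheight : ∀ k : ℕ, k + 2 ≤ p →
      B q ((k : ℤ) + 1) / B q ((k : ℤ) + 1 + 1) = height (lam q) (2 * k + 1 + 1) := by
    intro k hk
    rw [show 2 * k + 1 + 1 = 2 * (k + 1) by ring, height_even hq h.even (by omega), Heven]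
    push_cast
    rfl
  constructor
  · rintro ⟨n, ⟨hn1, hn2⟩, ht, hv⟩
    obtain ⟨k, rfl⟩ : ∃ k : ℕ, n = k + 1 := ⟨(n - 1).toNat, by omega⟩
    rw [hright k (by omega), ← h.thr_odd_of_eq hα (by omega)] at ht
    rw [hheight k (by omega)] at hv
    exact ⟨hv.1, Or.inl ⟨2 * k + 1, by omega, ht, hv.2⟩⟩
  · rintro ⟨h0, ⟨j, hj, ht, hv⟩ | ⟨ht, hv⟩⟩
    · obtain ⟨k, hk | hk⟩ := Nat.even_or_odd' j
      · subst hk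
        rw [h.thr_even_eq_odd hα (by omega)] at ht
        exact absurd (ht.1.trans_lt ht.2) (lt_irrefl _)
      · subst hk
        refine ⟨k + 1, ⟨by omega, by omega⟩, ?_⟩
        rw [hright k (by omega), ← h.thr_odd_of_eq hα (by omega), hheight k (by omega)]
        exact ⟨ht, h0, hv⟩
    · rw [hlast, h1] at ht
      exact absurd (ht.1.trans_lt ht.2) (lt_irrefl _)

theorem Omega_eq (h : Params q α) : Omega q α = stair q α := by
  rw [Omega]
  split_ifs with hα
  · exact h.OmegaLast_eq hα
  · exact h.OmegaGeneric_eq (lt_of_le_of_ne h.le_inv hα)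

end Params

end AlphaRosen

/-! ### The mass of the region of small approximation coefficient. -/

namespace AlphaRosen

/-- The approximation coefficient as a function on the planar domain. -/
noncomputable def coeff (z : ℝ × ℝ) : ℝ := |z.1| / (1 + z.1 * z.2)

/-- The part of the planar domain where the approximation coefficient is small. -/
def smallCoeff (c : ℝ) : Set (ℝ × ℝ) := {z | coeff z < c}

theorem measurable_coeff : Measurable coeff :=
  measurable_fst.abs.div ((measurable_fst.mul measurable_snd).const_add 1)

theorem measurableSet_smallCoeff (c : ℝ) : MeasurableSet (smallCoeff c) :=
  measurableSet_lt measurable_coeff measurable_const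

variable {q : ℕ} {α : ℝ}

/-- The mass of a horizontal section of `smallCoeff c`. -/
noncomputable def sectionMass (q : ℕ) (α c v : ℝ) : ENNReal :=
  ∫⁻ t, (smallCoeff c ∩ stair q α).indicator invDensity (t, v)

theorem stairMeasure_smallCoeff (c : ℝ) :
    stairMeasure q α (smallCoeff c) = ∫⁻ v, sectionMass q α c v := by
  have hm := (measurableSet_smallCoeff c).inter (measurableSet_stair (q := q) (α := α))
  rw [stairMeasure_apply (measurableSet_smallCoeff c), ← lintegral_indicator hm,
    Measure.volume_eq_prod, lintegral_prod_symm]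
  · rfl
  · exact (measurable_invDensity.indicator hm).aemeasurable

theorem stairMeasure_smallCoeff_eq (c : ℝ) :
    stairMeasure q α (smallCoeff c) = ∫⁻ v in Set.Ioc 0 1, sectionMass q α c v := by
  rw [stairMeasure_smallCoeff, restrict_Ioc_eq_restrict_Icc, ← lintegral_indicator measurableSet_Icc]
  refine lintegral_congr fun v => ?_
  by_cases hv : v ∈ Set.Icc (0 : ℝ) 1
  · rw [Set.indicator_of_mem hv]
  · rw [Set.indicator_of_notMem hv, sectionMass]
    rw [← lintegral_zero]
    refine lintegral_congr fun t => Set.indicator_of_notMem (fun hz => hv ?_) _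
    exact ⟨hz.2.2.1, hz.2.2.2.1⟩

namespace Params

/-- A section starting at `a` is straightened by `t ↦ t / (1 + t v)`. -/
theorem sectionMass_eq_volume (h : Params q α) {a c v : ℝ} (hv : v ∈ Set.Icc (0 : ℝ) 1)
    (hsec : ∀ t, (t, v) ∈ stair q α ↔ t ∈ Set.Ico a (lam q * α)) :
    sectionMass q α c v = volume ((fun t => t / (1 + t * v)) ''
      {t | t ∈ Set.Ico a (lam q * α) ∧ |t / (1 + t * v)| < c}) := by
  set s : Set ℝ := {t | t ∈ Set.Ico a (lam q * α) ∧ |t / (1 + t * v)| < c} with hs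
  have hpos : ∀ t ∈ s, 0 < 1 + t * v := fun t ht =>
    h.one_add_mul_pos (z := (t, v)) ((hsec t).2 ht.1).1.1 hv.1 hv.2
  have hsm : MeasurableSet s := by
    change MeasurableSet (Set.Ico a (lam q * α) ∩ {t | |t / (1 + t * v)| < c})
    refine measurableSet_Ico.inter (measurableSet_lt ?_ measurable_const)
    exact (measurable_id.div ((measurable_id.mul_const v).const_add 1)).abs
  have hder : ∀ t ∈ s, HasDerivWithinAt (fun t => t / (1 + t * v)) (1 / (1 + t * v) ^ 2) s t := by
    intro t ht
    have h1 : HasDerivAt (fun t : ℝ => 1 + t * v) v t := by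
      simpa using ((hasDerivAt_id t).mul_const v).const_add 1
    have h2 := (hasDerivAt_id t).fun_div h1 (hpos t ht).ne'
    have e : (1 * (1 + t * v) - id t * v) / (1 + t * v) ^ 2 = 1 / (1 + t * v) ^ 2 := by
      simp only [id]; congr 1; ring
    rw [e] at h2
    exact h2.hasDerivWithinAt
  have hinj : Set.InjOn (fun t : ℝ => t / (1 + t * v)) s := by
    intro t ht t' ht' htt
    simp only at htt
    rw [div_eq_div_iff (hpos t ht).ne' (hpos t' ht').ne'] at htt
    linarith
  rw [← setLIntegral_one, lintegral_image_eq_lintegral_abs_deriv_mul hsm hder hinj, sectionMass,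
    ← lintegral_indicator hsm]
  refine lintegral_congr fun t => ?_
  have hiff : (t, v) ∈ smallCoeff c ∩ stair q α ↔ t ∈ s := by
    rw [Set.mem_inter_iff, hsec, hs, Set.mem_ofPred_eq, and_comm]
    refine and_congr_right fun ht => ?_
    have h1 := h.one_add_mul_pos (z := (t, v)) ((hsec t).2 ht).1.1 hv.1 hv.2
    rw [smallCoeff, Set.mem_ofPred_eq, coeff, abs_div, abs_of_pos h1]
  by_cases ht : t ∈ s
  · rw [Set.indicator_of_mem (hiff.2 ht), Set.indicator_of_mem ht, mul_one, invDensity]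
    rw [abs_of_nonneg (by positivity)]
  · rw [Set.indicator_of_notMem (fun h' => ht (hiff.1 h')), Set.indicator_of_notMem ht]

theorem sectionMass_le (h : Params q α) {a c v : ℝ} (hv : v ∈ Set.Icc (0 : ℝ) 1)
    (hsec : ∀ t, (t, v) ∈ stair q α ↔ t ∈ Set.Ico a (lam q * α)) (har : a < lam q * α) :
    sectionMass q α c v ≤ ENNReal.ofReal (c - max (a / (1 + a * v)) (-c)) := by
  rw [h.sectionMass_eq_volume hv hsec, ← Real.volume_Ico]
  refine measure_mono ?_
  rintro _ ⟨t, ⟨ht, htc⟩, rfl⟩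
  obtain ⟨h1, h2⟩ := abs_lt.1 htc
  refine ⟨max_le ?_ h1.le, h2⟩
  have ha := h.one_add_mul_pos (z := (a, v)) ((hsec a).2 ⟨le_rfl, har⟩).1.1 hv.1 hv.2
  have hb := h.one_add_mul_pos (z := (t, v)) ((hsec t).2 ht).1.1 hv.1 hv.2
  simp only at ha hb
  rw [div_le_div_iff₀ ha hb]
  linarith [ht.1]

theorem le_sectionMass (h : Params q α) {a c v : ℝ} (hv : v ∈ Set.Icc (0 : ℝ) 1)
    (hsec : ∀ t, (t, v) ∈ stair q α ↔ t ∈ Set.Ico a (lam q * α)) (har : a < lam q * α)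
    (hc : c ≤ lam q * α / (1 + lam q * α * v)) :
    ENNReal.ofReal (c - max (a / (1 + a * v)) (-c)) ≤ sectionMass q α c v := by
  rw [h.sectionMass_eq_volume hv hsec, ← Real.volume_Ioo]
  refine measure_mono ?_
  rintro y ⟨hy1, hy2⟩
  obtain ⟨hya, hyc⟩ := max_lt_iff.1 hy1
  have ha := h.one_add_mul_pos (z := (a, v)) ((hsec a).2 ⟨le_rfl, har⟩).1.1 hv.1 hv.2
  simp only at ha
  have hr : 0 < 1 + lam q * α * v := by have := h.right_pos; have := hv.1; positivity
  rw [div_lt_iff₀ ha] at hya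
  have hyr := hy2.trans_le hc
  rw [lt_div_iff₀ hr] at hyr
  -- The inverse substitution is t = y/(1 - yv); its denominator is positive because y lies below
  -- r/(1 + rv) with r = λα.
  have hy : 0 < 1 - y * v := by
    by_contra hcon
    nlinarith [h.right_pos, hv.1, mul_nonneg h.right_pos.le hv.1]
  have e1 : y / (1 - y * v) / (1 + y / (1 - y * v) * v) = y := by
    have : 1 + y / (1 - y * v) * v = 1 / (1 - y * v) := by field_simp; ring
    rw [this]; field_simp
  refine ⟨y / (1 - y * v), ⟨⟨?_, ?_⟩, ?_⟩, e1⟩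
  · rw [le_div_iff₀ hy]; linarith
  · rw [div_lt_iff₀ hy]; linarith
  · rw [e1]; exact abs_lt.2 ⟨hyc, hy2⟩

theorem mem_stair_section (h : Params q α) {j : ℕ} (hj : j + 2 ≤ q) {v : ℝ}
    (hv : v ∈ Set.Ioc (height (lam q) j) (height (lam q) (j + 1))) (hv0 : 0 ≤ v) (t : ℝ) :
    (t, v) ∈ stair q α ↔ t ∈ Set.Ico (thr q α j) (lam q * α) := by
  constructor
  · rintro ⟨h1, -, -, h4⟩
    refine ⟨?_, h1.2⟩
    by_contra hcon
    exact absurd (h4 j hj (not_le.1 hcon)) (not_le.2 hv.1)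
  · rintro ⟨h1, h2⟩
    refine ⟨⟨?_, h2⟩, hv0, hv.2.trans (height_le_one h.four_le h.even (by omega)),
      fun i hi hlt => ?_⟩
    · rw [← h.thr_zero]
      exact (h.thr_mono (Nat.zero_le _) hj).trans h1
    · refine hv.2.trans (h.height_mono ?_ (by omega))
      by_contra hcon
      exact absurd hlt (not_lt.2 ((h.thr_mono (by omega : i ≤ j) hj).trans h1))

theorem thr_lt_right (h : Params q α) {j : ℕ} (hj : j + 3 ≤ q) : thr q α j < lam q * α :=
  ((h.thr_mono (by omega : j ≤ q - 3) (by omega)).trans h.thr_penultimate_nonpos).trans_lt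
    h.right_pos

/-- Every level below the last but two heights lies in some step. -/
theorem exists_step (h : Params q α) {v : ℝ} (hv : v ∈ Set.Ioc 0 (lam q - 1)) :
    ∃ j, j + 4 ≤ q ∧ v ∈ Set.Ioc (height (lam q) j) (height (lam q) (j + 1)) := by
  have hq := h.four_le
  classical
  set P : ℕ → Prop := fun j => height (lam q) j < v
  have hP0 : P 0 := hv.1
  have hP := Nat.findGreatest_spec (P := P) (Nat.zero_le (q - 4)) hP0
  have hle := Nat.findGreatest_le (P := P) (q - 4)
  refine ⟨_, by omega, hP, ?_⟩
  rcases hle.eq_or_lt with heq | hlt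
  · rw [heq, show q - 4 + 1 = q - 3 by omega, height_antepenultimate hq h.even]
    exact hv.2
  · exact not_lt.1 (Nat.findGreatest_is_greatest (P := P) (Nat.lt_succ_self _) hlt)

/-- The first entry λ/(λ + 2) of the minimum is r/(1 + rv) at r = λ/2, v = 1, its least value since
r = λα ≥ λ/2 and v ≤ 1. -/
theorem le_right_coeff (h : Params q α) {c v : ℝ} (hc : c ≤ L q α) (hv : v ∈ Set.Icc (0 : ℝ) 1) :
    c ≤ lam q * α / (1 + lam q * α * v) := by
  have h1 : c ≤ lam q / (lam q + 2) := hc.trans (min_le_left _ _)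
  have h2 := h.lam_pos
  have h3 := h.half_lam_le
  have h4 : lam q * α * v ≤ lam q * α := by nlinarith [h.right_pos, hv.2]
  refine h1.trans ?_
  rw [div_le_div_iff₀ (by linarith) (by nlinarith [hv.1, mul_nonneg h.right_pos.le hv.1])]
  nlinarith

/-- The second entry of the minimum comes from the step of index q - 4. With left end y and last
threshold m, y(m + λ) = -1, so -y/(1 + yv) = 1/(m + λ - v), which exceeds 1/(m + 2/λ) because v > λ
- 2/λ. The reciprocal of m + 2/λ is that second entry. -/
theorem inner_coeff_le (h : Params q α) {c v : ℝ} (hc0 : 0 ≤ c) (hc : c ≤ L q α) {j : ℕ}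
    (hj : j + 4 ≤ q) (hv : v ∈ Set.Ioc (height (lam q) j) (height (lam q) (j + 1)))
    (hv0 : 0 ≤ v) (hv1 : v ≤ 1) :
    thr q α j / (1 + thr q α j * v) ≤ -c := by
  have hl := h.one_lt_lam
  have hl2 := h.lam_lt_two
  have hq := h.four_le
  have hneg := h.thr_neg hj
  have hpos : 0 < 1 + thr q α j * v := by
    refine h.one_add_mul_pos (z := (thr q α j, v)) ?_ hv0 hv1
    rw [← h.thr_zero]; exact h.thr_mono (Nat.zero_le _) (by omega)
  rw [div_le_iff₀ hpos]
  rcases (show j ≤ q - 4 by omega).eq_or_lt with rfl | hlt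
  · have hm := h.thr_add_two hj
    rw [show q - 4 + 2 = q - 2 by omega] at hm
    have hv2 := hv.1
    rw [height_preantepenultimate hq h.even] at hv2
    have hm0 := h.thr_last_nonneg
    set y := thr q α (q - 4)
    set m := thr q α (q - 2)
    have hc2 : c * (m + 2 / lam q) ≤ 1 := by
      have h4 : 0 < 4 - lam q ^ 2 := by nlinarith
      have h5 : 0 < 2 - lam q * (lam q * α) := by linarith [h.lam_mul_lt_two]
      have e : m + 2 / lam q = (4 - lam q ^ 2) / (lam q * (2 - lam q * (lam q * α))) := by
        simp only [m]
        have h5' : 2 - lam q ^ 2 * α ≠ 0 := by nlinarith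
        rw [h.thr_last, chainParam]
        field_simp
        ring
      have h6 : c ≤ lam q * (2 - α * lam q ^ 2) / (4 - lam q ^ 2) := hc.trans (min_le_right _ _)
      rw [e, mul_div_assoc', div_le_one (by positivity)]
      rw [le_div_iff₀ h4] at h6
      linarith
    have hy : -1 / y = m + lam q := by linarith
    have hy2 : y * (m + lam q) = -1 := by
      have := hneg.ne
      rw [← hy]; field_simp
    have h7 : c * (m + lam q - v) ≤ 1 := by nlinarith
    nlinarith
  -- On earlier steps the first entry suffices: two indices later the threshold is still
  -- nonpositive, so -1/t ≤ λ, while λ/(λ + 2) ≤ 1/λ.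
  · have h1 : 1 / lam q ≤ -thr q α j := by
      have h2 := h.thr_mono (by omega : j ≤ q - 5) (by omega)
      have h3 := h.thr_add_two (by omega : (q - 5) + 4 ≤ q)
      have h4 := h.thr_neg (by omega : (q - 5) + 4 ≤ q)
      rw [show q - 5 + 2 = q - 3 by omega] at h3
      have h5 := h.thr_penultimate_nonpos
      refine le_trans ?_ (neg_le_neg h2)
      rw [div_le_iff₀ h.lam_pos]
      have h6 : -1 / thr q α (q - 5) ≤ lam q := by linarith
      rw [div_le_iff_of_neg h4] at h6
      linarith
    have h2 : c ≤ 1 / lam q := by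
      refine (hc.trans (min_le_left _ _)).trans ?_
      rw [div_le_div_iff₀ (by linarith) h.lam_pos]
      nlinarith
    nlinarith [mul_nonneg hc0 (mul_nonneg (neg_nonneg.2 hneg.le) hv0)]

end Params

/-- The profile of the two innermost steps. -/
noncomputable def profile (m v : ℝ) : ℝ := m / (1 + m * v)

theorem measurable_profile (m : ℝ) : Measurable (profile m) :=
  ((measurable_id.const_mul m).const_add 1).const_div m

namespace Params

/-- The reflection v ↦ λ - v carries the middle band onto the top band, where the two corrections
cancel. What remains is 2c times (λ - 1) + (1 - λ/2) = λ/2. -/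
theorem lintegral_profile (h : Params q α) {c m : ℝ} (hc : 0 ≤ c) (hm : 0 ≤ m) :
    (∫⁻ _ in Set.Ioc 0 (lam q - 1), ENNReal.ofReal (2 * c)) +
      (∫⁻ v in Set.Ioc (lam q - 1) (lam q / 2),
        ENNReal.ofReal (c + min c (profile m (lam q - v)))) +
      ∫⁻ v in Set.Ioc (lam q / 2) 1, ENNReal.ofReal (c - min c (profile m v)) =
    ENNReal.ofReal (lam q * c) := by
  have hl := h.one_lt_lam
  have hl2 := h.lam_lt_two
  have hflip : (∫⁻ v in Set.Ioc (lam q - 1) (lam q / 2),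
      ENNReal.ofReal (c + min c (profile m (lam q - v)))) =
      ∫⁻ v in Set.Ioc (lam q / 2) 1, ENNReal.ofReal (c + min c (profile m v)) := by
    rw [restrict_Ioc_eq_restrict_Icc, restrict_Ioc_eq_restrict_Icc,
      ← lintegral_indicator measurableSet_Icc, ← lintegral_indicator measurableSet_Icc,
      ← lintegral_sub_left_eq_self _ (lam q)]
    refine lintegral_congr fun v => ?_
    by_cases hv : v ∈ Set.Icc (lam q / 2) 1
    · rw [Set.indicator_of_mem hv, Set.indicator_of_mem]
      · rw [sub_sub_cancel]
      · constructor <;> linarith [hv.1, hv.2]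
    · rw [Set.indicator_of_notMem hv, Set.indicator_of_notMem]
      exact fun hv' => hv ⟨by linarith [hv'.2], by linarith [hv'.1]⟩
  have hsum : (∫⁻ v in Set.Ioc (lam q / 2) 1, ENNReal.ofReal (c + min c (profile m v))) +
      (∫⁻ v in Set.Ioc (lam q / 2) 1, ENNReal.ofReal (c - min c (profile m v))) =
      ∫⁻ _ in Set.Ioc (lam q / 2) 1, ENNReal.ofReal (2 * c) := by
    rw [← lintegral_add_left
      (((measurable_const.min (measurable_profile m)).const_add c).ennreal_ofReal)]
    refine setLIntegral_congr_fun measurableSet_Ioc fun v hv => ?_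
    have hp : 0 ≤ profile m v := by
      have : 0 ≤ v := by linarith [hv.1]
      exact div_nonneg hm (by positivity)
    rw [← ENNReal.ofReal_add (by have := le_min hc hp; linarith)
      (by linarith [min_le_left c (profile m v)])]
    congr 1
    ring
  rw [hflip, add_assoc, hsum, setLIntegral_const, setLIntegral_const, Real.volume_Ioc,
    Real.volume_Ioc, ← mul_add, ← ENNReal.ofReal_add (by linarith) (by linarith),
    ← ENNReal.ofReal_mul (by positivity)]
  congr 1
  ring

theorem lintegral_split (h : Params q α) (f : ℝ → ENNReal) :
    ∫⁻ v in Set.Ioc 0 1, f v = (∫⁻ v in Set.Ioc 0 (lam q - 1), f v) +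
      (∫⁻ v in Set.Ioc (lam q - 1) (lam q / 2), f v) + ∫⁻ v in Set.Ioc (lam q / 2) 1, f v := by
  have hl := h.one_lt_lam
  have hl2 := h.lam_lt_two
  rw [← lintegral_union measurableSet_Ioc
      (Set.Ioc_disjoint_Ioc_of_le le_rfl), Set.Ioc_union_Ioc_eq_Ioc (by linarith) (by linarith),
    ← lintegral_union measurableSet_Ioc
      (Set.Ioc_disjoint_Ioc_of_le le_rfl), Set.Ioc_union_Ioc_eq_Ioc (by linarith) (by linarith)]

theorem thr_penultimate_coeff (h : Params q α) {v : ℝ} (hv : v ≤ lam q) :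
    thr q α (q - 3) / (1 + thr q α (q - 3) * v) = -profile (thr q α (q - 2)) (lam q - v) := by
  have hm := h.thr_last_nonneg
  have hl := h.lam_pos
  rw [h.thr_penultimate, profile]
  set m := thr q α (q - 2)
  have h1 : 0 < 1 + m * (lam q - v) := by
    have : 0 ≤ lam q - v := by linarith
    positivity
  have h2 : 0 < 1 + lam q * m := by positivity
  have e : 1 + -(m / (1 + lam q * m)) * v = (1 + m * (lam q - v)) / (1 + lam q * m) := by
    field_simp
    ring
  rw [e]
  field_simp

theorem sectionMass_middle (h : Params q α) {v : ℝ}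
    (hv : v ∈ Set.Ioc (lam q - 1) (lam q / 2)) :
    ∀ t, (t, v) ∈ stair q α ↔ t ∈ Set.Ico (thr q α (q - 3)) (lam q * α) := by
  have hq := h.four_le
  refine h.mem_stair_section (by omega) ?_ (by linarith [h.one_lt_lam, hv.1])
  rwa [height_antepenultimate hq h.even, show q - 3 + 1 = q - 2 by omega,
    height_penultimate hq h.even]

theorem sectionMass_top (h : Params q α) {v : ℝ} (hv : v ∈ Set.Ioc (lam q / 2) 1) :
    ∀ t, (t, v) ∈ stair q α ↔ t ∈ Set.Ico (thr q α (q - 2)) (lam q * α) := by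
  have hq := h.four_le
  refine h.mem_stair_section (by omega) ?_ (by linarith [h.one_lt_lam, hv.1])
  rwa [height_penultimate hq h.even, show q - 2 + 1 = q - 1 by omega, height_last hq h.even]

theorem sectionMass_top_le (h : Params q α) {c v : ℝ} (hc : 0 ≤ c)
    (hv : v ∈ Set.Ioc (lam q / 2) 1) :
    sectionMass q α c v ≤ ENNReal.ofReal (c - min c (profile (thr q α (q - 2)) v)) := by
  have hl := h.one_lt_lam
  have hv1 : v ∈ Set.Icc (0 : ℝ) 1 := ⟨by linarith [hv.1], hv.2⟩
  have hm := h.thr_last_nonneg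
  have hp : 0 ≤ profile (thr q α (q - 2)) v := by
    have := hv1.1
    exact div_nonneg hm (by positivity)
  rcases h.thr_last_le.eq_or_lt with heq | hlt
  -- Equality of the last threshold and λα means λα = 1; the top strip is then empty.
  · have : sectionMass q α c v = 0 := by
      rw [h.sectionMass_eq_volume hv1 (h.sectionMass_top hv), heq]
      simp
    rw [this]
    exact zero_le
  · refine (h.sectionMass_le hv1 (h.sectionMass_top hv) hlt).trans (ENNReal.ofReal_le_ofReal_iff' |>.2 ?_)
    rw [← profile, max_eq_left (by linarith)]
    rcases le_total c (profile (thr q α (q - 2)) v) with h1 | h1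
    · right; linarith
    · left; rw [min_eq_right h1]

theorem le_sectionMass_top (h : Params q α) {c v : ℝ} (hc : 0 ≤ c) (hcL : c ≤ L q α)
    (hv : v ∈ Set.Ioc (lam q / 2) 1) :
    ENNReal.ofReal (c - min c (profile (thr q α (q - 2)) v)) ≤ sectionMass q α c v := by
  have hl := h.one_lt_lam
  have hv1 : v ∈ Set.Icc (0 : ℝ) 1 := ⟨by linarith [hv.1], hv.2⟩
  have hm := h.thr_last_nonneg
  have hp : 0 ≤ profile (thr q α (q - 2)) v := by
    have := hv1.1
    exact div_nonneg hm (by positivity)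
  have hcr := h.le_right_coeff hcL hv1
  rcases h.thr_last_le.eq_or_lt with heq | hlt
  · rw [profile, heq, min_eq_left hcr, sub_self, ENNReal.ofReal_zero]
    exact zero_le
  · refine le_trans (ENNReal.ofReal_le_ofReal_iff' |>.2 ?_)
      (h.le_sectionMass hv1 (h.sectionMass_top hv) hlt hcr)
    rw [← profile, max_eq_left (by linarith)]
    rcases le_total c (profile (thr q α (q - 2)) v) with h1 | h1
    · right; rw [min_eq_left h1]; linarith
    · left; rw [min_eq_right h1]

theorem sectionMass_le_two_mul (h : Params q α) {c v : ℝ}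
    (hv : v ∈ Set.Ioc 0 (lam q - 1)) : sectionMass q α c v ≤ ENNReal.ofReal (2 * c) := by
  obtain ⟨j, hj, hvj⟩ := h.exists_step hv
  have hv1 : v ∈ Set.Icc (0 : ℝ) 1 := ⟨hv.1.le, by linarith [hv.2, h.lam_lt_two]⟩
  refine (h.sectionMass_le hv1 (h.mem_stair_section (by omega) hvj hv.1.le)
    (h.thr_lt_right (by omega))).trans (ENNReal.ofReal_le_ofReal ?_)
  linarith [le_max_right (thr q α j / (1 + thr q α j * v)) (-c)]

theorem two_mul_le_sectionMass (h : Params q α) {c v : ℝ} (hc : 0 ≤ c) (hcL : c ≤ L q α)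
    (hv : v ∈ Set.Ioc 0 (lam q - 1)) : ENNReal.ofReal (2 * c) ≤ sectionMass q α c v := by
  obtain ⟨j, hj, hvj⟩ := h.exists_step hv
  have hv1 : v ∈ Set.Icc (0 : ℝ) 1 := ⟨hv.1.le, by linarith [hv.2, h.lam_lt_two]⟩
  refine le_trans (ENNReal.ofReal_le_ofReal ?_) (h.le_sectionMass hv1
    (h.mem_stair_section (by omega) hvj hv.1.le) (h.thr_lt_right (by omega))
    (h.le_right_coeff hcL hv1))
  rw [max_eq_right (h.inner_coeff_le hc hcL hj hvj hv1.1 hv1.2)]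
  linarith

/-- Each section bound truncates an interval to (-c, c), which is valid without c ≤ L. This matters
because the upper frequency estimate is applied at values slightly above the given one, possibly
beyond L. -/
theorem stairMeasure_smallCoeff_le (h : Params q α) {c : ℝ} (hc : 0 ≤ c) :
    stairMeasure q α (smallCoeff c) ≤ ENNReal.ofReal (lam q * c) := by
  rw [stairMeasure_smallCoeff_eq, ← h.lintegral_profile hc h.thr_last_nonneg, h.lintegral_split]
  have hl := h.one_lt_lam
  have hl2 := h.lam_lt_two
  refine add_le_add (add_le_add ?_ ?_) ?_
  · exact setLIntegral_mono' measurableSet_Ioc fun v hv => h.sectionMass_le_two_mul hv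
  · refine setLIntegral_mono' measurableSet_Ioc fun v hv => ?_
    have hv1 : v ∈ Set.Icc (0 : ℝ) 1 := ⟨by linarith [hv.1], by linarith [hv.2]⟩
    refine (h.sectionMass_le hv1 (h.sectionMass_middle hv)
      (h.thr_lt_right (by have := h.four_le; omega))).trans (ENNReal.ofReal_le_ofReal ?_)
    rw [h.thr_penultimate_coeff (by linarith [hv.2]), max_neg_neg, min_comm]
    linarith
  · exact setLIntegral_mono' measurableSet_Ioc fun v hv => h.sectionMass_top_le hc hv

/-- The mass of the part of the planar domain with small approximation coefficient. -/
theorem stairMeasure_smallCoeff_of_le (h : Params q α) {c : ℝ} (hc : 0 ≤ c) (hcL : c ≤ L q α) :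
    stairMeasure q α (smallCoeff c) = ENNReal.ofReal (lam q * c) := by
  refine le_antisymm (h.stairMeasure_smallCoeff_le hc) ?_
  rw [stairMeasure_smallCoeff_eq, ← h.lintegral_profile hc h.thr_last_nonneg, h.lintegral_split]
  have hl := h.one_lt_lam
  have hl2 := h.lam_lt_two
  refine add_le_add (add_le_add ?_ ?_) ?_
  · exact setLIntegral_mono' measurableSet_Ioc fun v hv => h.two_mul_le_sectionMass hc hcL hv
  · refine setLIntegral_mono' measurableSet_Ioc fun v hv => ?_
    have hv1 : v ∈ Set.Icc (0 : ℝ) 1 := ⟨by linarith [hv.1], by linarith [hv.2]⟩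
    refine le_trans (ENNReal.ofReal_le_ofReal ?_) (h.le_sectionMass hv1 (h.sectionMass_middle hv)
      (h.thr_lt_right (by have := h.four_le; omega)) (h.le_right_coeff hcL hv1))
    rw [h.thr_penultimate_coeff (by linarith [hv.2]), max_neg_neg, min_comm]
    linarith
  · exact setLIntegral_mono' measurableSet_Ioc fun v hv => h.le_sectionMass_top hc hcL hv

end Params

end AlphaRosen

/-! ### Tail-invariant sets are invariant under negation and inversion. -/

namespace AlphaRosen

section Transcendental

theorem Transcendental.rat_ne_zero {x : ℝ} (hx : Transcendental ℚ x) : x ≠ 0 := by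
  rintro rfl
  exact hx isAlgebraic_zero

theorem Transcendental.sub_lam {x : ℝ} (hx : Transcendental ℚ x) (q : ℕ) :
    Transcendental ℚ (x - lam q) := fun h => hx (by simpa using h.add (lam_isAlgebraic q))

theorem Transcendental.neg_real {x : ℝ} (hx : Transcendental ℚ x) :
    Transcendental ℚ (-x) := fun h => hx (by simpa using h.neg)

theorem Transcendental.one_div_real {x : ℝ} (hx : Transcendental ℚ x) :
    Transcendental ℚ (1 / x) := fun h => hx (by simpa using h.inv)

theorem Transcendental.lam_sub {x : ℝ} (hx : Transcendental ℚ x) (q : ℕ) :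
    Transcendental ℚ (lam q - x) := by
  have := Transcendental.neg_real (Transcendental.sub_lam hx q)
  rwa [neg_sub] at this

theorem Transcendental.sub_int_mul_lam {x : ℝ} (hx : Transcendental ℚ x) (q : ℕ) (n : ℤ) :
    Transcendental ℚ (x - n * lam q) := fun h => hx (by
  have h1 : IsAlgebraic ℚ ((n : ℝ) * lam q) := (isAlgebraic_intCast n).mul (lam_isAlgebraic q)
  simpa using h.add h1)

end Transcendental

/-- Sets that are invariant under the translation by `l` and under the branches of the map. -/
structure TailInvariant (q : ℕ) (α : ℝ) (D : Set ℝ) : Prop where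
  add_lam : ∀ x, x + lam q ∈ D ↔ x ∈ D
  inv_of_lt : ∀ x, 0 < x → x < lam q * α → (x ∈ D ↔ 1 / x ∈ D)
  neg_of_le : ∀ x, 0 < x → x ≤ lam q * (1 - α) → (-x ∈ D ↔ 1 / x ∈ D)

namespace TailInvariant

variable {q : ℕ} {α : ℝ} {D : Set ℝ}

theorem lam_sub (hD : TailInvariant q α D) (x : ℝ) : lam q - x ∈ D ↔ -x ∈ D := by
  rw [← hD.add_lam (-x), neg_add_eq_sub]

theorem sub_lam (hD : TailInvariant q α D) (x : ℝ) : x - lam q ∈ D ↔ x ∈ D := by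
  rw [← hD.add_lam (x - lam q), sub_add_cancel]

theorem add_int_mul (hD : TailInvariant q α D) (x : ℝ) (n : ℤ) : x + n * lam q ∈ D ↔ x ∈ D := by
  induction n using Int.induction_on with
  | zero => simp
  | succ n ih =>
    rw [← ih, ← hD.add_lam (x + ((n : ℤ) : ℝ) * lam q)]
    push_cast
    ring_nf
  | pred n ih =>
    rw [← ih, ← hD.sub_lam (x + ((-(n : ℤ) : ℤ) : ℝ) * lam q)]
    push_cast
    ring_nf

variable {a : ℝ}

/-- Write x ∼ y for equal membership in `D`, and c_j for the chain. One descends by -c_{2k+2} ∼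
1/c_{2k+2} = λ - c_{2k} ∼ -c_{2k}, down to -c_0 = a. Since the chain increases, bounding its top
element is enough. -/
theorem neg_chain_even (h : Params q α) (hD : TailInvariant q α D) (ha : 0 ≤ a) {k : ℕ}
    (hk : 2 * k + 2 ≤ q) (hle : chain (lam q) a (2 * k) ≤ lam q * (1 - α)) :
    -chain (lam q) a (2 * k) ∈ D ↔ a ∈ D := by
  induction k with
  | zero => simp [chain]
  | succ k ih =>
    have h1 := chain_pos h.four_le h.even ha (by omega : 2 * k + 4 ≤ q)
    have h2 := chain_le_succ_succ h.four_le h.even ha (by omega : 2 * k + 4 ≤ q)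
    rw [show 2 * (k + 1) = 2 * k + 2 by ring] at *
    rw [hD.neg_of_le _ h1 hle, chain, one_div_one_div, hD.lam_sub, ih (by omega) (h2.trans hle)]

/-- The same descent ends with -a/(1 + λa) ∼ 1/a + λ ∼ 1/a. -/
theorem neg_chain_odd (h : Params q α) (hD : TailInvariant q α D) (ha : 0 < a) {k : ℕ}
    (hk : 2 * k + 3 ≤ q) (hle : chain (lam q) a (2 * k + 1) ≤ lam q * (1 - α)) :
    -chain (lam q) a (2 * k + 1) ∈ D ↔ 1 / a ∈ D := by
  have hl := h.lam_pos
  induction k with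
  | zero =>
    have h1 : 0 < chain (lam q) a 1 := by simp only [chain]; positivity
    rw [Nat.mul_zero, zero_add] at *
    rw [hD.neg_of_le _ h1 hle, chain, one_div_div, ← hD.add_lam (1 / a)]
    rw [show (1 + lam q * a) / a = 1 / a + lam q by field_simp]
  | succ k ih =>
    obtain ⟨p, hp⟩ := h.even
    have h1 := chain_pos h.four_le h.even ha.le (by omega : (2 * k + 1) + 4 ≤ q)
    have h2 := chain_le_succ_succ h.four_le h.even ha.le (by omega : (2 * k + 1) + 4 ≤ q)
    rw [show 2 * (k + 1) + 1 = 2 * k + 1 + 2 by ring] at *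
    rw [hD.neg_of_le _ h1 hle, chain, one_div_one_div, hD.lam_sub]
    exact ih (by omega) (h2.trans hle)

/-- The parameter of the chain is a Möbius image of its last element. -/
theorem transcendental_chainParam (h : Params q α) {x : ℝ} (hx : Transcendental ℚ x)
    (hx1 : lam q / 2 ≤ x) (hx2 : lam q * x < 2) :
    Transcendental ℚ (chainParam (lam q) x) := by
  have ha := chainParam_nonneg hx1 hx2
  have key : ∀ i, 2 * i + 2 ≤ q →
      Transcendental ℚ (chain (lam q) (chainParam (lam q) x) (q - 2 - 2 * i)) := by
    intro i
    induction i with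
    | zero =>
      intro _
      rw [Nat.mul_zero, Nat.sub_zero, chain_last h.four_le h.even hx1 hx2]
      exact Transcendental.lam_sub hx q
    | succ i ih =>
      intro hi
      have h1 := ih (by omega)
      have h2 := chain_lt_lam h.four_le h.even ha (by omega : (q - 2 - 2 * (i + 1)) + 4 ≤ q)
      have e : q - 2 - 2 * i = (q - 2 - 2 * (i + 1)) + 2 := by omega
      rw [e, chain] at h1
      have h3 := Transcendental.lam_sub (Transcendental.one_div_real h1) q
      rwa [one_div_one_div, sub_sub_cancel] at h3
  obtain ⟨p, hp⟩ := h.even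
  have hq := h.four_le
  have h0 := key (p - 1) (by omega)
  rw [show q - 2 - 2 * (p - 1) = 0 by omega, chain] at h0
  simpa using Transcendental.neg_real h0

/-- The chain with parameter a ends in λ - 1/x, λ - x. Its odd part links x to 1/a, its even part
links λ - x to a, and a ∼ 1/a because 0 < a ≤ x < λα. -/
theorem lam_sub_iff (h : Params q α) (hD : TailInvariant q α D) {x : ℝ} (hx : Transcendental ℚ x)
    (hx1 : lam q / 2 ≤ x) (hx2 : x < lam q * α) : lam q - x ∈ D ↔ x ∈ D := by
  have hl := h.one_lt_lam
  have hl2 := h.lam_lt_two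
  have hq := h.four_le
  have hlx : lam q * x < 2 := by nlinarith [h.le_one]
  have ha0 := chainParam_nonneg hx1 hlx
  have ha : 0 < chainParam (lam q) x := lt_of_le_of_ne ha0
    (Transcendental.rat_ne_zero (transcendental_chainParam h hx hx1 hlx)).symm
  have hax := chainParam_le_self h.lam_pos (by linarith) (by linarith [h.le_one]) hlx
  have hx0 : 0 < x := by linarith
  have e1 := chain_last hq h.even hx1 hlx
  have e2 := chain_penultimate hq h.even hx1 hlx
  obtain ⟨p, hp⟩ := h.even
  set a := chainParam (lam q) x
  -- the side of `x`
  have hodd : x ∈ D ↔ 1 / a ∈ D := by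
    have h1 : lam q * α ≤ 1 / x := by
      rw [le_div_iff₀ hx0]; nlinarith [h.le_one]
    have h2 := neg_chain_odd h hD ha (k := p - 2) (by omega)
    rw [show 2 * (p - 2) + 1 = q - 3 by omega, e2] at h2
    rw [hD.inv_of_lt x hx0 hx2, ← h2 (by linarith), neg_sub, hD.sub_lam]
  -- the side of `l - x`
  have heven : lam q - x ∈ D ↔ a ∈ D := by
    have h1 : chain (lam q) a (q - 4) = lam q - 1 / (lam q - x) := by
      rw [← e1, show q - 2 = (q - 4) + 2 by omega, chain, one_div_one_div]
      ring
    have h2 := neg_chain_even h hD ha.le (k := p - 2) (by omega)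
    rw [show 2 * (p - 2) = q - 4 by omega, h1] at h2
    have h3 : lam q * α ≤ 1 / (lam q - x) := by
      rw [le_div_iff₀ (by linarith [h.le_one])]
      nlinarith [h.le_one, h.right_pos]
    rw [hD.inv_of_lt (lam q - x) (by linarith [h.le_one]) (by linarith), ← h2 (by linarith),
      neg_sub, hD.sub_lam]
  rw [hodd, heven]
  exact hD.inv_of_lt a ha (hax.trans_lt hx2)

/-- Modulo λ the point lies in the fundamental interval. If |t| ≤ λ(1 - α), the branches at t and -t
share the value 1/|t|. The remaining t fill an interval symmetric about λ/2, where -t ∼ λ - t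
reduces the claim to `lam_sub_iff`. -/
theorem neg_iff (h : Params q α) (hD : TailInvariant q α D) {x : ℝ} (hx : Transcendental ℚ x) :
    -x ∈ D ↔ x ∈ D := by
  have hl := h.lam_pos
  have small : ∀ y, Transcendental ℚ y → 0 < y → y ≤ lam q * (1 - α) → (-y ∈ D ↔ y ∈ D) := by
    intro y _ hy0 hy
    rcases (show lam q * (1 - α) ≤ lam q * α by nlinarith [h.half_le]).eq_or_lt with heq | hlt
    -- For α = 1/2 the endpoint λ/2 is not covered by `inv_of_lt`, but there -y and y differ by λ.
    · rcases hy.eq_or_lt with hy' | hy'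
      · rw [← hD.add_lam (-y), show -y + lam q = y by rw [hy']; linarith]
      · rw [hD.neg_of_le y hy0 hy, hD.inv_of_lt y hy0 (by linarith)]
    · rw [hD.neg_of_le y hy0 hy, hD.inv_of_lt y hy0 (by linarith)]
  set n := ⌊x / lam q + 1 - α⌋
  set t := x - n * lam q with ht
  have htr : Transcendental ℚ t := Transcendental.sub_int_mul_lam hx q n
  have ht0 := Transcendental.rat_ne_zero htr
  have hn1 := Int.floor_le (x / lam q + 1 - α)
  have hn2 := Int.lt_floor_add_one (x / lam q + 1 - α)
  have hx' : x = x / lam q * lam q := by field_simp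
  have ht1 : lam q * (α - 1) ≤ t := by rw [ht]; nlinarith
  have ht2 : t < lam q * α := by rw [ht]; nlinarith
  have e1 : x ∈ D ↔ t ∈ D := by
    rw [← hD.add_int_mul t n, ht, sub_add_cancel]
  have e2 : -x ∈ D ↔ -t ∈ D := by
    rw [← hD.add_int_mul (-x) n, ht, neg_sub, neg_add_eq_sub]
  rw [e1, e2]
  rcases lt_or_gt_of_ne ht0 with hneg | hpos
  · have := small (-t) (Transcendental.neg_real htr) (by linarith) (by linarith)
    rw [neg_neg] at this
    exact this.symm
  · by_cases hle : t ≤ lam q * (1 - α)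
    · exact small t htr hpos hle
    · rw [← hD.lam_sub]
      rcases le_or_gt (lam q / 2) t with h2 | h2
      · exact lam_sub_iff h hD htr h2 ht2
      · have := lam_sub_iff h hD (Transcendental.lam_sub htr q) (by linarith) (by linarith)
        rw [sub_sub_cancel] at this
        exact this.symm

theorem mem_iff_chainParam (h : Params q α) (hD : TailInvariant q α D) {x : ℝ}
    (hx1 : lam q * α ≤ x) (hx2 : lam q * x < 2) :
    x ∈ D ↔ chainParam (lam q) x ∈ D := by
  have hx3 := h.half_lam_le.trans hx1
  obtain ⟨p, hp⟩ := h.even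
  have hq := h.four_le
  have h1 := neg_chain_even h hD (chainParam_nonneg hx3 hx2) (k := p - 1) (by omega)
  rw [show 2 * (p - 1) = q - 2 by omega, chain_last h.four_le h.even hx3 hx2] at h1
  rw [← h1 (by linarith), neg_sub, hD.sub_lam]

/-- Beyond 1/(λα) inversion is a branch of the map. Below that, x and 1/x are equivalent to their
chain parameters, which are again mutually inverse, and passing to the parameter at least doubles
the distance to the fixed point 1. The number n bounds how many doublings are needed. -/
theorem inv_iff_of_one_lt (h : Params q α) (hD : TailInvariant q α D) (n : ℕ) {x : ℝ}
    (hx : Transcendental ℚ x) (hx1 : 1 < x) (hn : 1 / (lam q * α) < 1 + 2 ^ n * (x - 1)) :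
    1 / x ∈ D ↔ x ∈ D := by
  have hl := h.one_lt_lam
  have hl2 := h.lam_lt_two
  have hr := h.right_pos
  have big : ∀ y, 1 / (lam q * α) < y → (1 / y ∈ D ↔ y ∈ D) := by
    intro y hy
    have hy0 : 0 < y := lt_trans (by positivity) hy
    have := hD.inv_of_lt (1 / y) (by positivity) (by
      rw [div_lt_iff₀ hr] at hy
      rw [div_lt_iff₀ hy0]; linarith)
    rwa [one_div_one_div] at this
  induction n generalizing x with
  | zero => exact big x (by linarith)
  | succ n ih =>
    rcases lt_or_ge (1 / (lam q * α)) x with hlt | hge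
    · exact big x hlt
    · have hne : lam q * x ≠ 2 := by
        intro h2
        have : x = 2 * (1 / lam q) := by field_simp; linarith
        rw [this] at hx
        exact hx ((by simpa using isAlgebraic_natCast (R := ℚ) (A := ℝ) 2 : IsAlgebraic ℚ (2 : ℝ)).mul (by
          rw [one_div]; exact (lam_isAlgebraic q).inv))
      have hxr : lam q * α ≤ 1 / x := by
        rw [le_div_iff₀ hr] at hge
        rw [le_div_iff₀ (by linarith)]; linarith
      have hlx : lam q * x < 2 := by
        refine lt_of_le_of_ne ?_ hne
        rw [le_div_iff₀ hr] at hge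
        nlinarith [h.half_lam_le]
      have hx3 : lam q / 2 ≤ x := by linarith
      have ha := transcendental_chainParam h hx hx3 hlx
      have e1 := mem_iff_chainParam h hD (by linarith [h.le_one] : lam q * α ≤ x) hlx
      have e2 := mem_iff_chainParam h hD hxr (by
        rw [mul_one_div, div_lt_iff₀ (by linarith)]; linarith)
      have e3 : chainParam (lam q) (1 / x) = 1 / chainParam (lam q) x := by
        rw [chainParam, chainParam, one_div_div]
        field_simp
      have e4 : 2 * (x - 1) ≤ chainParam (lam q) x - 1 := by
        rw [chainParam, le_sub_iff_add_le, le_div_iff₀ (by linarith)]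
        nlinarith [mul_pos (by linarith : 0 < x - 1) (by linarith : 0 < lam q)]
      rw [e2, e1, e3]
      refine ih ha (by linarith) (hn.trans_le ?_)
      rw [pow_succ, mul_assoc]
      gcongr

theorem inv_iff (h : Params q α) (hD : TailInvariant q α D) {x : ℝ} (hx : Transcendental ℚ x) :
    1 / x ∈ D ↔ x ∈ D := by
  have gt_one : ∀ y, Transcendental ℚ y → 1 < y → (1 / y ∈ D ↔ y ∈ D) := by
    intro y hy hy1
    obtain ⟨n, hn⟩ := pow_unbounded_of_one_lt (1 / (lam q * α) / (y - 1)) (one_lt_two (α := ℝ))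
    rw [div_lt_iff₀ (by linarith)] at hn
    exact inv_iff_of_one_lt h hD n hy hy1 (by linarith)
  have pos : ∀ y, Transcendental ℚ y → 0 < y → (1 / y ∈ D ↔ y ∈ D) := by
    intro y hy hy0
    rcases lt_trichotomy y 1 with h1 | h1 | h1
    · have := gt_one (1 / y) (Transcendental.one_div_real hy) (by rwa [lt_div_iff₀ hy0, one_mul])
      rw [one_div_one_div] at this
      exact this.symm
    · rw [h1, one_div_one]
    · exact gt_one y hy h1
  rcases lt_or_gt_of_ne (Transcendental.rat_ne_zero hx) with h0 | h0
  · have := pos (-x) (Transcendental.neg_real hx) (by linarith)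
    rwa [div_neg, neg_iff h hD hx, neg_iff h hD (Transcendental.one_div_real hx)] at this
  · exact pos x hx h0

end TailInvariant

end AlphaRosen

/-! ### Convergents and the formula for Θ_n. -/

namespace AlphaRosen

variable {q : ℕ} {α : ℝ}

theorem T_transcendental {t : ℝ} (ht : Transcendental ℚ t) : Transcendental ℚ (T q α t) := by
  rw [T, if_neg (Transcendental.rat_ne_zero ht), mul_comm]
  refine Transcendental.sub_int_mul_lam ?_ q _
  rcases abs_choice (1 / t) with h | h <;> rw [h]
  · exact Transcendental.one_div_real ht
  · exact Transcendental.neg_real (Transcendental.one_div_real ht)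

theorem iterate_T_transcendental {x : ℝ} (hx : Transcendental ℚ x) (n : ℕ) :
    Transcendental ℚ ((T q α)^[n] x) := by
  induction n with
  | zero => exact hx
  | succ n ih => rw [Function.iterate_succ_apply']; exact T_transcendental ih

theorem natExt_iterate_fst (z : ℝ × ℝ) (n : ℕ) :
    ((natExt q α)^[n] z).1 = (T q α)^[n] z.1 := by
  induction n with
  | zero => rfl
  | succ n ih => rw [Function.iterate_succ_apply', Function.iterate_succ_apply', ← ih]; rfl

theorem S_succ_succ (x : ℝ) (n : ℕ) : S q α x (n + 2) =
    digit q α ((T q α)^[n + 1] x) * lam q * S q α x (n + 1) +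
      Real.sign ((T q α)^[n + 1] x) * S q α x n := rfl

theorem R_succ_succ (x : ℝ) (n : ℕ) : R q α x (n + 2) =
    digit q α ((T q α)^[n + 1] x) * lam q * R q α x (n + 1) +
      Real.sign ((T q α)^[n + 1] x) * R q α x n := rfl

theorem S_zero (x : ℝ) : S q α x 0 = 1 := rfl

theorem S_one (x : ℝ) : S q α x 1 = digit q α x * lam q := by
  simp [S, dig]

theorem R_zero (x : ℝ) : R q α x 0 = 0 := rfl

theorem R_one (x : ℝ) : R q α x 1 = Real.sign x := by
  simp [R, eps]

/-- The generic points of the interval. -/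
def generic (q : ℕ) (α : ℝ) : Set ℝ :=
  {x | x ∈ Set.Ico (lam q * (α - 1)) (lam q * α) ∧ Transcendental ℚ x}

theorem generic_T (hl : 0 < lam q) {x : ℝ} (hx : x ∈ generic q α) : T q α x ∈ generic q α :=
  ⟨T_mem hl (Transcendental.rat_ne_zero hx.2), T_transcendental hx.2⟩

theorem generic_iterate (hl : 0 < lam q) {x : ℝ} (hx : x ∈ generic q α) (n : ℕ) :
    (T q α)^[n] x ∈ generic q α := by
  induction n with
  | zero => exact hx
  | succ n ih => rw [Function.iterate_succ_apply']; exact generic_T hl ih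

theorem generic_ne_zero {x : ℝ} (hx : x ∈ generic q α) : x ≠ 0 :=
  Transcendental.rat_ne_zero hx.2

namespace Params

theorem natExt_iterate_mem (h : Params q α) {z : ℝ × ℝ} (hz : z ∈ stair q α)
    (hg : z.1 ∈ generic q α) (n : ℕ) : (natExt q α)^[n] z ∈ stair q α := by
  induction n with
  | zero => exact hz
  | succ n ih =>
    rw [Function.iterate_succ_apply']
    refine h.natExt_mem ih ?_
    rw [natExt_iterate_fst]
    exact generic_ne_zero (generic_iterate h.lam_pos hg n)

theorem zero_section_mem (h : Params q α) {x : ℝ} (hx : x ∈ generic q α) :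
    (x, (0 : ℝ)) ∈ stair q α :=
  ⟨hx.1, le_rfl, zero_le_one, fun j hj _ => h.height_mono (Nat.zero_le j) (by omega)⟩

/-- The second coordinate of the natural extension is the quotient of consecutive denominators. -/
theorem S_succ_mul (h : Params q α) {x : ℝ} (hx : x ∈ generic q α) (n : ℕ) :
    S q α x (n + 1) * ((natExt q α)^[n + 1] (x, 0)).2 = S q α x n ∧
      1 ≤ S q α x n ∧ S q α x n ≤ S q α x (n + 1) := by
  have hz := h.zero_section_mem hx
  have hden : ∀ k, 1 ≤ digit q α ((T q α)^[k] x) * lam q +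
      Real.sign ((T q α)^[k] x) * ((natExt q α)^[k] (x, 0)).2 := by
    intro k
    have := h.natExt_den_ge_one (h.natExt_iterate_mem hz hx k) (by
      rw [natExt_iterate_fst]; exact generic_ne_zero (generic_iterate h.lam_pos hx k))
    rwa [natExt_iterate_fst] at this
  have hv : ∀ k, ((natExt q α)^[k + 1] (x, 0)).2 = 1 / (digit q α ((T q α)^[k] x) * lam q +
      Real.sign ((T q α)^[k] x) * ((natExt q α)^[k] (x, 0)).2) := by
    intro k
    rw [Function.iterate_succ_apply']
    simp only [natExt]
    rw [natExt_iterate_fst]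
  induction n with
  | zero =>
    have h1 := hden 0
    rw [hv 0]
    simp only [Function.iterate_zero, id, mul_zero, add_zero, zero_add] at *
    rw [S_one, S_zero]
    exact ⟨mul_one_div_cancel (by linarith), le_rfl, h1⟩
  | succ n ih =>
    obtain ⟨h1, h2, h3⟩ := ih
    have e : S q α x (n + 2) = S q α x (n + 1) * (digit q α ((T q α)^[n + 1] x) * lam q +
        Real.sign ((T q α)^[n + 1] x) * ((natExt q α)^[n + 1] (x, 0)).2) := by
      rw [S_succ_succ, ← h1]; ring
    have h4 := hden (n + 1)
    refine ⟨?_, h2.trans h3, ?_⟩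
    · rw [hv (n + 1), e]
      field_simp
    · rw [e]
      nlinarith

theorem S_pos (h : Params q α) {x : ℝ} (hx : x ∈ generic q α) (n : ℕ) : 0 < S q α x n :=
  zero_lt_one.trans_le (h.S_succ_mul hx n).2.1

/-- S_n/S_{n+2} is the product of two consecutive second coordinates; this gives exponential growth
of the denominators. -/
theorem S_le_rate_mul (h : Params q α) {x : ℝ} (hx : x ∈ generic q α) (n : ℕ) :
    S q α x n ≤ rate q * S q α x (n + 2) := by
  have h1 := (h.S_succ_mul hx n).1
  have h2 := (h.S_succ_mul hx (n + 1)).1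
  have h3 := h.mul_natExt_le (h.natExt_iterate_mem (h.zero_section_mem hx) hx (n + 1)) (by
      rw [natExt_iterate_fst]; exact generic_ne_zero (generic_iterate h.lam_pos hx _))
  rw [← Function.iterate_succ_apply' (natExt q α)] at h3
  rw [← h1, ← h2]
  have := h.S_pos hx (n + 2)
  rw [show n + 1 + 1 = n + 2 from rfl] at *
  nlinarith

theorem tendsto_S (h : Params q α) {x : ℝ} (hx : x ∈ generic q α) :
    Tendsto (S q α x) atTop atTop := by
  have hmono : Monotone (S q α x) := monotone_nat_of_le_succ fun n => (h.S_succ_mul hx n).2.2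
  have hle : ∀ n, (rate q)⁻¹ ^ n ≤ S q α x (2 * n) := by
    intro n
    induction n with
    | zero => simp [S_zero]
    | succ n ih =>
      have h1 := h.S_le_rate_mul hx (2 * n)
      rw [pow_succ, mul_comm, inv_mul_le_iff₀ h.rate_pos]
      exact ih.trans h1
  refine tendsto_atTop_atTop_of_monotone hmono fun b => ?_
  obtain ⟨n, hn⟩ := pow_unbounded_of_one_lt b ((one_lt_inv₀ h.rate_pos).2 h.rate_lt_one)
  exact ⟨2 * n, hn.le.trans (hle n)⟩

theorem abs_det_convergents (x : ℝ) (hx : Transcendental ℚ x) (n : ℕ) :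
    |R q α x n * S q α x (n + 1) - R q α x (n + 1) * S q α x n| = 1 := by
  have hs : ∀ t : ℝ, t ≠ 0 → |Real.sign t| = 1 := by
    intro t ht
    rcases Real.sign_apply_eq_of_ne_zero t ht with h | h <;> rw [h] <;> simp
  induction n with
  | zero =>
    rw [R_zero, R_one, S_zero, zero_mul, zero_sub, mul_one, abs_neg]
    exact hs x (Transcendental.rat_ne_zero hx)
  | succ n ih =>
    rw [show n + 1 + 1 = n + 2 from rfl, R_succ_succ, S_succ_succ]
    set σ := Real.sign ((T q α)^[n + 1] x) with hσ
    have h1 : |σ| = 1 := hs _ (Transcendental.rat_ne_zero (iterate_T_transcendental hx _))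
    have e : R q α x (n + 1) * (digit q α ((T q α)^[n + 1] x) * lam q * S q α x (n + 1) +
        σ * S q α x n) - (digit q α ((T q α)^[n + 1] x) * lam q * R q α x (n + 1) +
        σ * R q α x n) * S q α x (n + 1) =
        -σ * (R q α x n * S q α x (n + 1) - R q α x (n + 1) * S q α x n) := by ring
    rw [e, abs_mul, ih, abs_neg, h1, mul_one]

/-- A point is a Möbius image of each point of its orbit. -/
theorem mul_eq_convergents {x : ℝ} (hx : Transcendental ℚ x) (n : ℕ) :
    x * (S q α x (n + 1) + S q α x n * (T q α)^[n + 1] x) =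
      R q α x (n + 1) + R q α x n * (T q α)^[n + 1] x := by
  induction n with
  | zero =>
    have h0 := Transcendental.rat_ne_zero hx
    rw [R_zero, R_one, S_zero, S_one, zero_add, Function.iterate_one, T_eq_sign_div h0]
    field_simp
    ring
  | succ n ih =>
    have ht := Transcendental.rat_ne_zero (iterate_T_transcendental (q := q) (α := α) hx (n + 1))
    rw [show n + 1 + 1 = n + 2 from rfl, R_succ_succ, S_succ_succ,
      show n + 2 = (n + 1) + 1 from rfl, Function.iterate_succ_apply' _ (n + 1), T_eq_sign_div ht]
    set t := (T q α)^[n + 1] x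
    have e := congrArg (fun y => y * (Real.sign t / t)) ih
    field_simp at e ⊢
    linear_combination e

/-- Solving the Möbius identity for x and using the unit determinant gives x - R/S = ±t/(S²(1 +
tv)), where v is the quotient of consecutive denominators. -/
theorem Theta_eq (h : Params q α) {x : ℝ} (hx : x ∈ generic q α) (n : ℕ) :
    Theta q α x (n + 1) = coeff ((natExt q α)^[n + 1] (x, 0)) := by
  have h1 := (h.S_succ_mul hx n).1
  have hS := h.S_pos hx (n + 1)
  have h2 := mul_eq_convergents (q := q) (α := α) hx.2 n
  have h3 := abs_det_convergents (q := q) (α := α) x hx.2 n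
  have hz := h.natExt_iterate_mem (h.zero_section_mem hx) hx (n + 1)
  have h4 := h.one_add_mul_pos hz.1.1 hz.2.1 hz.2.2.1
  rw [coeff]
  rw [natExt_iterate_fst] at *
  set t := (T q α)^[n + 1] x
  set v := ((natExt q α)^[n + 1] (x, 0)).2
  rw [Theta, show x - R q α x (n + 1) / S q α x (n + 1) =
    (t * (R q α x n * S q α x (n + 1) - R q α x (n + 1) * S q α x n)) /
      (S q α x (n + 1) ^ 2 * (1 + t * v)) by
    rw [← h1] at h2
    rw [eq_div_iff (by positivity), ← h1]
    field_simp
    linear_combination h2]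
  rw [abs_div, abs_mul, h3, abs_of_pos (by positivity : 0 < S q α x (n + 1) ^ 2 * (1 + t * v))]
  field_simp

end Params

end AlphaRosen

/-! ### The zero-one law for invariant sets. -/

namespace AlphaRosen

variable {q : ℕ} {α : ℝ}

/-- Reduction modulo `l` to the fundamental interval. -/
noncomputable def reduce (q : ℕ) (α y : ℝ) : ℝ := y - lam q * ⌊y / lam q + 1 - α⌋

theorem measurable_reduce : Measurable (reduce q α) := by
  unfold reduce
  exact measurable_id.sub (measurable_const.mul (measurable_from_top.comp
    (Int.measurable_floor.comp (((measurable_id.div_const _).add_const 1).sub_const α))))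

theorem T_eq_reduce (hl : 0 < lam q) {t : ℝ} (ht : t ≠ 0) : T q α t = reduce q α |1 / t| := by
  rw [T, if_neg ht, reduce, digit]
  have : |1 / (t * lam q)| = |1 / t| / lam q := by
    rw [← div_div, abs_div, abs_of_pos hl]
  rw [this]

theorem reduce_of_mem (hl : 0 < lam q) {t : ℝ}
    (ht : t ∈ Set.Ico (lam q * (α - 1)) (lam q * α)) : reduce q α t = t := by
  have : ⌊t / lam q + 1 - α⌋ = 0 := by
    rw [Int.floor_eq_iff]
    have h1 : α - 1 ≤ t / lam q := by rw [le_div_iff₀ hl]; linarith [ht.1]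
    have h2 : t / lam q < α := by rw [div_lt_iff₀ hl]; linarith [ht.2]
    push_cast
    constructor <;> linarith
  rw [reduce, this]
  simp

theorem reduce_add_lam (hl : 0 < lam q) (x : ℝ) : reduce q α (x + lam q) = reduce q α x := by
  have : (x + lam q) / lam q + 1 - α = x / lam q + 1 - α + 1 := by field_simp; ring
  rw [reduce, this, Int.floor_add_one, reduce]
  push_cast
  ring

/-- For t ≠ 0, `T` is t ↦ |1/t| followed by reduction modulo λ, so invariance of `A` becomes
invariance of its periodic extension under the unreduced branches. -/
theorem Params.tailInvariant (h : Params q α) {A : Set ℝ} (hA : T q α ⁻¹' A = A) :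
    TailInvariant q α (reduce q α ⁻¹' A) := by
  have hl := h.lam_pos
  have hα1 : lam q * (α - 1) < 0 := by linarith [h.le_one, h.one_lt_lam]
  have hT : ∀ t, t ∈ A ↔ T q α t ∈ A := fun t => by
    conv_lhs => rw [← hA]
    rfl
  refine ⟨fun x => ?_, fun x hx0 hx => ?_, fun x hx0 hx => ?_⟩
  · rw [Set.mem_preimage, Set.mem_preimage, reduce_add_lam hl]
  · rw [Set.mem_preimage, Set.mem_preimage, reduce_of_mem hl ⟨by linarith, hx⟩, hT,
      T_eq_reduce hl hx0.ne', abs_of_pos (by positivity)]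
  · rw [Set.mem_preimage, Set.mem_preimage, reduce_of_mem hl ⟨by linarith, by linarith [h.right_pos]⟩,
      hT, T_eq_reduce hl (by linarith), abs_div, abs_one, abs_neg, abs_of_pos hx0]

/-- The Möbius map given by two consecutive convergents. -/
noncomputable def convergentMap (q : ℕ) (α x : ℝ) (n : ℕ) (t : ℝ) : ℝ :=
  (R q α x (n + 1) + R q α x n * t) / (S q α x (n + 1) + S q α x n * t)

theorem TailInvariant.sign_div_iff (h : Params q α) {D : Set ℝ} (hD : TailInvariant q α D)
    {s t : ℝ} (hs : s ≠ 0) (ht : Transcendental ℚ t) (d : ℤ) :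
    Transcendental ℚ (Real.sign s / (d * lam q + t)) ∧
      (Real.sign s / (d * lam q + t) ∈ D ↔ t ∈ D) := by
  have h1 : Transcendental ℚ (t + d * lam q) := by
    have := Transcendental.sub_int_mul_lam ht q (-d)
    push_cast at this
    rwa [neg_mul, sub_neg_eq_add] at this
  have h2 := Transcendental.one_div_real h1
  have h3 : 1 / (t + d * lam q) ∈ D ↔ t ∈ D := by
    rw [inv_iff h hD h1, hD.add_int_mul]
  rw [add_comm]
  rcases Real.sign_apply_eq_of_ne_zero s hs with h4 | h4 <;> rw [h4]
  · rw [neg_div]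
    exact ⟨Transcendental.neg_real h2, (neg_iff h hD h2).trans h3⟩
  · exact ⟨h2, h3⟩

/-- The convergent map is a composition of maps t ↦ ±1/(dλ + t), each of which preserves membership
on transcendental points. -/
theorem TailInvariant.convergentMap_iff (h : Params q α) {D : Set ℝ} (hD : TailInvariant q α D)
    {x : ℝ} (hx : Transcendental ℚ x) (n : ℕ) {t : ℝ} (ht : Transcendental ℚ t) :
    convergentMap q α x n t ∈ D ↔ t ∈ D := by
  induction n generalizing t with
  | zero =>
    rw [convergentMap, R_zero, R_one, S_zero, S_one, zero_mul, add_zero, one_mul]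
    exact (hD.sign_div_iff h (Transcendental.rat_ne_zero hx) ht _).2
  | succ n ih =>
    have hs := Transcendental.rat_ne_zero (iterate_T_transcendental (q := q) (α := α) hx (n + 1))
    set s := (T q α)^[n + 1] x with hs_def
    obtain ⟨h1, h2⟩ := hD.sign_div_iff h hs ht (digit q α s)
    have h0 : digit q α s * lam q + t ≠ 0 := fun h0 => by
      rw [h0, div_zero] at h1
      exact Transcendental.rat_ne_zero h1 rfl
    rw [← h2, ← ih h1]
    have e : convergentMap q α x (n + 1) t =
        convergentMap q α x n (Real.sign s / (digit q α s * lam q + t)) := by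
      rw [convergentMap, convergentMap, show n + 1 + 1 = n + 2 from rfl, R_succ_succ, S_succ_succ,
        ← hs_def]
      symm
      rw [← mul_div_mul_left _ _ h0]
      congr 1 <;> · field_simp; ring
    rw [e]

theorem countable_algebraic : {x : ℝ | Transcendental ℚ x}ᶜ.Countable := by
  have : {x : ℝ | Transcendental ℚ x}ᶜ = {x : ℝ | IsAlgebraic ℚ x} := by
    ext x; simp [Transcendental]
  rw [this]
  exact Algebraic.countable ℚ ℝ

theorem ae_transcendental : ∀ᵐ x : ℝ, Transcendental ℚ x :=
  countable_algebraic.measure_zero volume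

theorem measurableSet_generic : MeasurableSet (generic q α) := by
  refine MeasurableSet.inter measurableSet_Ico ?_
  have := countable_algebraic.measurableSet.compl
  rwa [compl_compl] at this

namespace Params

theorem S_add_bounds (h : Params q α) {x : ℝ} (hx : x ∈ generic q α) (n : ℕ) {t : ℝ}
    (ht : t ∈ generic q α) :
    S q α x (n + 1) * (1 - lam q / 2) ≤ S q α x (n + 1) + S q α x n * t ∧
      S q α x (n + 1) + S q α x n * t ≤ 2 * S q α x (n + 1) := by
  have h1 := (h.S_succ_mul hx n).1
  have hS := h.S_pos hx (n + 1)
  have hz := h.natExt_iterate_mem (h.zero_section_mem hx) hx (n + 1)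
  have h2 := h.one_add_mul_ge (z := (t, ((natExt q α)^[n + 1] (x, 0)).2)) ht.1.1 hz.2.1 hz.2.2.1
  have h3 := hz.2.1
  have h4 := hz.2.2.1
  have h5 := h.le_one
  have h6 := ht.1.2
  simp only at h2
  rw [← h1]
  set v := ((natExt q α)^[n + 1] (x, 0)).2
  have h7 : t * v ≤ 1 := by nlinarith
  constructor <;> nlinarith

theorem convergentMap_sub (h : Params q α) {x : ℝ} (hx : x ∈ generic q α) (n : ℕ) {s t : ℝ}
    (hs : s ∈ generic q α) (ht : t ∈ generic q α) :
    convergentMap q α x n s - convergentMap q α x n t =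
      (R q α x n * S q α x (n + 1) - R q α x (n + 1) * S q α x n) * (s - t) /
        ((S q α x (n + 1) + S q α x n * s) * (S q α x (n + 1) + S q α x n * t)) := by
  have hS := h.S_pos hx (n + 1)
  have hl : 0 < 1 - lam q / 2 := by linarith [h.lam_lt_two]
  have h1 : 0 < S q α x (n + 1) + S q α x n * s :=
    lt_of_lt_of_le (by positivity) (h.S_add_bounds hx n hs).1
  have h2 : 0 < S q α x (n + 1) + S q α x n * t :=
    lt_of_lt_of_le (by positivity) (h.S_add_bounds hx n ht).1
  rw [convergentMap, convergentMap]
  rw [div_sub_div _ _ h1.ne' h2.ne']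
  congr 1
  ring

theorem injOn_convergentMap (h : Params q α) {x : ℝ} (hx : x ∈ generic q α) (n : ℕ) :
    Set.InjOn (convergentMap q α x n) (generic q α) := by
  intro s hs t ht hst
  have hS := h.S_pos hx (n + 1)
  have hl : 0 < 1 - lam q / 2 := by linarith [h.lam_lt_two]
  have h1 : 0 < S q α x (n + 1) + S q α x n * s :=
    lt_of_lt_of_le (by positivity) (h.S_add_bounds hx n hs).1
  have h2 : 0 < S q α x (n + 1) + S q α x n * t :=
    lt_of_lt_of_le (by positivity) (h.S_add_bounds hx n ht).1
  have h3 := h.convergentMap_sub hx n hs ht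
  have h4 := abs_det_convergents (q := q) (α := α) x hx.2 n
  rw [hst, sub_self, eq_comm, div_eq_zero_iff, mul_eq_zero] at h3
  rcases h3 with (h3 | h3) | h3
  · rw [h3] at h4; norm_num at h4
  · linarith
  · exact absurd h3 (mul_pos h1 h2).ne'

/-- The point x is itself the image of T^{n+1}x, so the difference formula applies, with both
denominators at least (1 - λ/2)S_{n+1}. -/
theorem abs_convergentMap_sub_le (h : Params q α) {x : ℝ} (hx : x ∈ generic q α) (n : ℕ) {t : ℝ}
    (ht : t ∈ generic q α) :
    |convergentMap q α x n t - x| ≤ lam q / (1 - lam q / 2) ^ 2 / S q α x (n + 1) ^ 2 := by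
  have hl : 0 < 1 - lam q / 2 := by linarith [h.lam_lt_two]
  have hl0 := h.lam_pos
  have hS := h.S_pos hx (n + 1)
  have hy := generic_iterate h.lam_pos hx (n + 1)
  have hb := (h.S_add_bounds hx n ht).1
  have hb' := (h.S_add_bounds hx n hy).1
  have hp : 0 < S q α x (n + 1) * (1 - lam q / 2) := by positivity
  have hxe : x = convergentMap q α x n ((T q α)^[n + 1] x) := by
    rw [convergentMap, eq_div_iff (by linarith)]
    exact mul_eq_convergents hx.2 n
  have hlt : |t - (T q α)^[n + 1] x| ≤ lam q := by
    rw [abs_sub_le_iff]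
    constructor <;> linarith [ht.1.1, ht.1.2, hy.1.1, hy.1.2]
  have key := h.convergentMap_sub hx n ht hy
  rw [← hxe] at key
  rw [key, abs_div, abs_mul, abs_det_convergents x hx.2, one_mul,
    abs_of_pos (mul_pos (hp.trans_le hb) (hp.trans_le hb')), div_div]
  have e : (1 - lam q / 2) ^ 2 * S q α x (n + 1) ^ 2 =
    (S q α x (n + 1) * (1 - lam q / 2)) * (S q α x (n + 1) * (1 - lam q / 2)) := by ring
  have hb0 := hp.le.trans hb
  rw [e]
  gcongr

theorem hasDerivAt_convergentMap (h : Params q α) {x : ℝ} (hx : x ∈ generic q α) (n : ℕ) {t : ℝ}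
    (ht : t ∈ generic q α) :
    HasDerivAt (convergentMap q α x n)
      ((R q α x n * S q α x (n + 1) - R q α x (n + 1) * S q α x n) /
        (S q α x (n + 1) + S q α x n * t) ^ 2) t := by
  have hS := h.S_pos hx (n + 1)
  have hl : 0 < 1 - lam q / 2 := by linarith [h.lam_lt_two]
  have h1 : 0 < S q α x (n + 1) + S q α x n * t :=
    lt_of_lt_of_le (by positivity) (h.S_add_bounds hx n ht).1
  have h2 : ∀ a b : ℝ, HasDerivAt (fun t : ℝ => a + b * t) b t := fun a b => by
    simpa using ((hasDerivAt_id t).const_mul b).const_add a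
  have h3 := (h2 (R q α x (n + 1)) (R q α x n)).fun_div (h2 (S q α x (n + 1)) (S q α x n)) h1.ne'
  rwa [show R q α x n * (S q α x (n + 1) + S q α x n * t) -
    (R q α x (n + 1) + R q α x n * t) * S q α x n =
    R q α x n * S q α x (n + 1) - R q α x (n + 1) * S q α x n by ring] at h3

theorem volume_image_convergentMap (h : Params q α) {x : ℝ} (hx : x ∈ generic q α) (n : ℕ)
    {E : Set ℝ} (hE : MeasurableSet E) (hsub : E ⊆ generic q α) :
    volume E * ENNReal.ofReal (1 / (4 * S q α x (n + 1) ^ 2)) ≤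
      volume (convergentMap q α x n '' E) := by
  have hS := h.S_pos hx (n + 1)
  have hl : 0 < 1 - lam q / 2 := by linarith [h.lam_lt_two]
  rw [← setLIntegral_one (convergentMap q α x n '' E),
    lintegral_image_eq_lintegral_abs_deriv_mul hE
    (fun t ht => (h.hasDerivAt_convergentMap hx n (hsub ht)).hasDerivWithinAt)
    ((h.injOn_convergentMap hx n).mono hsub), mul_comm, ← setLIntegral_const]
  refine setLIntegral_mono' hE fun t ht => ?_
  have h1 : 0 < S q α x (n + 1) + S q α x n * t :=
    lt_of_lt_of_le (by positivity) (h.S_add_bounds hx n (hsub ht)).1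
  have h2 := (h.S_add_bounds hx n (hsub ht)).2
  rw [mul_one, abs_div, abs_det_convergents x hx.2, abs_of_pos (by positivity)]
  apply ENNReal.ofReal_le_ofReal
  apply one_div_le_one_div_of_le (by positivity)
  nlinarith

/-- The zero-one law for invariant sets. -/
theorem volume_inter_eq_zero (h : Params q α) {A : Set ℝ} (hAm : MeasurableSet A)
    (hA : T q α ⁻¹' A = A) :
    volume (A ∩ Set.Ico (lam q * (α - 1)) (lam q * α)) = 0 ∨
      volume (Aᶜ ∩ Set.Ico (lam q * (α - 1)) (lam q * α)) = 0 := by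
  set J := Set.Ico (lam q * (α - 1)) (lam q * α) with hJ
  set D := reduce q α ⁻¹' A with hD_def
  have hD := h.tailInvariant hA
  have hDm : MeasurableSet D := measurable_reduce hAm
  have hDA : ∀ t ∈ J, (t ∈ D ↔ t ∈ A) := fun t ht => by
    rw [hD_def, Set.mem_preimage, reduce_of_mem h.lam_pos ht]
  have hl0 := h.lam_pos
  have hl : 0 < 1 - lam q / 2 := by linarith [h.lam_lt_two]
  set K := lam q / (1 - lam q / 2) ^ 2 with hK
  have hK0 : 0 < K := by positivity
  set E := Dᶜ ∩ generic q α with hE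
  have hEm : MeasurableSet E := hDm.compl.inter measurableSet_generic
  by_cases hE0 : volume E = 0
  · right
    refine measure_mono_null (t := E ∪ {x : ℝ | Transcendental ℚ x}ᶜ) ?_
      (measure_union_null hE0 (countable_algebraic.measure_zero volume))
    rintro t ⟨ht1, ht2⟩
    by_cases ht : Transcendental ℚ t
    · exact Or.inl ⟨fun hD' => ht1 ((hDA t ht2).1 hD'), ht2, ht⟩
    · exact Or.inr ht
  · left
    -- At almost every point of `D` the complement has density 0. The convergent maps place copies
    -- of `E` in balls of radius K/S_{n+1}² around x, which keeps the ratio above vol(E)/(8K).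
    have hae : ∀ᵐ x : ℝ, x ∈ J → x ∉ D := by
      filter_upwards [Besicovitch.ae_tendsto_measure_inter_div_of_measurableSet volume hDm.compl,
        ae_transcendental] with x hx htr hxJ hxD
      have hxg : x ∈ generic q α := ⟨hxJ, htr⟩
      have hr : Tendsto (fun n => K / S q α x (n + 1) ^ 2) atTop (𝓝[>] 0) := by
        refine tendsto_nhdsWithin_iff.2 ⟨?_, Eventually.of_forall fun n => ?_⟩
        · exact tendsto_const_nhds.div_atTop ((tendsto_pow_atTop two_ne_zero).comp
            ((tendsto_add_atTop_iff_nat 1).2 (h.tendsto_S hxg)))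
        · have := h.S_pos hxg (n + 1)
          exact Set.mem_Ioi.2 (by positivity)
      have hlim := hx.comp hr
      rw [Set.indicator_of_notMem (show x ∉ Dᶜ from fun hc => hc hxD)] at hlim
      have hge : ∀ n, volume E * ENNReal.ofReal (1 / (8 * K)) ≤
          volume (Dᶜ ∩ Metric.closedBall x (K / S q α x (n + 1) ^ 2)) /
            volume (Metric.closedBall x (K / S q α x (n + 1) ^ 2)) := by
        intro n
        have hS := h.S_pos hxg (n + 1)
        have hpos : 0 < 2 * (K / S q α x (n + 1) ^ 2) := by positivity
        rw [Real.volume_closedBall, ENNReal.le_div_iff_mul_le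
          (Or.inl (ENNReal.ofReal_pos.2 hpos).ne') (Or.inl ENNReal.ofReal_ne_top), mul_assoc,
          ← ENNReal.ofReal_mul (by positivity)]
        have e : 1 / (8 * K) * (2 * (K / S q α x (n + 1) ^ 2)) =
            1 / (4 * S q α x (n + 1) ^ 2) := by field_simp; ring
        rw [e]
        refine (h.volume_image_convergentMap hxg n hEm Set.inter_subset_right).trans
          (measure_mono ?_)
        rintro _ ⟨t, ⟨ht1, ht2⟩, rfl⟩
        refine ⟨fun hc => ht1 ((hD.convergentMap_iff h htr n ht2.2).1 hc), ?_⟩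
        rw [Metric.mem_closedBall, Real.dist_eq]
        exact h.abs_convergentMap_sub_le hxg n ht2
      have h0 := ge_of_tendsto' hlim hge
      rw [nonpos_iff_eq_zero, mul_eq_zero] at h0
      rcases h0 with h0 | h0
      · exact hE0 h0
      · rw [ENNReal.ofReal_eq_zero] at h0
        exact absurd h0 (not_le.2 (by positivity))
    refine measure_mono_null ?_ hae
    rintro t ⟨ht1, ht2⟩ hcon
    exact hcon ht2 ((hDA t ht2).2 ht1)

end Params

end AlphaRosen

/-! ### The invariant probability measure and ergodicity of the map. -/

namespace AlphaRosen

variable {q : ℕ} {α : ℝ}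

/-- The total mass of the planar domain. -/
noncomputable def mass (q : ℕ) (α : ℝ) : ℝ := (stairMeasure q α).real Set.univ

/-- The invariant probability measure of the map. -/
noncomputable def baseMeasure (q : ℕ) (α : ℝ) : Measure ℝ :=
  (stairMeasure q α Set.univ)⁻¹ • (stairMeasure q α).map Prod.fst

namespace Params

theorem absolutelyContinuous_stairMeasure (h : Params q α) :
    volume.restrict (stair q α) ≪ stairMeasure q α := by
  refine withDensity_absolutelyContinuous' measurable_invDensity.aemeasurable ?_
  filter_upwards [ae_restrict_mem measurableSet_stair] with z hz
  have := h.one_add_mul_pos hz.1.1 hz.2.1 hz.2.2.1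
  exact (ENNReal.ofReal_pos.2 (by positivity)).ne'

/-- The domain contains the full-width strip of height H_1 > 0, so the first marginal dominates
Lebesgue measure in the sense of null sets. -/
theorem volume_inter_of_stairMeasure (h : Params q α) {s : Set ℝ}
    (hs : stairMeasure q α (Prod.fst ⁻¹' s) = 0) :
    volume (s ∩ Set.Ico (lam q * (α - 1)) (lam q * α)) = 0 := by
  have hl := h.lam_pos
  have h1 := h.absolutelyContinuous_stairMeasure hs
  have h2 : volume ((s ∩ Set.Ico (lam q * (α - 1)) (lam q * α)) ×ˢ
      Set.Icc (0 : ℝ) (height (lam q) 1)) ≤ volume.restrict (stair q α) (Prod.fst ⁻¹' s) := by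
    refine le_trans (measure_mono ?_) (Measure.le_restrict_apply _ _)
    rintro ⟨t, v⟩ ⟨⟨ht1, ht2⟩, hv⟩
    refine ⟨ht1, ht2, hv.1, hv.2.trans (height_le_one h.four_le h.even
      (by have := h.four_le; omega)), fun j hj hlt => ?_⟩
    refine hv.2.trans (h.height_mono ?_ (by omega))
    by_contra hcon
    rw [show j = 0 by omega, h.thr_zero] at hlt
    exact absurd hlt (not_lt.2 ht2.1)
  rw [h1, nonpos_iff_eq_zero, Measure.volume_eq_prod, Measure.prod_prod, mul_eq_zero,
    Real.volume_Icc, ENNReal.ofReal_eq_zero] at h2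
  rcases h2 with h2 | h2
  · exact h2
  · exfalso
    simp only [height] at h2
    have : 0 < 1 / (lam q + 1) := by positivity
    linarith

theorem stairMeasure_univ_ne_zero (h : Params q α) : stairMeasure q α Set.univ ≠ 0 := by
  intro h0
  have h1 := h.volume_inter_of_stairMeasure (s := Set.univ) (by rwa [Set.preimage_univ])
  rw [Set.univ_inter, Real.volume_Ico, ENNReal.ofReal_eq_zero] at h1
  linarith [h.lam_pos]

theorem stairMeasure_univ_ne_top (h : Params q α) : stairMeasure q α Set.univ ≠ ⊤ :=
  h.stairMeasure_univ_lt_top.ne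

theorem mass_pos (h : Params q α) : 0 < mass q α :=
  ENNReal.toReal_pos h.stairMeasure_univ_ne_zero h.stairMeasure_univ_ne_top

theorem C_eq (h : Params q α) : C q α = (mass q α)⁻¹ := by
  rw [C, h.Omega_eq, mass, measureReal_def, stairMeasure_apply MeasurableSet.univ, Set.univ_inter,
    integral_eq_lintegral_of_nonneg_ae]
  · rfl
  · exact Eventually.of_forall fun z => by positivity
  · exact ((((measurable_fst.mul measurable_snd).const_add 1).pow_const 2).const_div
      1).aestronglyMeasurable

theorem baseMeasure_apply {s : Set ℝ} (hs : MeasurableSet s) :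
    baseMeasure q α s = (stairMeasure q α Set.univ)⁻¹ * stairMeasure q α (Prod.fst ⁻¹' s) := by
  rw [baseMeasure, Measure.smul_apply, Measure.map_apply measurable_fst hs, smul_eq_mul]

theorem isProbabilityMeasure_baseMeasure (h : Params q α) :
    IsProbabilityMeasure (baseMeasure q α) := by
  refine ⟨?_⟩
  rw [baseMeasure_apply MeasurableSet.univ, Set.preimage_univ]
  exact ENNReal.inv_mul_cancel h.stairMeasure_univ_ne_zero h.stairMeasure_univ_ne_top

theorem baseMeasure_real {s : Set ℝ} (hs : MeasurableSet s) :
    (baseMeasure q α).real s = (stairMeasure q α).real (Prod.fst ⁻¹' s) / mass q α := by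
  rw [measureReal_def, baseMeasure_apply hs, ENNReal.toReal_mul, ENNReal.toReal_inv, mass,
    measureReal_def, measureReal_def, div_eq_inv_mul]

theorem ergodic_T (h : Params q α) : Ergodic (T q α) (baseMeasure q α) := by
  have h1 : MeasurePreserving (T q α) ((stairMeasure q α).map Prod.fst)
      ((stairMeasure q α).map Prod.fst) :=
    MeasurePreserving.of_semiconj ⟨measurable_fst, rfl⟩ h.measurePreserving_natExt
      (fun _ => rfl) measurable_T
  refine ⟨h1.smul_measure _, ⟨fun A hA hinv => ?_⟩⟩
  have key : ∀ B : Set ℝ, MeasurableSet B →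
      volume (B ∩ Set.Ico (lam q * (α - 1)) (lam q * α)) = 0 → baseMeasure q α B = 0 := by
    intro B hB h0
    rw [baseMeasure_apply hB]
    refine mul_eq_zero_of_right _ (stairMeasure_absolutelyContinuous ?_)
    rw [Measure.restrict_apply (measurable_fst hB)]
    refine measure_mono_null (t := (B ∩ Set.Ico (lam q * (α - 1)) (lam q * α)) ×ˢ Set.univ)
      (fun z hz => ⟨⟨hz.1, hz.2.1⟩, trivial⟩) ?_
    rw [Measure.volume_eq_prod, Measure.prod_prod, h0, zero_mul]
  rw [eventuallyConst_set]
  rcases h.volume_inter_eq_zero hA hinv with h0 | h0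
  · right
    exact measure_eq_zero_iff_ae_notMem.1 (key A hA h0)
  · left
    exact key Aᶜ hA.compl h0

/-- Null sets of the invariant measure are Lebesgue null sets. -/
theorem ae_of_ae_baseMeasure (h : Params q α) {P : ℝ → Prop}
    (hP : ∀ᵐ x ∂baseMeasure q α, P x) : ∀ᵐ x ∂volume.restrict (X q α), P x := by
  obtain ⟨s, hs, hsm, hs0⟩ := exists_measurable_superset_of_null hP
  rw [baseMeasure_apply hsm, mul_eq_zero, ENNReal.inv_eq_zero] at hs0
  have h1 := h.volume_inter_of_stairMeasure (hs0.resolve_left h.stairMeasure_univ_ne_top)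
  rw [X, ← restrict_Ico_eq_restrict_Icc, ae_iff]
  refine measure_mono_null hs ?_
  rw [Measure.restrict_apply hsm, h1]

theorem ae_generic (_h : Params q α) :
    ∀ᵐ x ∂volume.restrict (X q α), x ∈ generic q α := by
  rw [X, ← restrict_Ico_eq_restrict_Icc]
  filter_upwards [ae_restrict_mem measurableSet_Ico, ae_restrict_of_ae ae_transcendental] with x h1 h2
  exact ⟨h1, h2⟩

/-! ### Finite-memory approximation and the asymptotic frequency. -/

/-- Points on the same vertical line approach each other under the natural extension. -/
theorem abs_natExt_iterate_sub_le (h : Params q α) {t v w : ℝ} (ht : t ∈ generic q α)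
    (hv : (t, v) ∈ stair q α) (hw : (t, w) ∈ stair q α) (k : ℕ) :
    |((natExt q α)^[2 * k] (t, v)).2 - ((natExt q α)^[2 * k] (t, w)).2| ≤ rate q ^ k := by
  -- One step multiplies the vertical distance by the product of the two new heights. Over two steps
  -- these factors regroup into consecutive products along each orbit, one bounded by `rate` and the
  -- other by 1.
  have step : ∀ a b : ℝ × ℝ, a ∈ stair q α → b ∈ stair q α → a.1 = b.1 → a.1 ≠ 0 →
      |(natExt q α a).2 - (natExt q α b).2| =
        (natExt q α a).2 * (natExt q α b).2 * |a.2 - b.2| := by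
    intro a b ha hb hab h0
    have d1 := h.natExt_den_ge_one ha h0
    have d2 := h.natExt_den_ge_one hb (hab ▸ h0)
    have p1 := (h.natExt_mem ha h0).2.1
    have p2 := (h.natExt_mem hb (hab ▸ h0)).2.1
    have e : (natExt q α a).2 - (natExt q α b).2 =
        (natExt q α a).2 * (natExt q α b).2 * (Real.sign a.1 * (b.2 - a.2)) := by
      simp only [natExt]
      rw [← hab] at d2 ⊢
      have d1' := (zero_lt_one.trans_le d1).ne'
      have d2' := (zero_lt_one.trans_le d2).ne'
      field_simp
      ring
    have hs : |Real.sign a.1| = 1 := by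
      rcases Real.sign_apply_eq_of_ne_zero _ h0 with h | h <;> rw [h] <;> simp
    rw [e, abs_mul, abs_mul _ (b.2 - a.2), hs, one_mul, abs_of_nonneg (mul_nonneg p1 p2),
      abs_sub_comm]
  have step2 : ∀ a b : ℝ × ℝ, a ∈ stair q α → b ∈ stair q α → a.1 = b.1 → a.1 ∈ generic q α →
      |((natExt q α)^[2] a).2 - ((natExt q α)^[2] b).2| ≤ rate q * |a.2 - b.2| := by
    intro a b ha hb hab hg
    have h0 := generic_ne_zero hg
    have ha1 := h.natExt_mem ha h0
    have hb1 := h.natExt_mem hb (hab ▸ h0)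
    have h1 : (natExt q α a).1 ≠ 0 := generic_ne_zero (generic_T h.lam_pos hg)
    have hab1 : (natExt q α a).1 = (natExt q α b).1 := by simp only [natExt]; rw [hab]
    change |(natExt q α (natExt q α a)).2 - (natExt q α (natExt q α b)).2| ≤ _
    rw [step _ _ ha1 hb1 hab1 h1, step _ _ ha hb hab h0]
    have m1 := h.mul_natExt_le ha1 h1
    have m2 := h.mul_natExt_le hb1 (hab1 ▸ h1)
    have ha2 := h.natExt_mem ha1 h1
    have hb2 := h.natExt_mem hb1 (hab1 ▸ h1)
    have hb3 : (natExt q α b).2 * (natExt q α (natExt q α b)).2 ≤ 1 := m2.trans h.rate_lt_one.le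
    have hb4 : 0 ≤ (natExt q α b).2 * (natExt q α (natExt q α b)).2 :=
      mul_nonneg hb1.2.1 hb2.2.1
    have e : (natExt q α (natExt q α a)).2 * (natExt q α (natExt q α b)).2 *
        ((natExt q α a).2 * (natExt q α b).2 * |a.2 - b.2|) =
        ((natExt q α a).2 * (natExt q α (natExt q α a)).2) *
        ((natExt q α b).2 * (natExt q α (natExt q α b)).2) * |a.2 - b.2| := by ring
    rw [e]
    refine mul_le_mul_of_nonneg_right ?_ (abs_nonneg _)
    nlinarith [mul_nonneg ha1.2.1 ha2.2.1, h.rate_pos]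
  induction k with
  | zero =>
    simp only [Nat.mul_zero, Function.iterate_zero, id, pow_zero]
    rw [abs_sub_le_iff]
    constructor <;> linarith [hv.2.1, hv.2.2.1, hw.2.1, hw.2.2.1]
  | succ k ih =>
    rw [show 2 * (k + 1) = 2 + 2 * k by ring, Function.iterate_add_apply,
      Function.iterate_add_apply _ _ _ (t, w), pow_succ']
    refine (step2 _ _ (h.natExt_iterate_mem hv ht _) (h.natExt_iterate_mem hw ht _) ?_ ?_).trans
      (mul_le_mul_of_nonneg_left ih h.rate_pos.le)
    · rw [natExt_iterate_fst, natExt_iterate_fst]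
    · rw [natExt_iterate_fst]
      exact generic_iterate h.lam_pos ht _

theorem abs_coeff_sub_le (h : Params q α) {a b : ℝ × ℝ} (ha : a ∈ stair q α) (hb : b ∈ stair q α)
    (hab : a.1 = b.1) : |coeff a - coeff b| ≤ 1 / (1 - lam q / 2) ^ 2 * |a.2 - b.2| := by
  have p1 := h.one_add_mul_ge ha.1.1 ha.2.1 ha.2.2.1
  have p2 := h.one_add_mul_ge hb.1.1 hb.2.1 hb.2.2.1
  have hl : 0 < 1 - lam q / 2 := by linarith [h.lam_lt_two]
  have ht := (h.abs_le ⟨ha.1.1, ha.1.2.le⟩).trans h.le_one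
  rw [← hab] at p2
  have q1 : 0 < 1 + a.1 * a.2 := hl.trans_le p1
  have q2 : 0 < 1 + a.1 * b.2 := hl.trans_le p2
  have e : coeff a - coeff b = |a.1| * a.1 * (b.2 - a.2) / ((1 + a.1 * a.2) * (1 + a.1 * b.2)) := by
    rw [coeff, coeff, ← hab, div_sub_div _ _ q1.ne' q2.ne']
    congr 1
    ring
  rw [e, abs_div, abs_mul, abs_mul, abs_abs, abs_of_pos (mul_pos q1 q2), abs_sub_comm b.2,
    one_div_mul_eq_div, sq]
  gcongr
  have := mul_le_one₀ ht (abs_nonneg _) ht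
  nlinarith [abs_nonneg (a.2 - b.2)]

end Params

/-- The error made by forgetting all but the last `2 k` digits. -/
noncomputable def memoryError (q k : ℕ) : ℝ := 1 / (1 - lam q / 2) ^ 2 * rate q ^ k

namespace Params

theorem tendsto_memoryError (h : Params q α) :
    Tendsto (memoryError q) atTop (𝓝 0) := by
  have := (tendsto_pow_atTop_nhds_zero_of_lt_one h.rate_pos.le h.rate_lt_one).const_mul
    (1 / (1 - lam q / 2) ^ 2)
  rwa [mul_zero] at this

theorem memoryError_nonneg (h : Params q α) (k : ℕ) : 0 ≤ memoryError q k := by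
  have := h.rate_pos
  unfold memoryError
  positivity

theorem abs_coeff_iterate_sub_le (h : Params q α) {z : ℝ × ℝ} (hz : z ∈ stair q α)
    (hg : z.1 ∈ generic q α) (k : ℕ) :
    |coeff ((natExt q α)^[2 * k] z) - coeff ((natExt q α)^[2 * k] (z.1, 0))| ≤ memoryError q k := by
  have h0 := h.zero_section_mem hg
  refine (h.abs_coeff_sub_le (h.natExt_iterate_mem hz hg _) (h.natExt_iterate_mem h0 hg _) ?_).trans
    (mul_le_mul_of_nonneg_left (h.abs_natExt_iterate_sub_le hg hz h0 k) (by positivity))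
  rw [natExt_iterate_fst, natExt_iterate_fst]

/-- The coefficient computed from the last `2 k` digits only. -/
theorem measurable_coeff_iterate (k : ℕ) :
    Measurable fun y => coeff ((natExt q α)^[2 * k] (y, 0)) :=
  measurable_coeff.comp ((measurable_natExt.iterate _).comp (measurable_id.prodMk measurable_const))

theorem ae_mem_stair :
    ∀ᵐ z ∂stairMeasure q α, z ∈ stair q α ∧ z.1 ∈ generic q α := by
  apply stairMeasure_absolutelyContinuous.ae_le
  have : ∀ᵐ z : ℝ × ℝ, Transcendental ℚ z.1 := by
    rw [ae_iff]
    refine measure_mono_null (t := {x : ℝ | Transcendental ℚ x}ᶜ ×ˢ Set.univ)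
      (fun z hz => ⟨hz, trivial⟩) ?_
    rw [Measure.volume_eq_prod, Measure.prod_prod, countable_algebraic.measure_zero, zero_mul]
  filter_upwards [ae_restrict_mem (measurableSet_stair (q := q) (α := α)),
    ae_restrict_of_ae this] with z h1 h2
  exact ⟨h1, h1.1, h2⟩

theorem stairMeasure_preimage_iterate (h : Params q α) {s : Set (ℝ × ℝ)} (hs : MeasurableSet s)
    (k : ℕ) : (stairMeasure q α).real ((natExt q α)^[k] ⁻¹' s) = (stairMeasure q α).real s := by
  rw [measureReal_def, (h.measurePreserving_natExt.iterate k).measure_preimage hs.nullMeasurableSet,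
    measureReal_def]

/-- Resetting the initial height to 0 costs `memoryError`; afterwards invariance of the planar
measure removes the 2k iterations. -/
theorem baseMeasure_lt_le (h : Params q α) (k : ℕ) {c : ℝ} (hc : 0 ≤ c) :
    (baseMeasure q α).real {y | coeff ((natExt q α)^[2 * k] (y, 0)) < c} ≤
      lam q * (c + memoryError q k) / mass q α := by
  have := h.isFiniteMeasure_stairMeasure
  have hk := h.memoryError_nonneg k
  have hl := h.lam_pos
  rw [baseMeasure_real (measurableSet_lt (measurable_coeff_iterate k) measurable_const)]
  refine div_le_div_of_nonneg_right ?_ h.mass_pos.le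
  have h1 : (stairMeasure q α).real (Prod.fst ⁻¹' {y | coeff ((natExt q α)^[2 * k] (y, 0)) < c}) ≤
      (stairMeasure q α).real ((natExt q α)^[2 * k] ⁻¹' smallCoeff (c + memoryError q k)) := by
    refine ENNReal.toReal_mono (measure_ne_top _ _) (measure_mono_ae ?_)
    filter_upwards [ae_mem_stair] with z ⟨hz1, hz2⟩ hz
    have h2 := (abs_sub_le_iff.1 (h.abs_coeff_iterate_sub_le hz1 hz2 k)).1
    change coeff ((natExt q α)^[2 * k] (z.1, 0)) < c at hz
    change coeff ((natExt q α)^[2 * k] z) < c + memoryError q k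
    linarith
  refine h1.trans ?_
  rw [h.stairMeasure_preimage_iterate (measurableSet_smallCoeff _)]
  exact ENNReal.toReal_le_of_le_ofReal (by positivity) (h.stairMeasure_smallCoeff_le (by linarith))

/-- The complementary estimate needs the exact mass, hence c ≤ L. -/
theorem baseMeasure_ge_le (h : Params q α) (k : ℕ) {c : ℝ} (hc : memoryError q k ≤ c)
    (hcL : c ≤ L q α) :
    (baseMeasure q α).real {y | c ≤ coeff ((natExt q α)^[2 * k] (y, 0))} ≤
      1 - lam q * (c - memoryError q k) / mass q α := by
  have := h.isFiniteMeasure_stairMeasure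
  have hk := h.memoryError_nonneg k
  have hl := h.lam_pos
  rw [baseMeasure_real (measurableSet_le measurable_const (measurable_coeff_iterate k)),
    div_le_iff₀ h.mass_pos, sub_mul, one_mul, div_mul_cancel₀ _ h.mass_pos.ne']
  have h1 : (stairMeasure q α).real (Prod.fst ⁻¹' {y | c ≤ coeff ((natExt q α)^[2 * k] (y, 0))}) ≤
      (stairMeasure q α).real ((natExt q α)^[2 * k] ⁻¹' (smallCoeff (c - memoryError q k))ᶜ) := by
    refine ENNReal.toReal_mono (measure_ne_top _ _) (measure_mono_ae ?_)
    filter_upwards [ae_mem_stair] with z ⟨hz1, hz2⟩ hz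
    have h2 := (abs_sub_le_iff.1 (h.abs_coeff_iterate_sub_le hz1 hz2 k)).2
    change c ≤ coeff ((natExt q α)^[2 * k] (z.1, 0)) at hz
    change ¬ coeff ((natExt q α)^[2 * k] z) < c - memoryError q k
    linarith
  refine h1.trans ?_
  rw [h.stairMeasure_preimage_iterate (measurableSet_smallCoeff _).compl,
    measureReal_compl (measurableSet_smallCoeff _), mass, measureReal_def (s := smallCoeff _),
    h.stairMeasure_smallCoeff_of_le (by linarith) (by linarith),
    ENNReal.toReal_ofReal (mul_nonneg hl.le (by linarith))]

end Params

/-- If `P (j + m)` implies `Q j`, then `P` holds at most `m` times more often than `Q`. -/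
theorem card_filter_le {P Q : ℕ → Prop} [DecidablePred P] [DecidablePred Q] (m N : ℕ)
    (hPQ : ∀ j, P (j + m) → Q j) :
    ((Finset.Icc 1 N).filter P).card ≤ m + ((Finset.range (N + 1)).filter Q).card := by
  have hsub : (Finset.Icc 1 N).filter P ⊆ (Finset.range m) ∪
      ((Finset.range (N + 1)).filter Q).image (fun j : ℕ => j + m) := by
    intro n hn
    rw [Finset.mem_filter, Finset.mem_Icc] at hn
    rw [Finset.mem_union, Finset.mem_range, Finset.mem_image]
    by_cases hm : n < m
    · exact Or.inl hm
    · refine Or.inr ⟨n - m, ?_, by omega⟩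
      rw [Finset.mem_filter, Finset.mem_range]
      refine ⟨by omega, hPQ _ ?_⟩
      rw [Nat.sub_add_cancel (not_lt.1 hm)]
      exact hn.2
  have h1 := Finset.card_union_le (Finset.range m)
    (((Finset.range (N + 1)).filter Q).image (fun j : ℕ => j + m))
  have h2 := Finset.card_image_le (s := (Finset.range (N + 1)).filter Q) (f := fun j : ℕ => j + m)
  have h3 := Finset.card_le_card hsub
  rw [Finset.card_range] at h1
  omega

namespace Params

theorem abs_coeff_sub_memory_le (h : Params q α) {x : ℝ} (hx : x ∈ generic q α) (k j : ℕ) :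
    |coeff ((natExt q α)^[j + 2 * k] (x, 0)) -
      coeff ((natExt q α)^[2 * k] ((T q α)^[j] x, 0))| ≤ memoryError q k := by
  have hz := h.natExt_iterate_mem (h.zero_section_mem hx) hx j
  have h1 := h.abs_coeff_iterate_sub_le hz (by
    rw [natExt_iterate_fst]; exact generic_iterate h.lam_pos hx j) k
  rwa [natExt_iterate_fst, ← Function.iterate_add_apply, add_comm (2 * k)] at h1

theorem filter_Theta_eq (h : Params q α) {x : ℝ} (hx : x ∈ generic q α) (c : ℝ) (N : ℕ) :
    (Finset.Icc 1 N).filter (fun n => Theta q α x n < c) =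
      (Finset.Icc 1 N).filter (fun n => coeff ((natExt q α)^[n] (x, 0)) < c) := by
  refine Finset.filter_congr fun n hn => ?_
  obtain ⟨m, rfl⟩ : ∃ m, n = m + 1 := ⟨n - 1, by have := (Finset.mem_Icc.1 hn).1; omega⟩
  rw [h.Theta_eq hx]

/-- Upper bound for the frequency of small approximation coefficients. -/
theorem ae_card_le (h : Params q α) {c s : ℝ} (hc : 0 ≤ c) (hs : lam q * c / mass q α < s) :
    ∀ᵐ x ∂volume.restrict (X q α), ∃ b : ℝ, ∀ N : ℕ,
      (((Finset.Icc 1 N).filter (fun n => Theta q α x n < c)).card : ℝ) ≤ N * s + b := by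
  have hprob := h.isProbabilityMeasure_baseMeasure
  -- The error enters twice: once in replacing Θ_n by the finite-memory coefficient along the orbit,
  -- once in the measure of the resulting set.
  obtain ⟨k, hk⟩ : ∃ k, lam q * (c + memoryError q k + memoryError q k) / mass q α < s := by
    have h1 : Tendsto (fun k => lam q * (c + memoryError q k + memoryError q k) / mass q α) atTop
        (𝓝 (lam q * (c + 0 + 0) / mass q α)) :=
      (((h.tendsto_memoryError.const_add c).add h.tendsto_memoryError).const_mul _).div_const _
    rw [add_zero, add_zero] at h1
    exact (h1.eventually (gt_mem_nhds hs)).exists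
  have hk0 := h.memoryError_nonneg k
  have hB := ae_card_visits_le h.ergodic_T
    (measurableSet_lt (measurable_coeff_iterate (q := q) (α := α) k)
      (measurable_const (a := c + memoryError q k)))
    ((h.baseMeasure_lt_le k (by linarith)).trans_lt hk)
  filter_upwards [h.ae_of_ae_baseMeasure hB, h.ae_generic] with x ⟨b, hb⟩ hx
  -- The shift by 2k loses at most 2k indices, and visits are counted over N + 1 times, which adds
  -- one s.
  refine ⟨2 * k + s + b, fun N => ?_⟩
  rw [h.filter_Theta_eq hx]
  classical
  have h1 := card_filter_le (P := fun n => coeff ((natExt q α)^[n] (x, 0)) < c)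
    (Q := fun j => (T q α)^[j] x ∈ {y | coeff ((natExt q α)^[2 * k] (y, 0)) < c + memoryError q k})
    (2 * k) N (fun j hj => by
      have := (abs_sub_le_iff.1 (h.abs_coeff_sub_memory_le hx k j)).2
      change coeff ((natExt q α)^[2 * k] ((T q α)^[j] x, 0)) < c + memoryError q k
      linarith)
  have h2 := hb (N + 1)
  have h3 : (((Finset.Icc 1 N).filter (fun n => coeff ((natExt q α)^[n] (x, 0)) < c)).card : ℝ) ≤
      2 * k + (((Finset.range (N + 1)).filter (fun j => (T q α)^[j] x ∈
        {y | coeff ((natExt q α)^[2 * k] (y, 0)) < c + memoryError q k})).card : ℝ) := by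
    exact_mod_cast h1
  have h6 : (((Finset.range (N + 1)).filter (fun j => (T q α)^[j] x ∈
        {y | coeff ((natExt q α)^[2 * k] (y, 0)) < c + memoryError q k})).card : ℝ) ≤
      ((N + 1 : ℕ) : ℝ) * s + b := by
    convert h2
    exact Iff.rfl
  push_cast at h6
  linarith

/-- Lower bound for the frequency of small approximation coefficients. -/
theorem ae_le_card (h : Params q α) {c s : ℝ} (hc : 0 < c) (hcL : c ≤ L q α)
    (hs : s < lam q * c / mass q α) :
    ∀ᵐ x ∂volume.restrict (X q α), ∃ b : ℝ, ∀ N : ℕ,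
      N * s - b ≤ (((Finset.Icc 1 N).filter (fun n => Theta q α x n < c)).card : ℝ) := by
  have hprob := h.isProbabilityMeasure_baseMeasure
  obtain ⟨k, hk, hk2⟩ : ∃ k, s < lam q * (c - memoryError q k - memoryError q k) / mass q α ∧
      2 * memoryError q k < c := by
    have h1 : Tendsto (fun k => lam q * (c - memoryError q k - memoryError q k) / mass q α) atTop
        (𝓝 (lam q * (c - 0 - 0) / mass q α)) :=
      (((h.tendsto_memoryError.const_sub c).sub h.tendsto_memoryError).const_mul _).div_const _
    rw [sub_zero, sub_zero] at h1
    have h2 := h.tendsto_memoryError.const_mul 2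
    rw [mul_zero] at h2
    exact ((h1.eventually (lt_mem_nhds hs)).and (h2.eventually (gt_mem_nhds hc))).exists
  have hk0 := h.memoryError_nonneg k
  have hB := ae_card_visits_le (s := 1 - s) h.ergodic_T
    (measurableSet_le (measurable_const (a := c - memoryError q k))
      (measurable_coeff_iterate (q := q) (α := α) k))
    ((h.baseMeasure_ge_le k (by linarith) (by linarith)).trans_lt (by linarith))
  filter_upwards [h.ae_of_ae_baseMeasure hB, h.ae_generic] with x ⟨b, hb⟩ hx
  refine ⟨2 * k + (1 - s) + b, fun N => ?_⟩
  rw [h.filter_Theta_eq hx]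
  classical
  have h1 := card_filter_le (P := fun n => ¬ coeff ((natExt q α)^[n] (x, 0)) < c)
    (Q := fun j => (T q α)^[j] x ∈ {y | c - memoryError q k ≤ coeff ((natExt q α)^[2 * k] (y, 0))})
    (2 * k) N (fun j hj => by
      have := (abs_sub_le_iff.1 (h.abs_coeff_sub_memory_le hx k j)).1
      change c - memoryError q k ≤ coeff ((natExt q α)^[2 * k] ((T q α)^[j] x, 0))
      linarith)
  have h2 := hb (N + 1)
  have h0 := Finset.card_filter_add_card_filter_not (s := Finset.Icc 1 N)
    (fun n => coeff ((natExt q α)^[n] (x, 0)) < c)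
  rw [Nat.card_Icc, Nat.add_sub_cancel] at h0
  have h3 : (N : ℝ) - (((Finset.Icc 1 N).filter
      (fun n => coeff ((natExt q α)^[n] (x, 0)) < c)).card : ℝ) ≤
      2 * k + (((Finset.range (N + 1)).filter (fun j => (T q α)^[j] x ∈
        {y | c - memoryError q k ≤ coeff ((natExt q α)^[2 * k] (y, 0))})).card : ℝ) := by
    have h4 : N ≤ ((Finset.Icc 1 N).filter (fun n => coeff ((natExt q α)^[n] (x, 0)) < c)).card +
        (2 * k + ((Finset.range (N + 1)).filter (fun j => (T q α)^[j] x ∈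
        {y | c - memoryError q k ≤ coeff ((natExt q α)^[2 * k] (y, 0))})).card) := by
      conv_lhs => rw [← h0]
      gcongr
    have h5 := (Nat.cast_le (α := ℝ)).2 h4
    push_cast at h5
    linarith
  have h6 : (((Finset.range (N + 1)).filter (fun j => (T q α)^[j] x ∈
        {y | c - memoryError q k ≤ coeff ((natExt q α)^[2 * k] (y, 0))})).card : ℝ) ≤
      ((N + 1 : ℕ) : ℝ) * (1 - s) + b := by
    convert h2
    exact Iff.rfl
  push_cast at h6
  linarith

/-- The asymptotic frequency of small approximation coefficients. -/
theorem ae_tendsto_frequency (h : Params q α) :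
    ∀ᵐ x ∂(volume.restrict (X q α)), ∀ z : ℝ, 0 < z → z ≤ L q α →
      Tendsto (fun N : ℕ => (((Finset.Icc 1 N).filter (fun n => Theta q α x n < z)).card : ℝ) / N)
        atTop (𝓝 (lam q * z / mass q α)) := by
  have hl := h.lam_pos
  have hm := h.mass_pos
  -- Rational thresholds and slopes give a single exceptional null set; monotonicity of the count in
  -- the threshold then yields all real z simultaneously.
  have hup : ∀ᵐ x ∂(volume.restrict (X q α)), ∀ c s : ℚ, 0 ≤ (c : ℝ) →
      lam q * c / mass q α < s → ∃ b : ℝ, ∀ N : ℕ,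
      (((Finset.Icc 1 N).filter (fun n => Theta q α x n < c)).card : ℝ) ≤ N * s + b := by
    simp only [ae_all_iff]
    exact fun c s hc hs => h.ae_card_le hc hs
  have hlow : ∀ᵐ x ∂(volume.restrict (X q α)), ∀ c s : ℚ, 0 < (c : ℝ) → (c : ℝ) ≤ L q α →
      (s : ℝ) < lam q * c / mass q α → ∃ b : ℝ, ∀ N : ℕ,
      N * s - b ≤ (((Finset.Icc 1 N).filter (fun n => Theta q α x n < c)).card : ℝ) := by
    simp only [ae_all_iff]
    exact fun c s hc hcL hs => h.ae_le_card hc hcL hs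
  have hcard : ∀ (x : ℝ) (N : ℕ) (a b : ℝ), a ≤ b →
      (((Finset.Icc 1 N).filter (fun n => Theta q α x n < a)).card : ℝ) ≤
        (((Finset.Icc 1 N).filter (fun n => Theta q α x n < b)).card : ℝ) := by
    intro x N a b hab
    have : (Finset.Icc 1 N).filter (fun n => Theta q α x n < a) ⊆
        (Finset.Icc 1 N).filter (fun n => Theta q α x n < b) := fun n hn => by
      rw [Finset.mem_filter] at hn ⊢
      exact ⟨hn.1, hn.2.trans_le hab⟩
    exact_mod_cast Finset.card_le_card this
  have hlin : ∀ s b : ℝ, Tendsto (fun N : ℕ => (N * s + b) / N) atTop (𝓝 s) := by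
    intro s b
    have h1 : Tendsto (fun N : ℕ => s + b / N) atTop (𝓝 (s + 0)) :=
      (tendsto_const_div_atTop_nhds_zero_nat b).const_add s
    rw [add_zero] at h1
    refine h1.congr' ?_
    filter_upwards [eventually_gt_atTop 0] with N hN
    have : (N : ℝ) ≠ 0 := by exact_mod_cast hN.ne'
    field_simp
  filter_upwards [hup, hlow] with x hx1 hx2 z hz hzL
  rw [tendsto_order]
  constructor
  · intro a ha
    obtain ⟨s, hs1, hs2⟩ := exists_rat_btwn ha
    -- The threshold is taken below z, so that c ≤ L, yet close enough that λc/mass still exceeds s.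
    obtain ⟨c, hc1, hc2⟩ : ∃ c : ℚ, max 0 (s * mass q α / lam q) < c ∧ (c : ℝ) < z := by
      refine exists_rat_btwn (max_lt hz ?_)
      rw [lt_div_iff₀ hm] at hs2
      rw [div_lt_iff₀ hl]
      linarith
    obtain ⟨hc0, hcs⟩ := max_lt_iff.1 hc1
    obtain ⟨b, hb⟩ := hx2 c s hc0 (hc2.le.trans hzL) (by
      rw [div_lt_iff₀ hl] at hcs
      rw [lt_div_iff₀ hm]
      linarith)
    filter_upwards [(hlin s (-b)).eventually (lt_mem_nhds hs1)] with N hN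
    refine hN.trans_le (div_le_div_of_nonneg_right ?_ (Nat.cast_nonneg N))
    have := hb N
    have := hcard x N c z hc2.le
    linarith
  · intro a ha
    obtain ⟨s, hs1, hs2⟩ := exists_rat_btwn ha
    obtain ⟨c, hc1, hc2⟩ : ∃ c : ℚ, z < c ∧ (c : ℝ) < s * mass q α / lam q := by
      refine exists_rat_btwn ?_
      rw [div_lt_iff₀ hm] at hs1
      rw [lt_div_iff₀ hl]
      linarith
    obtain ⟨b, hb⟩ := hx1 c s (hz.trans hc1).le (by
      rw [lt_div_iff₀ hl] at hc2
      rw [div_lt_iff₀ hm]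
      linarith)
    filter_upwards [(hlin s b).eventually (gt_mem_nhds hs2)] with N hN
    refine lt_of_le_of_lt (div_le_div_of_nonneg_right ?_ (Nat.cast_nonneg N)) hN
    exact (hcard x N z c hc1.le).trans (hb N)

theorem L_pos (h : Params q α) : 0 < L q α := by
  have h1 := h.one_lt_lam
  have h2 := h.lam_lt_two
  have h3 := h.lam_mul_lt_two
  refine lt_min (by positivity) (div_pos (mul_pos h.lam_pos ?_) ?_) <;> nlinarith

end Params

end AlphaRosen

theorem mainTheorem12 (q : ℕ) (hq : 4 ≤ q) (hqe : Even q) (α : ℝ) (hα : 1 / 2 ≤ α)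
    (hα' : α ≤ 1 / AlphaRosen.lam q) :
    ∀ᵐ x ∂(volume.restrict (AlphaRosen.X q α)), ∀ c : ℝ, 1 / AlphaRosen.L q α ≤ c →
      Tendsto
        (fun N : ℕ =>
          (((Finset.Icc 1 N).filter (fun n : ℕ => AlphaRosen.Theta q α x n < 1 / c)).card : ℝ) / N)
        atTop (𝓝 (AlphaRosen.lam q * AlphaRosen.C q α / c)) := by
  have h : AlphaRosen.Params q α := ⟨hq, hqe, hα, hα'⟩
  filter_upwards [h.ae_tendsto_frequency] with x hx c hc
  have hL := h.L_pos
  have hc0 : 0 < c := lt_of_lt_of_le (one_div_pos.2 hL) hc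
  have h1 : 1 / c ≤ AlphaRosen.L q α := by
    rw [div_le_iff₀ hL] at hc
    rw [div_le_iff₀ hc0]
    linarith
  have h2 := hx (1 / c) (one_div_pos.2 hc0) h1
  rwa [show AlphaRosen.lam q * (1 / c) / AlphaRosen.mass q α =
    AlphaRosen.lam q * AlphaRosen.C q α / c by rw [h.C_eq]; ring] at h2
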